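/- **Setting.** Let $p,d\in\mathbb N$, let $\mathcal H$ be the reproducing kernel Hilbert space of a kernel $k:\mathbb R^d\times\mathbb R^d\to\mathbb R$, and fix a test point $\mathbf x\in[0,1]^p$. The observations $\mathbf Z_i=(\mathbf X_i,\mathbf Y_i)\in[0,1]^p\times\mathbb R^d$ are i.i.d. copies of $(\mathbf X,\mathbf Y)$; conditional expectations given $\mathbf X=\mathbf u$ refer to a fixed regular conditional law of $\mathbf Y$ given $\mathbf X$. For a square integrable random element $\xi$ of $\mathcal H$, $\mathrm{Var}(\xi)=\mathbb E\|\xi-\mathbb E\xi\|_{\mathcal H}^2$. Put $\mu(\mathbf u)=\mathbb E[k(\mathbf Y,\cdot)\mid\mathbf X=\mathbf u]$. **Trees.** For each $n$ a randomized tree-growing procedure is given. It takes $s_n$ observations and a uniformly random partition of their indices into halves $\mathcal I_1,\mathcal I_2$ with $|\mathcal I_2|=\lceil s_n/2\rceil$, and returns, using auxiliary randomness independent of the data and of the partition, a finite binary tree of axis-aligned splits $\{u_j<c\}$, $\{u_j\ge c\}$ of $[0,1]^p$ (measurably in the data and the randomness). Let $\mathcal L(\mathbf x)$ be its leaf containing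 $\mathbf x$, $S_i=\mathbf 1\{\mathbf X_i\in\mathcal L(\mathbf x)\}/|\{j\in\mathcal I_2:\mathbf X_j\in\mathcal L(\mathbf x)\}|$ for $i\in\mathcal I_2$, let $T(\mathbf Z_1,\dots,\mathbf Z_{s_n})$ be $\sum_{i\in\mathcal I_2}S_i\,k(\mathbf Y_i,\cdot)$ with the partition and the auxiliary randomness integrated out, and $$T_n(\mathbf Z_1)=\mathbb E[T(\mathbf Z_1,\dots,\mathbf Z_{s_n})\mid\mathbf Z_1]-\mathbb E[T(\mathbf Z_1,\dots,\mathbf Z_{s_n})].$$ **Assumptions on the forest**, with constants $\pi>0$, $0<\alpha\le 0.2$, $\kappa\ge1$ integer, $\beta$ not depending on $n$; those that refer to $\mathcal I_2$ are understood for each fixed value of $(\mathcal I_1,\mathcal I_2)$: * (DRF-F1, honesty) the tree depends on the data only through $(\mathbf X_i,\mathbf Y_i)_{i\in\mathcal I_1}$ and $(\mathbf X_i)_{i\in\mathcal I_2}$; * (DRF-F2, random split) given the data, at every split point and conditionally on the splits at its ancestors, each feature $j$ is split with probability at least $\pi/p$; * (DRF-F3, symmetry) the law of the leaf of any test point does not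 change when the observations, with their roles in $\mathcal I_1$ or $\mathcal I_2$, are relabelled; * (DRF-F4, $\alpha$-regularity) almost surely, each split leaves at least a fraction $\alpha$ of the parent's $\mathcal I_2$-observations in each child, and every leaf contains between $\kappa$ and $2\kappa-1$ of the $\mathcal I_2$-observations (as soon as $|\mathcal I_2|\ge\kappa$); * (DRF-F5) $s_n\geq 1$ is $n^\beta$ up to rounding, i.e. $|s_n-n^\beta|<1$ for $n\ge1$, with $1>\beta>\bigl(1+\tfrac{\log((1-\alpha)^{-1})}{\log(\alpha^{-1})}\tfrac{\pi}{p}\bigr)^{-1}$; * (DRF-F1*, honesty*) there is $\varepsilon>0$ such that, for all measurable $\mathcal H$-valued functions $f=f_n$ that are bounded uniformly in $n$, as $n\to\infty$, uniformly over $i\in\mathcal I_2$, $$\mathrm{Var}\bigl(\mathbb E[f(\mathcal L(\mathbf x))\mid\mathbf X_i]\bigr)=o\bigl(s_n^{-(1+\varepsilon)}\bigr),$$ and, with $F_i=f\bigl((\mathbf X_j,\mathbf 1\{\mathbf X_j\in\mathcal L(\mathbf x)\})_{j\in\mathcal I_2,\,j\ne i}\bigr)$ (where $f$ may also depend on $i$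 and on $\mathcal I_2$), $$\mathbb E\Bigl[\bigl\|\mathbb E[F_i\mid\mathbf 1\{\mathbf X_i\notin\mathcal L(\mathbf x)\},\mathcal L(\mathbf x),\mathbf X_i]-\mathbb E[F_i\mid\mathbf 1\{\mathbf X_i\notin\mathcal L(\mathbf x)\},\mathcal L(\mathbf x)]\bigr\|_{\mathcal H}^2\Bigr]=o\bigl(s_n^{-(1+\varepsilon)}\bigr).$$ **Assumptions on the data:** * (DRF-D1) $\mathbf X$ has a density on $[0,1]^p$ bounded away from $0$ and infinity; * (DRF-D2), (DRF-D3) $\mathbf u\mapsto\mu(\mathbf u)\in\mathcal H$ and $\mathbf u\mapsto\mathbb E[\|k(\mathbf Y,\cdot)\|_{\mathcal H}^2\mid\mathbf X=\mathbf u]$ are Lipschitz on $[0,1]^p$; * (DRF-D4) $\mathrm{Var}(k(\mathbf Y,\cdot)\mid\mathbf X=\mathbf x)>0$; * (DRF-D5) for some $\delta>0$ and $M$, $\mathbb E[\|k(\mathbf Y,\cdot)-\mu(\mathbf u)\|_{\mathcal H}^{2+\delta}\mid\mathbf X=\mathbf u]\le M$ for all $\mathbf u\in[0,1]^p$; * (DRF-D6),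 (DRF-D7) for every $f\in\mathcal H\setminus\{0\}$, $\mathrm{Var}(f(\mathbf Y)\mid\mathbf X=\mathbf x)>0$, and $\mathbf u\mapsto\mathbb E[|f(\mathbf Y)|^2\mid\mathbf X=\mathbf u]$ is Lipschitz on $[0,1]^p$. **Assumptions on the kernel:** (K1) $\sup_{\mathbf y,\mathbf y'}k(\mathbf y,\mathbf y')<\infty$; (K2) $k$ is jointly continuous. **Theorem.** Under these assumptions, for every $f\in\mathcal H\setminus\{0\}$, $$\lim_{n\to\infty}\frac{\mathrm{Var}(\langle T_n(\mathbf Z_1),f\rangle)}{\mathrm{Var}(T_n(\mathbf Z_1))}=\frac{\mathrm{Var}(f(\mathbf Y)\mid\mathbf X=\mathbf x)}{\mathrm{Var}(k(\mathbf Y,\cdot)\mid\mathbf X=\mathbf x)}>0.$$ -/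

import Mathlib

open MeasureTheory ProbabilityTheory Filter Topology
open scoped ENNReal NNReal RealInnerProductSpace

noncomputable section

namespace DRF

/-! ### Hilbert-space-valued variance and the kernel of an RKHS -/

/-- `Var(ξ) = E ‖ξ - E ξ‖²` for a random element `ξ` of a Hilbert space. -/
def hilbertVar {Ω V : Type*} [MeasurableSpace Ω] [NormedAddCommGroup V] [InnerProductSpace ℝ V]
    (P : Measure Ω) (ξ : Ω → V) : ℝ :=
  ∫ ω, ‖ξ ω - ∫ ω', ξ ω' ∂P‖ ^ 2 ∂P

/-- Covariate space `ℝ^p`. -/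
abbrev Cov (p : ℕ) : Type := EuclideanSpace ℝ (Fin p)

/-- Response space `ℝ^d`. -/
abbrev Resp (d : ℕ) : Type := EuclideanSpace ℝ (Fin d)

/-- One observation `Z = (X, Y)`. -/
abbrev Obs (p d : ℕ) : Type := Cov p × Resp d

section Kernel

variable {d : ℕ} (H : Type*) [NormedAddCommGroup H] [InnerProductSpace ℝ H] [CompleteSpace H]
  [RKHS ℝ H (Resp d) ℝ]

/-- The element `k(y, ·)` of the reproducing kernel Hilbert space `H`. -/
def feature (y : Resp d) : H := RKHS.kerFun H y (1 : ℝ)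

/-- The reproducing kernel `k(y, y')` of `H`. -/
def kernelFn (y y' : Resp d) : ℝ := RKHS.kernel H y y' (1 : ℝ)

/-- The kernel is bounded above. -/
def KernelBounded : Prop :=
  BddAbove (Set.range fun q : Resp d × Resp d => kernelFn H q.1 q.2)

/-- The kernel is jointly continuous. -/
def KernelContinuous : Prop :=
  Continuous fun q : Resp d × Resp d => kernelFn H q.1 q.2

end Kernel

/-! ### Cells and trees -/

/-- The cube `[0,1]^p`. -/
def cube (p : ℕ) : Set (Cov p) := {u | ∀ j, u j ∈ Set.Icc (0 : ℝ) 1}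

/-- An axis-aligned cell, given by its lower and its upper endpoints. -/
abbrev Cell (p : ℕ) : Type := (Fin p → EReal) × (Fin p → EReal)

/-- The points of `[0,1]^p` in a cell. -/
def Cell.toSet {p : ℕ} (C : Cell p) : Set (Cov p) :=
  {u | u ∈ cube p ∧ ∀ j, C.1 j ≤ (u j : EReal) ∧ (u j : EReal) < C.2 j}

/-- The cell that is all of `[0,1]^p`. -/
def Cell.root (p : ℕ) : Cell p := (fun _ => ⊥, fun _ => ⊤)

/-- The part `u j < c` of a cell. -/
def Cell.left {p : ℕ} (C : Cell p) (j : Fin p) (c : ℝ) : Cell p :=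
  (C.1, Function.update C.2 j (min (C.2 j) (c : EReal)))

/-- The part `c ≤ u j` of a cell. -/
def Cell.right {p : ℕ} (C : Cell p) (j : Fin p) (c : ℝ) : Cell p :=
  (Function.update C.1 j (max (C.1 j) (c : EReal)), C.2)

/-- A finite binary tree of axis-aligned splits: `node j c l r` sends the points with `u j < c` to
`l` and those with `c ≤ u j` to `r`. -/
inductive SplitTree (p : ℕ) : Type
  | leaf : SplitTree p
  | node (j : Fin p) (c : ℝ) (l r : SplitTree p) : SplitTree p

namespace SplitTree

variable {p : ℕ}

open Classical in
/-- The leaf that contains `x`, for a tree whose root is the cell `C`. -/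
def leafFrom : SplitTree p → Cell p → Cov p → Cell p
  | leaf, C, _ => C
  | node j c l r, C, x =>
      if x j < c then leafFrom l (C.left j c) x else leafFrom r (C.right j c) x

/-- The leaf `L(x)` of a tree on `[0,1]^p` that contains `x`. -/
def leafAt (τ : SplitTree p) (x : Cov p) : Cell p := τ.leafFrom (Cell.root p) x

/-- The split (feature, threshold) at the node with address `a` (`false`: go left, `true`: go
right), or `Sum.inr ()` if there is no split at that address. -/
def splitAt : SplitTree p → List Bool → (Fin p × ℝ) ⊕ Unit
  | leaf, _ => Sum.inr ()
  | node j c _ _, [] => Sum.inl (j, c)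
  | node _ _ l r, b :: a => cond b (splitAt r a) (splitAt l a)

/-- The splits at all strict ancestors of the address `a`. -/
def history (a : List Bool) (τ : SplitTree p) : Fin a.length → (Fin p × ℝ) ⊕ Unit :=
  fun m => τ.splitAt (a.take m)

/-- A random tree is measurable when all its splits are. -/
instance : MeasurableSpace (SplitTree p) :=
  MeasurableSpace.comap splitAt MeasurableSpace.pi

/-- With `N C` the number of training points in the cell `C`: every split leaves at least the
fraction `α` of the points of the parent node in each child node, and every leaf contains between
`κ` and `2 κ - 1` points. -/
def IsRegular (α : ℝ) (κ : ℕ) (N : Cell p → ℕ) : SplitTree p → Cell p → Prop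
  | leaf, C => κ ≤ N C ∧ N C ≤ 2 * κ - 1
  | node j c l r, C =>
      α * N C ≤ N (C.left j c) ∧ α * N C ≤ N (C.right j c) ∧
      IsRegular α κ N l (C.left j c) ∧ IsRegular α κ N r (C.right j c)

end SplitTree

/-! ### Randomized tree-growing procedures on a sample of size `s` -/

/-- A measurable randomized procedure that grows a tree from a sample of size `s`, given the set
`I₂ ⊆ {1,…,s}` of observations that populate the leaves (its complement is `I₁`). The auxiliary
randomness `ξ` has law `law` and is independent of the sample. -/
structure TreeProcedure (p d s : ℕ) where
  Aux : Type*
  [measAux : MeasurableSpace Aux]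
  law : Measure Aux
  [probLaw : IsProbabilityMeasure law]
  tree : Finset (Fin s) → Aux → (Fin s → Obs p d) → SplitTree p
  measurable_tree : ∀ I, Measurable fun q : Aux × (Fin s → Obs p d) => tree I q.1 q.2

attribute [instance] TreeProcedure.measAux TreeProcedure.probLaw

/-- The possible index sets `I₂`: the halves, of size `⌈s/2⌉`, of `{1,…,s}`. -/
def halves (s : ℕ) : Finset (Finset (Fin s)) :=
  Finset.powersetCard ((s + 1) / 2) Finset.univ

open Classical in
/-- Number of covariates `X_i`, `i ∈ I₂`, in a cell. -/
def count {p d s : ℕ} (I : Finset (Fin s)) (z : Fin s → Obs p d) (C : Cell p) : ℕ :=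
  (I.filter fun i => (z i).1 ∈ C.toSet).card

open Classical in
/-- The weight `S_i = 1{X_i ∈ L} / #{j ∈ I₂ : X_j ∈ L}` of the observation `i ∈ I₂`. -/
def weight {p d s : ℕ} (I : Finset (Fin s)) (z : Fin s → Obs p d) (L : Cell p) (i : Fin s) : ℝ :=
  if (z i).1 ∈ L.toSet then ((count I z L : ℕ) : ℝ)⁻¹ else 0

/-- Law of an i.i.d. sample of size `s`, where `X` has law `ν` and `Q u` is the conditional law
of `Y` given `X = u`. -/
def sampleLaw {p d : ℕ} (s : ℕ) (ν : Measure (Cov p)) (Q : Kernel (Cov p) (Resp d)) :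
    Measure (Fin s → Obs p d) :=
  Measure.pi fun _ => ν ⊗ₘ Q

namespace TreeProcedure

variable {p d s : ℕ} (A : TreeProcedure p d s)

/-- Joint law of the sample and of the auxiliary randomness of a tree. -/
def jointLaw (ν : Measure (Cov p)) (Q : Kernel (Cov p) (Resp d)) :
    Measure ((Fin s → Obs p d) × A.Aux) :=
  (sampleLaw s ν Q).prod A.law

/-- The random leaf `L(x)` of the tree whose leaves are populated by `I₂ = I`. -/
def leaf (x : Cov p) (I : Finset (Fin s)) (ω : (Fin s → Obs p d) × A.Aux) : Cell p :=
  (A.tree I ω.2 ω.1).leafAt x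

/-- Honesty: the tree is a function of the auxiliary randomness, of the observations in `I₁`, and of
the covariates (not the responses) of the observations in `I₂`. -/
def Honest : Prop :=
  ∀ I ∈ halves s, ∀ z z' : Fin s → Obs p d, (∀ i, (z i).1 = (z' i).1) →
    (∀ i, i ∉ I → z i = z' i) → ∀ ξ, A.tree I ξ z = A.tree I ξ z'

/-- Random split: given the data, at every node address `a`, conditionally on the splits at the
ancestors of `a` and on `a` being split, the probability of a split along the feature `j` is at
least `π / p`. -/
def RandomSplit (ν : Measure (Cov p)) (Q : Kernel (Cov p) (Resp d)) (π : ℝ) : Prop :=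
  ∀ I ∈ halves s, ∀ᵐ z ∂(sampleLaw s ν Q), ∀ (a : List Bool) (j : Fin p)
    (B : Set (Fin a.length → (Fin p × ℝ) ⊕ Unit)), MeasurableSet B →
    π / p * A.law.real {ξ | (A.tree I ξ z).history a ∈ B ∧
        ∃ j' c, (A.tree I ξ z).splitAt a = Sum.inl (j', c)}
      ≤ A.law.real {ξ | (A.tree I ξ z).history a ∈ B ∧
        ∃ c, (A.tree I ξ z).splitAt a = Sum.inl (j, c)}

/-- Symmetry: relabelling the observations (together with their roles) does not change the law of
the leaf of any test point. -/
def Symmetric (ν : Measure (Cov p)) (Q : Kernel (Cov p) (Resp d)) : Prop :=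
  ∀ I ∈ halves s, ∀ σ : Equiv.Perm (Fin s), ∀ᵐ z ∂(sampleLaw s ν Q), ∀ u ∈ cube p,
    A.law.map (fun ξ => (A.tree (I.map σ.toEmbedding) ξ z).leafAt u)
      = A.law.map (fun ξ => (A.tree I ξ (fun i => z (σ i))).leafAt u)

/-- `α`-regularity with leaf sizes in `[κ, 2 κ - 1]`, both relative to the observations in `I₂`
(demanded once there are at least `κ` such observations). -/
def AlphaRegular (ν : Measure (Cov p)) (Q : Kernel (Cov p) (Resp d)) (α : ℝ) (κ : ℕ) : Prop :=
  κ ≤ (s + 1) / 2 → ∀ I ∈ halves s, ∀ᵐ ω ∂(A.jointLaw ν Q),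
    (A.tree I ω.2 ω.1).IsRegular α κ (count I ω.1) (Cell.root p)

section Output

variable (H : Type*) [NormedAddCommGroup H] [InnerProductSpace ℝ H] [CompleteSpace H]
  [RKHS ℝ H (Resp d) ℝ]

/-- The prediction `∑_{i ∈ I₂} S_i k(Y_i, ·)` at `x` of a tree with `I₂ = I`. -/
def predict (x : Cov p) (I : Finset (Fin s)) (ω : (Fin s → Obs p d) × A.Aux) : H :=
  ∑ i ∈ I, weight I ω.1 (A.leaf x I ω) i • feature H (ω.1 i).2

/-- The tree `T(Z_1,…,Z_s)`: the prediction at `x` with the randomness of the tree (the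
uniformly random choice of the half `I₂` and the auxiliary randomness) integrated out. -/
def T (x : Cov p) (z : Fin s → Obs p d) : H :=
  ((halves s).card : ℝ)⁻¹ • ∑ I ∈ halves s, ∫ ξ, A.predict H x I (z, ξ) ∂A.law

/-- `T_n(Z_i) = E[T(Z_1,…,Z_s) | Z_i] - E[T(Z_1,…,Z_s)]`, as a random element of `H`. -/
def proj (ν : Measure (Cov p)) (Q : Kernel (Cov p) (Resp d)) (x : Cov p) (i : Fin s)
    (z : Fin s → Obs p d) : H :=
  ((sampleLaw s ν Q)[A.T H x |
      MeasurableSpace.comap (fun z : Fin s → Obs p d => z i) inferInstance]) z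
    - ∫ z', A.T H x z' ∂(sampleLaw s ν Q)

/-- `Var(E[f(L(x)) | X_i])`. -/
def leafDependence (ν : Measure (Cov p)) (Q : Kernel (Cov p) (Resp d)) (x : Cov p)
    (I : Finset (Fin s)) (i : Fin s) (f : Cell p → H) : ℝ :=
  hilbertVar (A.jointLaw ν Q)
    ((A.jointLaw ν Q)[fun ω => f (A.leaf x I ω) |
      MeasurableSpace.comap (fun ω : (Fin s → Obs p d) × A.Aux => (ω.1 i).1) inferInstance])

/-- The family `(X_j, 1{X_j ∈ L(x)})_{j ∈ I₂, j ≠ i}`. -/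
def others (x : Cov p) (I : Finset (Fin s)) (i : Fin s) (ω : (Fin s → Obs p d) × A.Aux) :
    {j : Fin s // j ∈ I ∧ j ≠ i} → Cov p × Prop :=
  fun j => ((ω.1 j).1, (ω.1 j).1 ∈ (A.leaf x I ω).toSet)

/-- `E ‖E[F | 1{X_i ∉ L(x)}, L(x), X_i] - E[F | 1{X_i ∉ L(x)}, L(x)]‖²` for
`F = f((X_j, 1{X_j ∈ L(x)})_{j ∈ I₂, j ≠ i})`. -/
def othersDependence (ν : Measure (Cov p)) (Q : Kernel (Cov p) (Resp d)) (x : Cov p)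
    (I : Finset (Fin s)) (i : Fin s)
    (f : ({j : Fin s // j ∈ I ∧ j ≠ i} → Cov p × Prop) → H) : ℝ :=
  ∫ ω, ‖((A.jointLaw ν Q)[fun ω => f (A.others x I i ω) |
        MeasurableSpace.comap (fun ω : (Fin s → Obs p d) × A.Aux =>
          (((ω.1 i).1 ∉ (A.leaf x I ω).toSet : Prop), A.leaf x I ω, (ω.1 i).1)) inferInstance]) ω
      - ((A.jointLaw ν Q)[fun ω => f (A.others x I i ω) |
        MeasurableSpace.comap (fun ω : (Fin s → Obs p d) × A.Aux =>
          (((ω.1 i).1 ∉ (A.leaf x I ω).toSet : Prop), A.leaf x I ω)) inferInstance]) ω‖ ^ 2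
    ∂(A.jointLaw ν Q)

end Output

end TreeProcedure

/-- Honesty*: for some `ε > 0` and every uniformly bounded sequence of functions `f`,
`Var(E[f(L(x)) | X_i]) = o(s_n^{-(1+ε)})`, and
`E ‖E[F | 1{X_i ∉ L(x)}, L(x), X_i] - E[F | 1{X_i ∉ L(x)}, L(x)]‖² = o(s_n^{-(1+ε)})` for
`F = f((X_j, 1{X_j ∈ L(x)})_{j ∈ I₂, j ≠ i})`, uniformly in `i ∈ I₂` (and in the half `I₂`). -/
def HonestyStar {p d : ℕ} (H : Type*) [NormedAddCommGroup H] [InnerProductSpace ℝ H]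
    (ν : Measure (Cov p)) (Q : Kernel (Cov p) (Resp d)) (x : Cov p)
    (s : ℕ → ℕ) (A : ∀ n, TreeProcedure p d (s n)) : Prop :=
  ∃ ε : ℝ, 0 < ε ∧
    (∀ f : ℕ → Cell p → H, (∀ n, StronglyMeasurable (f n)) → (∃ M : ℝ, ∀ n C, ‖f n C‖ ≤ M) →
      ∀ δ > 0, ∀ᶠ n in atTop, ∀ I ∈ halves (s n), ∀ i ∈ I,
        (A n).leafDependence H ν Q x I i (f n) ≤ δ * (s n : ℝ) ^ (-(1 + ε))) ∧
    (∀ f : ∀ (n : ℕ) (I : Finset (Fin (s n))) (i : Fin (s n)),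
        ({j : Fin (s n) // j ∈ I ∧ j ≠ i} → Cov p × Prop) → H,
      (∀ n I i, StronglyMeasurable (f n I i)) → (∃ M : ℝ, ∀ n I i v, ‖f n I i v‖ ≤ M) →
      ∀ δ > 0, ∀ᶠ n in atTop, ∀ I ∈ halves (s n), ∀ i ∈ I,
        (A n).othersDependence H ν Q x I i (f n I i) ≤ δ * (s n : ℝ) ^ (-(1 + ε)))

/-- Data sampling: the subsample size is `s_n = n^β` up to rounding, with
`1 > β > (1 + (log((1-α)⁻¹) / log(α⁻¹)) (π / p))⁻¹`. -/
def SubsampleRate (p : ℕ) (α π β : ℝ) (s : ℕ → ℕ) : Prop :=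
  β < 1 ∧ (1 + Real.log ((1 - α)⁻¹) / Real.log (α⁻¹) * (π / p))⁻¹ < β ∧
    ∀ n : ℕ, 1 ≤ n → |(s n : ℝ) - (n : ℝ) ^ β| < 1

/-! ### Conditions on the data -/

/-- `ν` is a law on `[0,1]^p` with a density bounded away from `0` and infinity. -/
def HasBoundedDensity {p : ℕ} (ν : Measure (Cov p)) : Prop :=
  ∃ g : Cov p → ℝ, Measurable g ∧
    (∃ c C : ℝ, 0 < c ∧ ∀ u ∈ cube p, c ≤ g u ∧ g u ≤ C) ∧
    ν = (volume.restrict (cube p)).withDensity fun u => ENNReal.ofReal (g u)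

section Data

variable {p d : ℕ} (H : Type*) [NormedAddCommGroup H] [InnerProductSpace ℝ H] [CompleteSpace H]
  [RKHS ℝ H (Resp d) ℝ]

/-- The conditional mean embedding `μ(u) = E[k(Y, ·) | X = u]`. -/
def condMean (Q : Kernel (Cov p) (Resp d)) (u : Cov p) : H := ∫ y, feature H y ∂(Q u)

/-- `Var(k(Y, ·) | X = u)`. -/
def condVar (Q : Kernel (Cov p) (Resp d)) (u : Cov p) : ℝ := hilbertVar (Q u) (feature H)

/-- The conditions on the law of `(X, Y)`, for the test point `x`. -/
structure DataConditions (ν : Measure (Cov p)) (Q : Kernel (Cov p) (Resp d)) (x : Cov p) :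
    Prop where
  density : HasBoundedDensity ν
  mean_lipschitz : ∃ K : ℝ≥0, LipschitzOnWith K (condMean H Q) (cube p)
  second_moment_lipschitz :
    ∃ K : ℝ≥0, LipschitzOnWith K (fun u => ∫ y, ‖feature H y‖ ^ 2 ∂(Q u)) (cube p)
  var_pos : 0 < condVar H Q x
  moment_bound : ∃ δ M : ℝ, 0 < δ ∧ ∀ u ∈ cube p,
    Integrable (fun y => ‖feature H y - condMean H Q u‖ ^ (2 + δ)) (Q u) ∧
    ∫ y, ‖feature H y - condMean H Q u‖ ^ (2 + δ) ∂(Q u) ≤ M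
  eval_var_pos : ∀ f : H, f ≠ 0 → 0 < Var[fun y => f y; Q x]
  eval_second_moment_lipschitz : ∀ f : H, f ≠ 0 →
    ∃ K : ℝ≥0, LipschitzOnWith K (fun u => ∫ y, |f y| ^ 2 ∂(Q u)) (cube p)

end Data

end DRF

end

/-! With the partition and the auxiliary randomness integrated out, the tree is a weighted sum `∑
W_i k(Y_i,·)` with non-negative weights (`meanWeight`) that almost surely sum to one as soon as the
sample is large enough. Split `k(Y_i,·)` into the residual `k(Y_i,·) - μ(X_i)` and `μ(X_i)`. By
honesty `W_i` does not involve `Y_i`, so given `Z_1` every residual but the first averages to zero.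
Hence (`marg_T`) `T_n(Z_1)` is a noise term `b(Z_1) (k(Y_1,·) - μ(X_1))`, where `b(Z_1) = E[W_1 |
Z_1]` is the share of the observation and depends only on `X_1`, plus the centred projection of the
bias `∑ W_i μ(X_i) - μ(x)`.

Let `D` (`meanDist`) be the mean weighted distance to `x` of the observations in its leaf, and let
`l` be a continuous linear map on `H`. The second moment of `l` of the noise is `E[b² v(X_1)]` with
`v` the conditional variance of `l (k(Y,·))`. As `v` is Lipschitz, `b ≤ 1` and, by symmetry, `E[b
dist] = D / s`, it equals `v(x) E[b²]` up to `O(D / s)`. The bias is symmetric in the observations,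
so its `s` projections have the same variance. Bessel's inequality bounds their sum by the second
moment of the bias, which is `O(D)`; each is therefore `O(D / s)` too. If `D = o(s E[b²])`, then
`Var(l T_n) / E[b²]` tends to `v(x)`. Taking `l = ⟪f, ·⟫` and `l = id` and dividing gives the
theorem.

It remains to compare `D` with `s E[b²]` (`tendsto_meanDist_div`). Let `m` be the size of the half
`I₂`. Up to an event of negligible probability, the counts in all cells are comparable with volumes
as long as they are not too small. So each split removes a fixed fraction of the side it cuts, each
side is cut with probability at least `π / p` at each of about `log m` splits, and `D` is `O(m ^
(-c₀))` for some `c₀ > 0` (`meanDist_le`).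

For `E[b²]`, a leaf holds boundedly many points and so has volume about `1 / m`. A point `u` of the
leaf spans with `x` a box inside the leaf, hence lies in the non-random set where `boxVol x u` is
small, which has measure nearly `1 / m`. Since `E b = 1 / s` and `b` lives mostly on this set,
Cauchy–Schwarz shows that `s E[b²]` is at least a constant times `m ^ (-2η)` with `η` at our
disposal (`one_le_mul_shareSq`). Choosing `2η < c₀` concludes. -/

set_option linter.unusedSectionVars false

namespace DRF

/-! ### Projections of a function of i.i.d. variables onto single variables. -/

section Resample

variable {ι Ω : Type*} [Fintype ι] [DecidableEq ι] [MeasurableSpace Ω]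

theorem measurable_update_pair (i : ι) :
    Measurable fun q : (ι → Ω) × Ω => Function.update q.1 i q.2 := by
  refine measurable_pi_lambda _ fun j => ?_
  by_cases h : j = i
  · subst h; simpa using measurable_snd
  · simp only [Function.update_of_ne h]
    exact (measurable_pi_apply j).comp measurable_fst

variable (lam : Measure Ω) [IsProbabilityMeasure lam]

/-- Resampling one coordinate of an i.i.d. sample does not change its law. -/
theorem measurePreserving_update (i : ι) :
    MeasurePreserving (fun q : (ι → Ω) × Ω => Function.update q.1 i q.2)
      ((Measure.pi fun _ => lam).prod lam) (Measure.pi fun _ => lam) := by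
  refine ⟨measurable_update_pair i, ?_⟩
  symm
  refine Measure.pi_eq fun B hB => ?_
  rw [Measure.map_apply (measurable_update_pair i) (MeasurableSet.univ_pi hB)]
  -- The old value of coordinate `i` is overwritten, hence unconstrained.
  have : (fun q : (ι → Ω) × Ω => Function.update q.1 i q.2) ⁻¹' Set.univ.pi B
      = (Set.univ.pi (Function.update B i Set.univ)) ×ˢ B i := by
    ext q
    simp only [Set.mem_preimage, Set.mem_univ_pi, Set.mem_prod]
    constructor
    · intro h
      refine ⟨fun j => ?_, by simpa using h i⟩
      by_cases hj : j = i
      · subst hj; simp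
      · simpa [Function.update_of_ne hj] using h j
    · rintro ⟨h, h'⟩ j
      by_cases hj : j = i
      · subst hj; simpa using h'
      · simpa [Function.update_of_ne hj] using h j
  rw [this, Measure.prod_prod, Measure.pi_pi]
  rw [← Finset.mul_prod_erase _ _ (Finset.mem_univ i), ← Finset.mul_prod_erase _ (fun j => lam (B j)) (Finset.mem_univ i)]
  simp only [Function.update_self, measure_univ, one_mul]
  rw [mul_comm]
  congr 1
  refine Finset.prod_congr rfl fun j hj => ?_
  rw [Function.update_of_ne (Finset.ne_of_mem_erase hj)]

theorem measurePreserving_perm (σ : Equiv.Perm ι) :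
    MeasurePreserving (fun z : ι → Ω => fun i => z (σ i))
      (Measure.pi fun _ => lam) (Measure.pi fun _ => lam) := by
  have := measurePreserving_piCongrLeft (fun _ : ι => lam) σ.symm
  convert this using 1
  ext z i
  have := MeasurableEquiv.piCongrLeft_apply_apply (β := fun _ : ι => Ω) (e := σ.symm) z (σ i)
  simpa using this.symm

variable {V : Type*} [NormedAddCommGroup V] [InnerProductSpace ℝ V] [CompleteSpace V]

/-- The average of `F` over all coordinates but the `i`-th. -/
noncomputable def marg (F : (ι → Ω) → V) (i : ι) (w : Ω) : V :=
  ∫ z, F (Function.update z i w) ∂(Measure.pi fun _ => lam)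

variable {lam} {F G : (ι → Ω) → V}

theorem integrable_update (hF : Integrable F (Measure.pi fun _ => lam)) (i : ι) :
    Integrable (fun q : (ι → Ω) × Ω => F (Function.update q.1 i q.2))
      ((Measure.pi fun _ => lam).prod lam) :=
  (measurePreserving_update lam i).integrable_comp_of_integrable hF

theorem integrable_marg (hF : Integrable F (Measure.pi fun _ => lam)) (i : ι) :
    Integrable (marg lam F i) lam :=
  (integrable_update hF i).integral_prod_right

theorem integral_update (hF : Integrable F (Measure.pi fun _ => lam)) (i : ι) :
    ∫ z, F z ∂(Measure.pi fun _ => lam)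
      = ∫ w, ∫ z, F (Function.update z i w) ∂(Measure.pi fun _ => lam) ∂lam := by
  have h := (measurePreserving_update lam i)
  rw [← integral_prod_symm _ (integrable_update hF i)]
  conv_lhs => rw [← h.map_eq]
  rw [integral_map h.measurable.aemeasurable]
  rw [h.map_eq]; exact hF.aestronglyMeasurable

theorem integral_marg (hF : Integrable F (Measure.pi fun _ => lam)) (i : ι) :
    ∫ w, marg lam F i w ∂lam = ∫ z, F z ∂(Measure.pi fun _ => lam) :=
  (integral_update hF i).symm

theorem integral_eval {i : ι} {g : Ω → V} (hg : AEStronglyMeasurable g lam) :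
    ∫ z, g (z i) ∂(Measure.pi fun _ => lam) = ∫ w, g w ∂lam := by
  have h := measurePreserving_eval (fun _ : ι => lam) i
  conv_rhs => rw [← h.map_eq]
  rw [integral_map h.measurable.aemeasurable (by rw [h.map_eq]; exact hg)]

/-- The conditional expectation given one coordinate. -/
theorem condExp_eval_ae_eq (hF : Integrable F (Measure.pi fun _ => lam)) (i : ι) :
    (Measure.pi fun _ => lam)[F | MeasurableSpace.comap (fun z : ι → Ω => z i) inferInstance]
      =ᵐ[Measure.pi fun _ => lam] fun z => marg lam F i (z i) := by
  have he := measurePreserving_eval (fun _ : ι => lam) i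
  have hm : MeasurableSpace.comap (fun z : ι → Ω => z i) inferInstance ≤
      (inferInstance : MeasurableSpace (ι → Ω)) := (measurable_pi_apply i).comap_le
  obtain ⟨g, hg, hgm⟩ := (integrable_marg hF i).aestronglyMeasurable
  symm
  refine ae_eq_condExp_of_forall_setIntegral_eq hm hF ?_ ?_ ?_
  · intro t _ _
    exact (he.integrable_comp_of_integrable (integrable_marg hF i)).integrableOn
  · rintro t ⟨t', ht', rfl⟩ -
    have hms : MeasurableSet ((fun z : ι → Ω => z i) ⁻¹' t') := measurable_pi_apply i ht'
    rw [← integral_indicator hms, ← integral_indicator hms]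
    -- After resampling coordinate `i`, the indicator depends on the outer variable only, and the
    -- inner integral is `marg`.
    rw [integral_update (hF.indicator hms) i]
    have h1 : ∀ z : ι → Ω, ((fun z : ι → Ω => z i) ⁻¹' t').indicator (fun z => marg lam F i (z i)) z
        = (t'.indicator (marg lam F i)) (z i) := fun z => rfl
    simp_rw [h1]
    rw [integral_eval ((integrable_marg hF i).indicator ht').aestronglyMeasurable]
    refine integral_congr_ae (.of_forall fun w => ?_)
    by_cases hw : w ∈ t'
    · simp [Set.indicator, hw, marg]
    · simp [Set.indicator, hw]
  · refine ⟨fun z => g (z i), ?_, ?_⟩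
    · exact hg.comp_measurable (comap_measurable _)
    · exact he.quasiMeasurePreserving.ae_eq_comp hgm

theorem integrable_of_bdd {α : Type*} [MeasurableSpace α] {μ : Measure α} [IsFiniteMeasure μ] {f : α → V}
    (hf : AEStronglyMeasurable f μ) {M : ℝ} (hM : ∀ a, ‖f a‖ ≤ M) : Integrable f μ :=
  Integrable.of_bound hf M (.of_forall hM)

theorem marg_norm_le {M : ℝ} (hM : ∀ z, ‖F z‖ ≤ M) (i : ι) (w : Ω) : ‖marg lam F i w‖ ≤ M := by
  refine (norm_integral_le_of_norm_le_const (C := M) (.of_forall fun z => hM _)).trans ?_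
  simp

theorem hilbertVar_eq_sub {α : Type*} [MeasurableSpace α] {μ : Measure α} [IsProbabilityMeasure μ]
    {f : α → V} (hf : AEStronglyMeasurable f μ) {M : ℝ} (hM : ∀ a, ‖f a‖ ≤ M) :
    hilbertVar μ f = ∫ a, ‖f a‖ ^ 2 ∂μ - ‖∫ a, f a ∂μ‖ ^ 2 := by
  have hi := integrable_of_bdd hf hM
  have hi2 : Integrable (fun a => ‖f a‖ ^ 2) μ := by
    refine integrable_of_bdd (hf.norm.pow 2) (M := M ^ 2) fun a => ?_
    rw [Real.norm_of_nonneg (by positivity)]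
    exact pow_le_pow_left₀ (norm_nonneg _) (hM a) 2
  unfold hilbertVar
  set c := ∫ a, f a ∂μ with hc
  have : ∀ a, ‖f a - c‖ ^ 2 = ‖f a‖ ^ 2 - 2 * ⟪f a, c⟫ + ‖c‖ ^ 2 := fun a => norm_sub_sq_real _ _
  simp_rw [this]
  have hinn : Integrable (fun a => ⟪f a, c⟫) μ := hi.inner_const c
  have hsub : Integrable (fun a => ‖f a‖ ^ 2 - 2 * ⟪f a, c⟫) μ := hi2.sub (hinn.const_mul 2)
  rw [integral_add hsub (integrable_const _),
    integral_sub hi2 (hinn.const_mul 2), integral_const_mul]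
  have : ∫ a, ⟪f a, c⟫ ∂μ = ⟪c, c⟫ := by
    simp_rw [real_inner_comm c]
    rw [integral_inner hi, hc]
  rw [this, real_inner_self_eq_norm_sq]
  simp
  ring

/-- Bessel's inequality for the projections of a function of independent variables onto the single
variables. -/
theorem sum_hilbertVar_marg_le (hF : StronglyMeasurable F) {M : ℝ} (hM : ∀ z, ‖F z‖ ≤ M) :
    ∑ i, hilbertVar lam (marg lam F i) ≤ ∫ z, ‖F z‖ ^ 2 ∂(Measure.pi fun _ => lam) := by
  set P : Measure (ι → Ω) := Measure.pi fun _ => lam with hP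
  have hFi : Integrable F P := integrable_of_bdd hF.aestronglyMeasurable hM
  set c := ∫ z, F z ∂P with hc
  set g : ι → Ω → V := fun i w => marg lam F i w - c with hg
  have hmm : ∀ i, StronglyMeasurable (marg lam F i) := fun i => by
    unfold marg
    exact (hF.comp_measurable (measurable_update_pair i)).integral_prod_left'
  have hgm : ∀ i, StronglyMeasurable (g i) := fun i => (hmm i).sub stronglyMeasurable_const
  have hcM : ‖c‖ ≤ M := by
    refine (norm_integral_le_of_norm_le_const (C := M) (.of_forall fun z => hM _)).trans ?_
    simp
  have hgM : ∀ i w, ‖g i w‖ ≤ 2 * M := fun i w =>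
    (norm_sub_le _ _).trans (by linarith [marg_norm_le (lam := lam) hM i w])
  have hgi : ∀ i, Integrable (g i) lam := fun i => integrable_of_bdd (hgm i).aestronglyMeasurable (hgM i)
  have hg0 : ∀ i, ∫ w, g i w ∂lam = 0 := fun i => by
    simp only [hg]
    rw [integral_sub (integrable_marg hFi i) (integrable_const _), integral_marg hFi]
    simp [hc, hP]
  have hM0 : 0 ≤ M := (norm_nonneg _).trans hcM
  have hvar : ∀ i, hilbertVar lam (marg lam F i) = ∫ w, ‖g i w‖ ^ 2 ∂lam := fun i => by
    unfold hilbertVar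
    rw [integral_marg hFi i]
  have binn : ∀ {a b : V} {A B : ℝ}, ‖a‖ ≤ A → ‖b‖ ≤ B → ‖⟪a, b⟫‖ ≤ A * B := fun ha hb =>
    (norm_inner_le_norm _ _).trans (mul_le_mul ha hb (norm_nonneg _) ((norm_nonneg _).trans ha))
  have hev : ∀ i, StronglyMeasurable fun z : ι → Ω => g i (z i) := fun i =>
    (hgm i).comp_measurable (measurable_pi_apply i)
  -- With coordinate `i` frozen at `w`, averaging `F - c` over the other coordinates gives `g i w`.
  have hFg : ∀ i, ∫ z, ⟪F z - c, g i (z i)⟫ ∂P = ∫ w, ‖g i w‖ ^ 2 ∂lam := fun i => by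
    have hint : Integrable (fun z => ⟪F z - c, g i (z i)⟫) P :=
      integrable_of_bdd ((hF.sub stronglyMeasurable_const).inner (hev i)).aestronglyMeasurable
        fun z => binn ((norm_sub_le _ _).trans (add_le_add (hM z) hcM)) (hgM i _)
    rw [integral_update hint i]
    refine integral_congr_ae ?_
    filter_upwards [(integrable_update hFi i).prod_left_ae] with w hw
    simp only [Function.update_self]
    have : ∫ z, ⟪F (Function.update z i w) - c, g i w⟫ ∂P
        = ⟪∫ z, (F (Function.update z i w) - c) ∂P, g i w⟫ := by
      simp_rw [real_inner_comm (g i w)]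
      rw [integral_inner]
      exact hw.sub (integrable_const _)
    rw [← hP, this, integral_sub hw (integrable_const _)]
    simp only [integral_const, probReal_univ, one_smul]
    exact real_inner_self_eq_norm_sq _
  have hgg : ∀ i j, i ≠ j → ∫ z, ⟪g i (z i), g j (z j)⟫ ∂P = 0 := fun i j hij => by
    have hint : Integrable (fun z : ι → Ω => ⟪g i (z i), g j (z j)⟫) P :=
      integrable_of_bdd ((hev i).inner (hev j)).aestronglyMeasurable
        fun z => binn (hgM i _) (hgM j _)
    rw [integral_update hint i]
    have : ∀ w, ∫ z, ⟪g i ((Function.update z i w) i), g j ((Function.update z i w) j)⟫ ∂P = 0 := by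
      intro w
      simp only [Function.update_self, Function.update_of_ne hij.symm]
      have hgj : Integrable (fun z : ι → Ω => g j (z j)) P :=
        integrable_of_bdd (hev j).aestronglyMeasurable fun z => hgM j _
      rw [integral_inner hgj, integral_eval (hgm j).aestronglyMeasurable, hg0 j, inner_zero_right]
    rw [integral_congr_ae (.of_forall this)]
    simp
  have hggs : ∀ i, ∫ z, ⟪g i (z i), g i (z i)⟫ ∂P = ∫ w, ‖g i w‖ ^ 2 ∂lam := fun i => by
    simp_rw [real_inner_self_eq_norm_sq]
    exact integral_eval (g := fun w => ‖g i w‖ ^ 2) ((hgm i).norm.pow 2).aestronglyMeasurable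
  -- Expanding this square proves Bessel: the `g i (z i)` are mutually orthogonal and each pairs
  -- with `F - c` to its own squared norm, so the integral is the variance of `F` minus the sum of
  -- the variances of the projections.
  have key : 0 ≤ ∫ z, ‖(F z - c) - ∑ i, g i (z i)‖ ^ 2 ∂P := integral_nonneg fun z => by positivity
  have hexp : ∀ z, ‖(F z - c) - ∑ i, g i (z i)‖ ^ 2 = ‖F z - c‖ ^ 2
      - 2 * ∑ i, ⟪F z - c, g i (z i)⟫ + ∑ i, ∑ j, ⟪g i (z i), g j (z j)⟫ := fun z => by
    rw [norm_sub_sq_real, inner_sum, ← real_inner_self_eq_norm_sq (∑ i, g i (z i)), sum_inner]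
    simp_rw [inner_sum]
  have hint0 : Integrable (fun z => ‖F z - c‖ ^ 2) P := by
    refine integrable_of_bdd ((hF.sub stronglyMeasurable_const).norm.pow 2).aestronglyMeasurable
      (M := (2 * M) ^ 2) fun z => ?_
    rw [Real.norm_of_nonneg (by positivity)]
    exact pow_le_pow_left₀ (norm_nonneg _) ((norm_sub_le _ _).trans (by linarith [hM z])) 2
  have hint1 : ∀ i, Integrable (fun z => ⟪F z - c, g i (z i)⟫) P := fun i =>
    integrable_of_bdd ((hF.sub stronglyMeasurable_const).inner (hev i)).aestronglyMeasurable
        fun z => binn ((norm_sub_le _ _).trans (add_le_add (hM z) hcM)) (hgM i _)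
  have hint2 : ∀ i j, Integrable (fun z : ι → Ω => ⟪g i (z i), g j (z j)⟫) P := fun i j =>
    integrable_of_bdd ((hev i).inner (hev j)).aestronglyMeasurable
        fun z => binn (hgM i _) (hgM j _)
  simp_rw [hexp] at key
  have hsub : Integrable (fun z => ‖F z - c‖ ^ 2 - 2 * ∑ i, ⟪F z - c, g i (z i)⟫) P :=
    hint0.sub ((integrable_finsetSum _ fun i _ => hint1 i).const_mul 2)
  rw [integral_add hsub
      (integrable_finsetSum _ fun i _ => integrable_finsetSum _ fun j _ => hint2 i j),
    integral_sub hint0 ((integrable_finsetSum _ fun i _ => hint1 i).const_mul 2),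
    integral_const_mul, integral_finsetSum _ (fun i _ => hint1 i),
    integral_finsetSum _ (fun i _ => integrable_finsetSum _ fun j _ => hint2 i j)] at key
  have hsum : ∀ i, ∫ z, ∑ j, ⟪g i (z i), g j (z j)⟫ ∂P = ∫ w, ‖g i w‖ ^ 2 ∂lam := fun i => by
    rw [integral_finsetSum _ (fun j _ => hint2 i j), Finset.sum_eq_single i, hggs i]
    · exact fun j _ hj => hgg i j hj.symm
    · simp
  simp_rw [hsum, hFg] at key
  simp_rw [hvar]
  have h1 := hilbertVar_eq_sub (μ := P) hF.aestronglyMeasurable hM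
  unfold hilbertVar at h1
  have h2 : 0 ≤ ‖∫ z, F z ∂P‖ ^ 2 := by positivity
  linarith

/-- For a symmetric function, all projections onto single variables agree. -/
theorem marg_ae_eq_of_symm (i j : ι)
    (hsym : ∀ σ : Equiv.Perm ι, ∀ᵐ z ∂(Measure.pi fun _ => lam), F (fun k => z (σ k)) = F z) 
    (hF : StronglyMeasurable F) :
    marg lam F i =ᵐ[lam] marg lam F j := by
  have h := Measure.measurePreserving_swap.quasiMeasurePreserving.ae
    ((measurePreserving_update lam j).quasiMeasurePreserving.ae (hsym (Equiv.swap i j)))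
  have h' : ∀ᵐ w ∂lam, ∀ᵐ z ∂(Measure.pi fun _ : ι => lam),
      F (fun k => (Function.update z j w) (Equiv.swap i j k)) = F (Function.update z j w) :=
    Measure.ae_ae_of_ae_prod h
  filter_upwards [h'] with w hw
  -- Swapping `i` and `j` moves the inserted value from place `j` to place `i` of the swapped
  -- sample, and the swapped sample has the same law.
  have e1 : ∀ z : ι → Ω, (fun k => (Function.update z j w) (Equiv.swap i j k))
      = Function.update (fun k => z (Equiv.swap i j k)) i w := fun z => by
    ext k
    by_cases hk : k = i
    · subst hk; simp
    · rw [Function.update_of_ne hk, Function.update_of_ne]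
      intro h0
      apply hk
      have := congrArg (Equiv.swap i j) h0
      simpa using this
  have hp := measurePreserving_perm lam (Equiv.swap i j)
  unfold marg
  rw [← integral_congr_ae hw]
  simp_rw [e1]
  conv_lhs => rw [← hp.map_eq]
  rw [integral_map hp.measurable.aemeasurable]
  exact (hF.comp_measurable ((measurable_update_pair i).comp
    (measurable_id.prodMk measurable_const))).aestronglyMeasurable

end Resample

/-! ### Measurability of the leaf -/

theorem root_toSet (p : ℕ) : (Cell.root p).toSet = cube p := by
  ext u
  simp only [Cell.toSet, Cell.root, Set.mem_ofPred_eq, bot_le, true_and, and_iff_left_iff_imp]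
  exact fun _ j => EReal.coe_lt_top _

theorem mem_left_toSet {p : ℕ} {C : Cell p} {j : Fin p} {c : ℝ} {u : Cov p} :
    u ∈ (C.left j c).toSet ↔ u ∈ C.toSet ∧ u j < c := by
  simp only [Cell.toSet, Cell.left, Set.mem_ofPred_eq]
  constructor
  · rintro ⟨h, h'⟩
    have hj := h' j
    simp only [Function.update_self, lt_min_iff, EReal.coe_lt_coe_iff] at hj
    refine ⟨⟨h, fun i => ?_⟩, hj.2.2⟩
    by_cases hi : i = j
    · subst hi; exact ⟨hj.1, hj.2.1⟩
    · simpa [Function.update_of_ne hi] using h' i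
  · rintro ⟨⟨h, h'⟩, hc⟩
    refine ⟨h, fun i => ?_⟩
    by_cases hi : i = j
    · subst hi
      simpa using ⟨(h' i).1, (h' i).2, hc⟩
    · simpa [Function.update_of_ne hi] using h' i

theorem mem_right_toSet {p : ℕ} {C : Cell p} {j : Fin p} {c : ℝ} {u : Cov p} :
    u ∈ (C.right j c).toSet ↔ u ∈ C.toSet ∧ c ≤ u j := by
  simp only [Cell.toSet, Cell.right, Set.mem_ofPred_eq]
  constructor
  · rintro ⟨h, h'⟩
    have hj := h' j
    simp only [Function.update_self, max_le_iff, EReal.coe_le_coe_iff] at hj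
    refine ⟨⟨h, fun i => ?_⟩, hj.1.2⟩
    by_cases hi : i = j
    · subst hi; exact ⟨hj.1.1, hj.2⟩
    · simpa [Function.update_of_ne hi] using h' i
  · rintro ⟨⟨h, h'⟩, hc⟩
    refine ⟨h, fun i => ?_⟩
    by_cases hi : i = j
    · subst hi
      simpa using ⟨⟨(h' i).1, hc⟩, (h' i).2⟩
    · simpa [Function.update_of_ne hi] using h' i

namespace SplitTree

variable {p : ℕ}

theorem mem_leafFrom (τ : SplitTree p) (C : Cell p) {x : Cov p} (hx : x ∈ C.toSet) :
    x ∈ (τ.leafFrom C x).toSet := by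
  induction τ generalizing C with
  | leaf => exact hx
  | node j c l r ihl ihr =>
    simp only [leafFrom]
    split_ifs with h
    · exact ihl _ (mem_left_toSet.2 ⟨hx, h⟩)
    · exact ihr _ (mem_right_toSet.2 ⟨hx, not_lt.1 h⟩)

theorem IsRegular.leafFrom {α : ℝ} {κ : ℕ} {N : Cell p → ℕ} {τ : SplitTree p} {C : Cell p}
    (h : τ.IsRegular α κ N C) (x : Cov p) :
    κ ≤ N (τ.leafFrom C x) ∧ N (τ.leafFrom C x) ≤ 2 * κ - 1 := by
  induction τ generalizing C with
  | leaf => exact h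
  | node j c l r ihl ihr =>
    simp only [SplitTree.leafFrom]
    split_ifs
    · exact ihl h.2.2.1
    · exact ihr h.2.2.2

theorem measurable_splitAt (a : List Bool) : Measurable fun τ : SplitTree p => τ.splitAt a :=
  measurable_pi_iff.1 (comap_measurable splitAt) a

/-- The subtree below the root, on the side `b`. -/
def sub (b : Bool) : SplitTree p → SplitTree p
  | leaf => leaf
  | node _ _ l r => cond b r l

theorem splitAt_sub (b : Bool) (τ : SplitTree p) (a : List Bool) :
    (sub b τ).splitAt a = τ.splitAt (b :: a) := by
  cases τ with
  | leaf => rfl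
  | node j c l r => cases b <;> rfl

theorem measurable_sub (b : Bool) : Measurable (sub b : SplitTree p → SplitTree p) := by
  rw [measurable_comap_iff, measurable_pi_iff]
  intro a
  have : (fun τ : SplitTree p => (splitAt ∘ sub b) τ a) = fun τ => τ.splitAt (b :: a) := by
    funext τ; exact splitAt_sub b τ a
  rw [this]
  exact measurable_splitAt _

/-- The threshold of a split. -/
def threshold : (Fin p × ℝ) ⊕ Unit → ℝ := Sum.elim Prod.snd fun _ => 0

theorem measurable_threshold : Measurable (threshold : (Fin p × ℝ) ⊕ Unit → ℝ) :=
  Measurable.sumElim measurable_snd measurable_const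

theorem measurableSet_isSplit (j : Fin p) :
    MeasurableSet {s : (Fin p × ℝ) ⊕ Unit | ∃ c, s = Sum.inl (j, c)} := by
  have : {s : (Fin p × ℝ) ⊕ Unit | ∃ c, s = Sum.inl (j, c)}
      = Sum.inl '' (Prod.fst ⁻¹' ({j} : Set (Fin p))) := by
    ext s
    simp only [Set.mem_ofPred_eq, Set.mem_image, Set.mem_preimage, Set.mem_singleton_iff]
    constructor
    · rintro ⟨c, rfl⟩; exact ⟨(j, c), rfl, rfl⟩
    · rintro ⟨⟨j', c⟩, rfl, rfl⟩; exact ⟨c, rfl⟩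
  rw [this]
  exact MeasurableSet.inl_image (measurable_fst (measurableSet_singleton j))

/-- A split at which `x` is sent to the left. -/
def goesLeft (x : Cov p) (s : (Fin p × ℝ) ⊕ Unit) : Prop :=
  ∃ j, (∃ c, s = Sum.inl (j, c)) ∧ x j < threshold s

theorem measurableSet_goesLeft (x : Cov p) : MeasurableSet {s | goesLeft x s} := by
  have : {s | goesLeft x s} = ⋃ j, ({s : (Fin p × ℝ) ⊕ Unit | ∃ c, s = Sum.inl (j, c)} ∩
      {s | x j < threshold s}) := by
    ext s; simp [goesLeft]
  rw [this]
  exact MeasurableSet.iUnion fun j => (measurableSet_isSplit j).inter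
    (measurableSet_lt measurable_const measurable_threshold)

open Classical in
/-- The child cell that contains `x`. -/
noncomputable def childCell (x : Cov p) (s : (Fin p × ℝ) ⊕ Unit) (C : Cell p) : Cell p :=
  (fun j => if (∃ c, s = Sum.inl (j, c)) ∧ ¬ x j < threshold s then max (C.1 j) (threshold s : EReal)
      else C.1 j,
    fun j => if (∃ c, s = Sum.inl (j, c)) ∧ x j < threshold s then min (C.2 j) (threshold s : EReal)
      else C.2 j)

theorem childCell_left {x : Cov p} {j : Fin p} {c : ℝ} (h : x j < c) (C : Cell p) :
    childCell x (Sum.inl (j, c)) C = C.left j c := by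
  ext i
  · simp only [childCell, Cell.left]
    rw [if_neg]
    rintro ⟨⟨c', hc'⟩, h'⟩
    obtain ⟨rfl, rfl⟩ := Prod.mk.inj (Sum.inl.inj hc')
    exact h' h
  · simp only [childCell, Cell.left]
    by_cases hi : i = j
    · subst hi
      rw [if_pos ⟨⟨c, rfl⟩, h⟩, Function.update_self]; rfl
    · rw [if_neg, Function.update_of_ne hi]
      rintro ⟨⟨c', hc'⟩, -⟩
      exact hi (Prod.mk.inj (Sum.inl.inj hc')).1.symm

theorem childCell_right {x : Cov p} {j : Fin p} {c : ℝ} (h : ¬ x j < c) (C : Cell p) :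
    childCell x (Sum.inl (j, c)) C = C.right j c := by
  ext i
  · simp only [childCell, Cell.right]
    by_cases hi : i = j
    · subst hi
      rw [if_pos ⟨⟨c, rfl⟩, h⟩, Function.update_self]; rfl
    · rw [if_neg, Function.update_of_ne hi]
      rintro ⟨⟨c', hc'⟩, -⟩
      exact hi (Prod.mk.inj (Sum.inl.inj hc')).1.symm
  · simp only [childCell, Cell.right]
    rw [if_neg]
    rintro ⟨⟨c', hc'⟩, h'⟩
    obtain ⟨rfl, rfl⟩ := Prod.mk.inj (Sum.inl.inj hc')
    exact h h'

theorem measurable_childCell (x : Cov p) :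
    Measurable fun q : ((Fin p × ℝ) ⊕ Unit) × Cell p => childCell x q.1 q.2 := by
  have hthr : Measurable fun q : ((Fin p × ℝ) ⊕ Unit) × Cell p => (threshold q.1 : EReal) :=
    measurable_coe_real_ereal.comp (measurable_threshold.comp measurable_fst)
  have hlt : ∀ j, MeasurableSet {q : ((Fin p × ℝ) ⊕ Unit) × Cell p | x j < threshold q.1} := fun j =>
    measurableSet_lt measurable_const (measurable_threshold.comp measurable_fst)
  have hsp : ∀ j, MeasurableSet {q : ((Fin p × ℝ) ⊕ Unit) × Cell p | ∃ c, q.1 = Sum.inl (j, c)} :=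
    fun j => measurable_fst (measurableSet_isSplit j)
  refine Measurable.prodMk (measurable_pi_lambda _ fun j => ?_) (measurable_pi_lambda _ fun j => ?_)
  · refine Measurable.ite ((hsp j).inter (hlt j).compl) ?_ ?_
    · exact ((measurable_pi_apply j).comp (measurable_fst.comp measurable_snd)).max hthr
    · exact (measurable_pi_apply j).comp (measurable_fst.comp measurable_snd)
  · refine Measurable.ite ((hsp j).inter (hlt j)) ?_ ?_
    · exact ((measurable_pi_apply j).comp (measurable_snd.comp measurable_snd)).min hthr
    · exact (measurable_pi_apply j).comp (measurable_snd.comp measurable_snd)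

open Classical in
/-- The cell that contains `x` after the first `k` splits. -/
noncomputable def cellFrom (x : Cov p) : ℕ → SplitTree p → Cell p → Cell p
  | 0, _, C => C
  | k + 1, τ, C =>
      if goesLeft x (τ.splitAt []) then cellFrom x k (sub false τ) (childCell x (τ.splitAt []) C)
      else cellFrom x k (sub true τ) (childCell x (τ.splitAt []) C)

theorem measurable_cellFrom (x : Cov p) (k : ℕ) :
    Measurable fun q : SplitTree p × Cell p => cellFrom x k q.1 q.2 := by
  induction k with
  | zero => exact measurable_snd
  | succ k ih =>
    have hs : Measurable fun q : SplitTree p × Cell p => q.1.splitAt [] :=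
      (measurable_splitAt []).comp measurable_fst
    have hc : Measurable fun q : SplitTree p × Cell p => childCell x (q.1.splitAt []) q.2 :=
      (measurable_childCell x).comp (hs.prodMk measurable_snd)
    refine Measurable.ite (hs (measurableSet_goesLeft x)) ?_ ?_
    · exact ih.comp (((measurable_sub false).comp measurable_fst).prodMk hc)
    · exact ih.comp (((measurable_sub true).comp measurable_fst).prodMk hc)

/-- Where there is no split, `childCell` leaves the cell unchanged, so the iteration is stationary
once the leaf is reached. -/
theorem cellFrom_leaf (x : Cov p) (k : ℕ) (C : Cell p) : cellFrom x k leaf C = C := by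
  induction k generalizing C with
  | zero => rfl
  | succ k ih =>
    have : childCell x (splitAt (leaf : SplitTree p) []) C = C := by
      simp [childCell, splitAt]
    simp only [cellFrom, this, sub, ih, ite_self]

theorem goesLeft_inl {x : Cov p} {j : Fin p} {c : ℝ} :
    goesLeft x (Sum.inl (j, c)) ↔ x j < c := by
  constructor
  · rintro ⟨j', ⟨c', h⟩, h'⟩
    obtain ⟨rfl, rfl⟩ := Prod.mk.inj (Sum.inl.inj h)
    exact h'
  · exact fun h => ⟨j, ⟨c, rfl⟩, h⟩

theorem eventually_cellFrom_eq (x : Cov p) (τ : SplitTree p) (C : Cell p) :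
    ∀ᶠ k in atTop, cellFrom x k τ C = τ.leafFrom C x := by
  induction τ generalizing C with
  | leaf => exact .of_forall fun k => cellFrom_leaf x k C
  | node j c l r ihl ihr =>
    have : ∀ᶠ k in atTop, cellFrom x (k + 1) (node j c l r) C = (node j c l r).leafFrom C x := by
      by_cases h : x j < c
      · filter_upwards [ihl (C.left j c)] with k hk
        simp only [cellFrom, splitAt, goesLeft_inl, h, if_true, leafFrom, sub, cond_false,
          childCell_left h, hk]
      · filter_upwards [ihr (C.right j c)] with k hk
        simp only [cellFrom, splitAt, goesLeft_inl, h, if_false, leafFrom, sub, cond_true,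
          childCell_right h, hk]
    obtain ⟨K, hK⟩ := eventually_atTop.1 this
    refine eventually_atTop.2 ⟨K + 1, fun k hk => ?_⟩
    obtain ⟨k, rfl⟩ : ∃ k', k = k' + 1 := ⟨k - 1, by omega⟩
    exact hK k (by omega)

/-- The σ-algebra on trees only sees single splits, while the leaf comes from a recursion of
unbounded depth. It is the eventually constant limit of the cells after `k` splits, each of which
reads finitely many splits. -/
theorem measurable_leafAt (x : Cov p) : Measurable fun τ : SplitTree p => τ.leafAt x := by
  have hm : ∀ k, Measurable fun τ : SplitTree p => cellFrom x k τ (Cell.root p) := fun k =>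
    (measurable_cellFrom x k).comp (measurable_id.prodMk measurable_const)
  have hlim : ∀ τ : SplitTree p, ∀ᶠ k in atTop, cellFrom x k τ (Cell.root p) = τ.leafAt x :=
    fun τ => eventually_cellFrom_eq x τ _
  refine Measurable.prodMk (measurable_pi_lambda _ fun j => ?_) (measurable_pi_lambda _ fun j => ?_)
  · refine measurable_of_tendsto_metrizable
      (fun k => (measurable_pi_apply j).comp (measurable_fst.comp (hm k))) ?_
    refine tendsto_pi_nhds.2 fun τ => tendsto_const_nhds.congr' ?_
    filter_upwards [hlim τ] with k hk
    exact congrArg (fun C : Cell p => C.1 j) hk.symm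
  · refine measurable_of_tendsto_metrizable
      (fun k => (measurable_pi_apply j).comp (measurable_snd.comp (hm k))) ?_
    refine tendsto_pi_nhds.2 fun τ => tendsto_const_nhds.congr' ?_
    filter_upwards [hlim τ] with k hk
    exact congrArg (fun C : Cell p => C.2 j) hk.symm

end SplitTree

/-! ### Measurability of cells, counts and weights -/

theorem measurableSet_cube (p : ℕ) : MeasurableSet (cube p) := by
  have : cube p = ⋂ j, {u : Cov p | u j ∈ Set.Icc (0 : ℝ) 1} := by ext; simp [cube]
  rw [this]
  refine MeasurableSet.iInter fun j => ?_
  exact (by fun_prop : Measurable fun u : Cov p => u j) measurableSet_Icc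

theorem measurableSet_mem_cell (p : ℕ) :
    MeasurableSet {q : Cov p × Cell p | q.1 ∈ q.2.toSet} := by
  have : {q : Cov p × Cell p | q.1 ∈ q.2.toSet} = Prod.fst ⁻¹' cube p ∩
      ⋂ j, ({q | q.2.1 j ≤ (q.1 j : EReal)} ∩ {q | (q.1 j : EReal) < q.2.2 j}) := by
    ext q; simp [Cell.toSet]
  rw [this]
  have hu : ∀ j, Measurable fun q : Cov p × Cell p => (q.1 j : EReal) := fun j =>
    measurable_coe_real_ereal.comp ((by fun_prop : Measurable fun u : Cov p => u j).comp measurable_fst)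
  refine (measurable_fst (measurableSet_cube p)).inter (MeasurableSet.iInter fun j => ?_)
  exact (measurableSet_le ((measurable_pi_apply j).comp (measurable_fst.comp measurable_snd)) (hu j)).inter
    (measurableSet_lt (hu j) ((measurable_pi_apply j).comp (measurable_snd.comp measurable_snd)))

section Weights

variable {p d s : ℕ}

theorem measurable_count (I : Finset (Fin s)) :
    Measurable fun q : (Fin s → Obs p d) × Cell p => count I q.1 q.2 := by
  classical
  have : (fun q : (Fin s → Obs p d) × Cell p => count I q.1 q.2)
      = fun q => ∑ i ∈ I, if (q.1 i).1 ∈ q.2.toSet then 1 else 0 := by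
    funext q
    unfold count
    rw [Finset.card_filter]
  rw [this]
  refine Finset.measurable_sum _ fun i _ => Measurable.ite ?_ measurable_const measurable_const
  exact (((measurable_pi_apply i).comp measurable_fst).fst.prodMk measurable_snd)
    (measurableSet_mem_cell p)

theorem measurable_weight (I : Finset (Fin s)) (i : Fin s) :
    Measurable fun q : (Fin s → Obs p d) × Cell p => weight I q.1 q.2 i := by
  classical
  refine Measurable.ite ?_ ?_ measurable_const
  · exact (((measurable_pi_apply i).comp measurable_fst).fst.prodMk measurable_snd)
      (measurableSet_mem_cell p)
  · exact ((measurable_from_top (f := fun n : ℕ => (n : ℝ))).comp (measurable_count I)).inv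

theorem weight_nonneg (I : Finset (Fin s)) (z : Fin s → Obs p d) (L : Cell p) (i : Fin s) :
    0 ≤ weight I z L i := by
  unfold weight; split_ifs <;> positivity

theorem sum_weight (I : Finset (Fin s)) (z : Fin s → Obs p d) (L : Cell p) (h : 0 < count I z L) :
    ∑ i ∈ I, weight I z L i = 1 := by
  classical
  unfold weight
  rw [← Finset.sum_filter, Finset.sum_const, nsmul_eq_mul]
  have : (Finset.filter (fun i => (z i).1 ∈ L.toSet) I).card = count I z L := by
    unfold count; congr
  rw [this]
  exact mul_inv_cancel₀ (by exact_mod_cast h.ne')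

theorem sum_weight_le_one (I : Finset (Fin s)) (z : Fin s → Obs p d) (L : Cell p) :
    ∑ i ∈ I, weight I z L i ≤ 1 := by
  rcases Nat.eq_zero_or_pos (count I z L) with h | h
  · have : ∀ i ∈ I, weight I z L i = 0 := fun i _ => by simp [weight, h]
    rw [Finset.sum_congr rfl this]; simp
  · exact (sum_weight I z L h).le

theorem weight_le_one (I : Finset (Fin s)) (z : Fin s → Obs p d) (L : Cell p) (i : Fin s) :
    weight I z L i ≤ 1 := by
  unfold weight
  split_ifs
  · rcases Nat.eq_zero_or_pos (count I z L) with h | h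
    · simp [h]
    · exact inv_le_one_of_one_le₀ (by exact_mod_cast h)
  · exact zero_le_one

theorem TreeProcedure.measurable_leaf (A : TreeProcedure p d s) (x : Cov p) (I : Finset (Fin s)) :
    Measurable (A.leaf x I) :=
  (SplitTree.measurable_leafAt x).comp ((A.measurable_tree I).comp measurable_swap)

theorem TreeProcedure.measurable_leaf_weight (A : TreeProcedure p d s) (x : Cov p)
    (I : Finset (Fin s)) (i : Fin s) :
    Measurable fun ω : (Fin s → Obs p d) × A.Aux => weight I ω.1 (A.leaf x I ω) i :=
  (measurable_weight I i).comp (measurable_fst.prodMk (A.measurable_leaf x I))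

end Weights

/-! ### Side lengths and volumes of cells -/

/-- The point of `[0,1]` closest to `e`. -/
noncomputable def clamp (e : EReal) : ℝ := (max 0 (min 1 e)).toReal

theorem coe_clamp (e : EReal) : (clamp e : EReal) = max 0 (min 1 e) := by
  refine EReal.coe_toReal ?_ ?_
  · exact ne_of_lt (max_lt EReal.zero_lt_top ((min_le_left _ _).trans_lt (EReal.coe_lt_top 1)))
  · exact ne_of_gt (EReal.bot_lt_zero.trans_le (le_max_left _ _))

theorem clamp_mono : Monotone clamp := fun a b h => by
  rw [← EReal.coe_le_coe_iff, coe_clamp, coe_clamp]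
  exact max_le_max le_rfl (min_le_min le_rfl h)

theorem clamp_nonneg (e : EReal) : 0 ≤ clamp e := by
  rw [← EReal.coe_le_coe_iff, coe_clamp]
  exact le_max_left _ _

theorem clamp_le_one (e : EReal) : clamp e ≤ 1 := by
  rw [← EReal.coe_le_coe_iff, coe_clamp]
  exact max_le (by norm_num) (min_le_left _ _)

theorem clamp_coe (c : ℝ) : clamp (c : EReal) = max 0 (min 1 c) := by
  rw [← EReal.coe_eq_coe_iff, coe_clamp]
  have hmono : Monotone ((↑) : ℝ → EReal) := fun a b h => EReal.coe_le_coe_iff.2 h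
  rw [hmono.map_max, hmono.map_min]; rfl

theorem clamp_coe_of_mem {c : ℝ} (h : c ∈ Set.Icc (0 : ℝ) 1) : clamp (c : EReal) = c := by
  rw [clamp_coe, min_eq_right h.2, max_eq_right h.1]

theorem clamp_min (a b : EReal) : clamp (min a b) = min (clamp a) (clamp b) := clamp_mono.map_min
theorem clamp_max (a b : EReal) : clamp (max a b) = max (clamp a) (clamp b) := clamp_mono.map_max

theorem clamp_le_of_le {e : EReal} {u : ℝ} (hu : u ∈ Set.Icc (0 : ℝ) 1) (h : e ≤ u) : clamp e ≤ u := by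
  rw [← clamp_coe_of_mem hu]; exact clamp_mono h

theorem le_clamp_of_le {e : EReal} {u : ℝ} (hu : u ∈ Set.Icc (0 : ℝ) 1) (h : u ≤ e) : u ≤ clamp e := by
  rw [← clamp_coe_of_mem hu]; exact clamp_mono h

theorem lt_of_clamp_lt {e : EReal} {u : ℝ} (hu : u ∈ Set.Icc (0 : ℝ) 1) (h : clamp e < u) : e < u := by
  by_contra h'
  exact absurd (le_clamp_of_le hu (not_lt.1 h')) (not_le.2 h)

theorem lt_of_lt_clamp {e : EReal} {u : ℝ} (hu : u ∈ Set.Icc (0 : ℝ) 1) (h : u < clamp e) : u < e := by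
  by_contra h'
  exact absurd (clamp_le_of_le hu (not_lt.1 h')) (not_le.2 h)

variable {p : ℕ}

/-- The length of the `j`-th side of a cell within `[0,1]^p`. -/
noncomputable def Cell.len (C : Cell p) (j : Fin p) : ℝ := max 0 (clamp (C.2 j) - clamp (C.1 j))

/-- The volume of a cell within `[0,1]^p`. -/
noncomputable def Cell.vol (C : Cell p) : ℝ := ∏ j, C.len j

theorem Cell.len_nonneg (C : Cell p) (j : Fin p) : 0 ≤ C.len j := le_max_left _ _

theorem Cell.len_le_one (C : Cell p) (j : Fin p) : C.len j ≤ 1 :=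
  max_le zero_le_one (by linarith [clamp_le_one (C.2 j), clamp_nonneg (C.1 j)])

theorem Cell.vol_nonneg (C : Cell p) : 0 ≤ C.vol := Finset.prod_nonneg fun j _ => C.len_nonneg j

theorem Cell.abs_sub_le_len {C : Cell p} {u v : Cov p} (hu : u ∈ C.toSet) (hv : v ∈ C.toSet)
    (j : Fin p) : |u j - v j| ≤ C.len j := by
  have h1 := clamp_le_of_le (hu.1 j) (hu.2 j).1
  have h2 := le_clamp_of_le (hu.1 j) (hu.2 j).2.le
  have h3 := clamp_le_of_le (hv.1 j) (hv.2 j).1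
  have h4 := le_clamp_of_le (hv.1 j) (hv.2 j).2.le
  refine le_trans ?_ (le_max_right _ _)
  rw [abs_le]
  constructor <;> linarith

theorem measurableSet_toSet (C : Cell p) : MeasurableSet C.toSet :=
  measurable_prodMk_right (y := C) (measurableSet_mem_cell p)

/-- The half-open cell lies between the open and the closed box with the clamped endpoints, which
have equal volume. The truncation in `len` agrees with `ENNReal.ofReal` on degenerate sides. -/
theorem volume_toSet (C : Cell p) : volume C.toSet = ENNReal.ofReal C.vol := by
  have hvp := PiLp.volume_preserving_ofLp (Fin p)
  have hprod : ENNReal.ofReal C.vol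
      = ∏ j, ENNReal.ofReal (clamp (C.2 j) - clamp (C.1 j)) := by
    unfold Cell.vol
    rw [ENNReal.ofReal_prod_of_nonneg fun j _ => C.len_nonneg j]
    refine Finset.prod_congr rfl fun j _ => ?_
    unfold Cell.len
    rw [max_comm, ENNReal.ofReal_max]; simp
  have hsub : (WithLp.ofLp ⁻¹' (Set.univ.pi fun j => Set.Ioo (clamp (C.1 j)) (clamp (C.2 j))) :
      Set (Cov p)) ⊆ C.toSet := by
    intro u hu
    have hu' : ∀ j, u j ∈ Set.Ioo (clamp (C.1 j)) (clamp (C.2 j)) := fun j => hu j (Set.mem_univ j)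
    have h01 : ∀ j, u j ∈ Set.Icc (0 : ℝ) 1 := fun j =>
      ⟨(clamp_nonneg _).trans (hu' j).1.le, (hu' j).2.le.trans (clamp_le_one _)⟩
    exact ⟨h01, fun j => ⟨(lt_of_clamp_lt (h01 j) (hu' j).1).le, lt_of_lt_clamp (h01 j) (hu' j).2⟩⟩
  have hsup : C.toSet ⊆ (WithLp.ofLp ⁻¹' (Set.Icc (fun j => clamp (C.1 j)) (fun j => clamp (C.2 j))) :
      Set (Cov p)) := fun u hu =>
    ⟨fun j => clamp_le_of_le (hu.1 j) (hu.2 j).1, fun j => le_clamp_of_le (hu.1 j) (hu.2 j).2.le⟩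
  refine le_antisymm ?_ ?_
  · refine (measure_mono hsup).trans_eq ?_
    rw [hvp.measure_preimage measurableSet_Icc.nullMeasurableSet, Real.volume_Icc_pi, hprod]
  · refine le_trans (Eq.le ?_) (measure_mono hsub)
    rw [hvp.measure_preimage (MeasurableSet.univ_pi fun j => measurableSet_Ioo).nullMeasurableSet,
      Real.volume_pi_Ioo, hprod]

/-- The last clause serves for sets that are not cells, such as sublevel sets of `boxVol`, and shows
that the covariates lie in the cube. -/
theorem measure_cell_bounds {ν : Measure (Cov p)} [IsProbabilityMeasure ν] (hν : HasBoundedDensity ν) :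
    ∃ c C : ℝ, 0 < c ∧ c ≤ C ∧ (∀ S : Cell p, c * S.vol ≤ ν.real S.toSet ∧ ν.real S.toSet ≤ C * S.vol)
      ∧ ν ≤ ENNReal.ofReal C • volume.restrict (cube p) := by
  obtain ⟨g, hg, ⟨c, C, hc, hcC⟩, rfl⟩ := hν
  have h0 : (0 : Cov p) ∈ cube p := fun j => by simp
  have hcC' : c ≤ C := (hcC 0 h0).1.trans (hcC 0 h0).2
  have hC0 : 0 ≤ C := hc.le.trans hcC'
  refine ⟨c, C, hc, hcC', fun S => ?_, ?_⟩
  · have hS : S.toSet ⊆ cube p := fun u hu => hu.1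
    have hmeas : (volume.restrict (cube p)).withDensity (fun u => ENNReal.ofReal (g u)) S.toSet
        = ∫⁻ u in S.toSet, ENNReal.ofReal (g u) := by
      rw [withDensity_apply _ (measurableSet_toSet S),
        Measure.restrict_restrict (measurableSet_toSet S), Set.inter_eq_left.2 hS]
    have e : ∀ a : ℝ, 0 ≤ a → a * S.vol = (∫⁻ u in S.toSet, ENNReal.ofReal a).toReal := fun a ha => by
      rw [setLIntegral_const, volume_toSet, ENNReal.toReal_mul, ENNReal.toReal_ofReal ha,
        ENNReal.toReal_ofReal S.vol_nonneg]
    have htop : ∫⁻ u in S.toSet, ENNReal.ofReal C ≠ ⊤ := by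
      rw [setLIntegral_const, volume_toSet]
      exact ENNReal.mul_ne_top ENNReal.ofReal_ne_top ENNReal.ofReal_ne_top
    have hle : ∫⁻ u in S.toSet, ENNReal.ofReal (g u) ≤ ∫⁻ u in S.toSet, ENNReal.ofReal C :=
      setLIntegral_mono' (measurableSet_toSet S) fun u hu =>
        ENNReal.ofReal_le_ofReal (hcC u (hS hu)).2
    rw [Measure.real, hmeas, e c hc.le, e C hC0]
    refine ⟨ENNReal.toReal_mono (ne_top_of_le_ne_top htop hle) ?_, ENNReal.toReal_mono htop hle⟩
    exact setLIntegral_mono' (measurableSet_toSet S) fun u hu =>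
        ENNReal.ofReal_le_ofReal (hcC u (hS hu)).1
  · rw [← withDensity_const]
    refine withDensity_mono ?_
    rw [Filter.EventuallyLE, ae_restrict_iff' (measurableSet_cube p)]
    exact .of_forall fun u hu => ENNReal.ofReal_le_ofReal (hcC u hu).2

/-! ### Approximation of cells by grid cells -/

/-- A cell whose endpoints are multiples of `1 / m`. -/
noncomputable def gridCell (m : ℕ) (k l : Fin p → Fin (m + 2)) : Cell p :=
  (fun j => (((k j : ℕ) / m : ℝ) : EReal), fun j => (((l j : ℕ) / m : ℝ) : EReal))

theorem abs_prod_sub_prod_le {ι : Type*} (s : Finset ι) (f g : ι → ℝ)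
    (hf : ∀ i, f i ∈ Set.Icc (0 : ℝ) 1) (hg : ∀ i, g i ∈ Set.Icc (0 : ℝ) 1) :
    |∏ i ∈ s, f i - ∏ i ∈ s, g i| ≤ ∑ i ∈ s, |f i - g i| := by
  classical
  induction s using Finset.induction_on with
  | empty => simp
  | insert a s ha ih =>
    rw [Finset.prod_insert ha, Finset.prod_insert ha, Finset.sum_insert ha]
    have e : f a * ∏ i ∈ s, f i - g a * ∏ i ∈ s, g i
        = (f a - g a) * ∏ i ∈ s, f i + g a * (∏ i ∈ s, f i - ∏ i ∈ s, g i) := by ring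
    rw [e]
    refine (abs_add_le _ _).trans (add_le_add ?_ ?_)
    · rw [abs_mul]
      refine mul_le_of_le_one_right (abs_nonneg _) ?_
      rw [abs_of_nonneg (Finset.prod_nonneg fun i _ => (hf i).1)]
      exact Finset.prod_le_one (fun i _ => (hf i).1) fun i _ => (hf i).2
    · rw [abs_mul, abs_of_nonneg (hg a).1]
      exact (mul_le_of_le_one_left (abs_nonneg _) (hg a).2).trans ih

theorem abs_clamp_sub_le {c : ℝ} {h : ℝ} (hh : h ∈ Set.Icc (0 : ℝ) 1) {δ : ℝ} (hd : |c - h| ≤ δ) :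
    |clamp (c : EReal) - h| ≤ δ := by
  refine le_trans ?_ hd
  conv_lhs => rw [← max_eq_right hh.1, ← min_eq_right hh.2, clamp_coe]
  refine (abs_max_sub_max_le_max _ _ _ _).trans ?_
  simp only [sub_self, abs_zero]
  refine max_le (abs_nonneg _) ((abs_min_sub_min_le_max _ _ _ _).trans ?_)
  simp

theorem abs_vol_sub_le (C K : Cell p) {δ : ℝ} (h1 : ∀ j, |clamp (K.1 j) - clamp (C.1 j)| ≤ δ)
    (h2 : ∀ j, |clamp (K.2 j) - clamp (C.2 j)| ≤ δ) : |K.vol - C.vol| ≤ p * (2 * δ) := by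
  refine (abs_prod_sub_prod_le _ _ _ (fun j => ⟨K.len_nonneg j, K.len_le_one j⟩)
    (fun j => ⟨C.len_nonneg j, C.len_le_one j⟩)).trans ?_
  refine (Finset.sum_le_card_nsmul _ _ (2 * δ) fun j _ => ?_).trans_eq (by simp)
  refine (abs_max_sub_max_le_max _ _ _ _).trans ?_
  have a1 := abs_le.1 (h1 j)
  have a2 := abs_le.1 (h2 j)
  simp only [sub_self, abs_zero]
  refine max_le (by linarith) (abs_le.2 ⟨by linarith, by linarith⟩)

/-- The leaf depends on the data, so counts must be controlled for all cells at once. Rounding to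
mesh `1 / m` leaves polynomially many cells for a union bound and, for `m` points, moves an expected
count only by a constant. -/
theorem exists_outer_gridCell {m : ℕ} (hm : 0 < m) (C : Cell p) :
    ∃ k l : Fin p → Fin (m + 2), C.toSet ⊆ (gridCell m k l).toSet ∧
      |(gridCell m k l).vol - C.vol| ≤ p * (2 * (1 / m)) := by
  have hm' : (0 : ℝ) < m := by exact_mod_cast hm
  have hfl : ∀ e : EReal, ⌊m * clamp e⌋₊ ≤ m := fun e => by
    refine Nat.floor_le_of_le ?_
    exact mul_le_of_le_one_right hm'.le (clamp_le_one e)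
  have hf1 : ∀ e : EReal, ((⌊m * clamp e⌋₊ : ℕ) : ℝ) / m ≤ clamp e := fun e => by
    rw [div_le_iff₀ hm', mul_comm]
    exact Nat.floor_le (mul_nonneg (clamp_nonneg e) hm'.le)
  have hf2 : ∀ e : EReal, clamp e < ((⌊m * clamp e⌋₊ + 1 : ℕ) : ℝ) / m := fun e => by
    rw [lt_div_iff₀ hm', mul_comm]
    push_cast
    exact Nat.lt_floor_add_one _
  have hadd : ∀ e : EReal, ((⌊m * clamp e⌋₊ + 1 : ℕ) : ℝ) / m
      = ((⌊m * clamp e⌋₊ : ℕ) : ℝ) / m + 1 / m := fun e => by push_cast; rw [add_div]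
  -- The upper endpoint is rounded strictly up because cells are open above. It can reach `m + 1`,
  -- hence the index type `Fin (m + 2)`.
  refine ⟨fun j => ⟨⌊m * clamp (C.1 j)⌋₊, by have := hfl (C.1 j); omega⟩,
    fun j => ⟨⌊m * clamp (C.2 j)⌋₊ + 1, by have := hfl (C.2 j); omega⟩, ?_, ?_⟩
  · intro u hu
    refine ⟨hu.1, fun j => ⟨?_, ?_⟩⟩
    · exact EReal.coe_le_coe_iff.2 ((hf1 _).trans (clamp_le_of_le (hu.1 j) (hu.2 j).1))
    · exact EReal.coe_lt_coe_iff.2 ((le_clamp_of_le (hu.1 j) (hu.2 j).2.le).trans_lt (hf2 _))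
  · refine abs_vol_sub_le _ _ (fun j => ?_) (fun j => ?_)
    · refine abs_clamp_sub_le ⟨clamp_nonneg _, clamp_le_one _⟩ ?_
      have h1 := hf1 (C.1 j)
      have h2 := hf2 (C.1 j)
      rw [hadd] at h2
      rw [abs_le]
      constructor <;> simp only <;> linarith
    · refine abs_clamp_sub_le ⟨clamp_nonneg _, clamp_le_one _⟩ ?_
      have h1 := hf1 (C.2 j)
      have h2 := hf2 (C.2 j)
      have h3 := hadd (C.2 j)
      rw [abs_le]
      constructor <;> simp only <;> linarith

theorem exists_inner_gridCell {m : ℕ} (hm : 0 < m) (C : Cell p) :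
    ∃ k l : Fin p → Fin (m + 2), (gridCell m k l).toSet ⊆ C.toSet ∧
      |(gridCell m k l).vol - C.vol| ≤ p * (2 * (1 / m)) := by
  have hm' : (0 : ℝ) < m := by exact_mod_cast hm
  have hfl : ∀ e : EReal, ⌊m * clamp e⌋₊ ≤ m := fun e => by
    refine Nat.floor_le_of_le ?_
    exact mul_le_of_le_one_right hm'.le (clamp_le_one e)
  have hf1 : ∀ e : EReal, ((⌊m * clamp e⌋₊ : ℕ) : ℝ) / m ≤ clamp e := fun e => by
    rw [div_le_iff₀ hm', mul_comm]
    exact Nat.floor_le (mul_nonneg (clamp_nonneg e) hm'.le)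
  have hf2 : ∀ e : EReal, clamp e < ((⌊m * clamp e⌋₊ + 1 : ℕ) : ℝ) / m := fun e => by
    rw [lt_div_iff₀ hm', mul_comm]
    push_cast
    exact Nat.lt_floor_add_one _
  have hadd : ∀ e : EReal, ((⌊m * clamp e⌋₊ + 1 : ℕ) : ℝ) / m
      = ((⌊m * clamp e⌋₊ : ℕ) : ℝ) / m + 1 / m := fun e => by push_cast; rw [add_div]
  -- The roundings are reversed. The inner grid cell may be empty, which the truncated side lengths
  -- allow for.
  refine ⟨fun j => ⟨⌊m * clamp (C.1 j)⌋₊ + 1, by have := hfl (C.1 j); omega⟩,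
    fun j => ⟨⌊m * clamp (C.2 j)⌋₊, by have := hfl (C.2 j); omega⟩, ?_, ?_⟩
  · intro u hu
    refine ⟨hu.1, fun j => ⟨?_, ?_⟩⟩
    · exact (lt_of_clamp_lt (hu.1 j) ((hf2 _).trans_le (EReal.coe_le_coe_iff.1 (hu.2 j).1))).le
    · exact lt_of_lt_clamp (hu.1 j) ((EReal.coe_lt_coe_iff.1 (hu.2 j).2).trans_le (hf1 _))
  · refine abs_vol_sub_le _ _ (fun j => ?_) (fun j => ?_)
    · refine abs_clamp_sub_le ⟨clamp_nonneg _, clamp_le_one _⟩ ?_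
      have h1 := hf1 (C.1 j)
      have h2 := hf2 (C.1 j)
      have h3 := hadd (C.1 j)
      rw [abs_le]
      constructor <;> simp only <;> linarith
    · refine abs_clamp_sub_le ⟨clamp_nonneg _, clamp_le_one _⟩ ?_
      have h1 := hf1 (C.2 j)
      have h2 := hf2 (C.2 j)
      rw [hadd] at h2
      rw [abs_le]
      constructor <;> simp only <;> linarith

/-! ### Concentration of the number of points in a cell -/

section Concentration

variable {d s : ℕ} (ν : Measure (Cov p)) [IsProbabilityMeasure ν]
  (Q : Kernel (Cov p) (Resp d)) [IsMarkovKernel Q]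

instance : IsProbabilityMeasure (sampleLaw s ν Q) := by unfold sampleLaw; infer_instance

theorem measurable_count_cell (I : Finset (Fin s)) (C : Cell p) :
    Measurable fun z : Fin s → Obs p d => (count I z C : ℝ) :=
  (measurable_from_top (f := fun n : ℕ => (n : ℝ))).comp
    ((measurable_count I).comp (measurable_id.prodMk measurable_const))

theorem count_mono (I : Finset (Fin s)) (z : Fin s → Obs p d) {C D : Cell p} (h : C.toSet ⊆ D.toSet) :
    count I z C ≤ count I z D := by
  classical
  unfold count
  exact Finset.card_le_card (Finset.monotone_filter_right _ fun i _ hi => h hi)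

theorem count_le_card (I : Finset (Fin s)) (z : Fin s → Obs p d) (C : Cell p) :
    count I z C ≤ I.card := by
  classical
  unfold count
  exact Finset.card_filter_le _ _

theorem mgf_count (I : Finset (Fin s)) (C : Cell p) (c : ℝ) :
    mgf (fun z : Fin s → Obs p d => (count I z C : ℝ)) (sampleLaw s ν Q) c
      = (1 + (Real.exp c - 1) * ν.real C.toSet) ^ I.card := by
  classical
  have hset : MeasurableSet {w : Obs p d | w.1 ∈ C.toSet} := measurable_fst (measurableSet_toSet C)
  have hexp : ∀ z : Fin s → Obs p d, Real.exp (c * (count I z C : ℝ))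
      = ∏ i, (if i ∈ I then
          (1 + {w : Obs p d | w.1 ∈ C.toSet}.indicator (fun _ => Real.exp c - 1) (z i)) else 1) := by
    intro z
    have h1 : (count I z C : ℝ) = ∑ i ∈ I, if (z i).1 ∈ C.toSet then (1 : ℝ) else 0 := by
      unfold count
      rw [Finset.card_filter]
      push_cast
      refine Finset.sum_congr rfl fun i _ => ?_
      congr
    rw [h1, Finset.mul_sum, Real.exp_sum, Finset.prod_ite_mem, Finset.univ_inter]
    refine Finset.prod_congr rfl fun i _ => ?_
    by_cases h : (z i).1 ∈ C.toSet
    · rw [if_pos h, Set.indicator_of_mem (show z i ∈ {w : Obs p d | w.1 ∈ C.toSet} from h)]; simp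
    · rw [if_neg h, Set.indicator_of_notMem (show z i ∉ {w : Obs p d | w.1 ∈ C.toSet} from h)]; simp
  unfold mgf sampleLaw
  simp_rw [hexp]
  rw [integral_fintype_prod_eq_prod (μ := fun _ : Fin s => ν ⊗ₘ Q) (fun (i : Fin s) (w : Obs p d) => if i ∈ I then
          (1 + {w : Obs p d | w.1 ∈ C.toSet}.indicator (fun _ => Real.exp c - 1) w) else 1)]
  have hq : (ν ⊗ₘ Q).real {w : Obs p d | w.1 ∈ C.toSet} = ν.real C.toSet := by
    have := Measure.fst_compProd ν Q
    conv_rhs => rw [← this]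
    rw [Measure.real, Measure.real, Measure.fst_apply (measurableSet_toSet C)]; rfl
  have hint : ∀ i : Fin s, ∫ w, (if i ∈ I then
      (1 + {w : Obs p d | w.1 ∈ C.toSet}.indicator (fun _ => Real.exp c - 1) w) else 1) ∂(ν ⊗ₘ Q)
      = if i ∈ I then 1 + (Real.exp c - 1) * ν.real C.toSet else 1 := by
    intro i
    by_cases hi : i ∈ I
    · simp only [hi, if_true]
      rw [integral_add (integrable_const _) ((integrable_const _).indicator hset),
        integral_indicator_const _ hset, hq]
      simp [mul_comm]
    · simp [hi]
  simp_rw [hint]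
  rw [Finset.prod_ite_mem, Finset.univ_inter, Finset.prod_const]

/-- Chernoff's bound at parameter `1`, where `exp 1 - 1 ≤ 2` produces the factor `2`. Only the order
of magnitude of the mean matters, so no optimisation over the parameter is needed. -/
theorem prob_count_ge (I : Finset (Fin s)) (C : Cell p) (t : ℝ) :
    (sampleLaw s ν Q).real {z | 2 * I.card * ν.real C.toSet + t ≤ count I z C} ≤ Real.exp (-t) := by
  set q := ν.real C.toSet with hq
  have hq0 : 0 ≤ q := measureReal_nonneg
  refine (measure_ge_le_exp_mul_mgf (t := 1) _ zero_le_one ?_).trans ?_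
  · refine integrable_of_bdd ((measurable_count_cell I C).const_mul 1).exp.aestronglyMeasurable
      (M := Real.exp I.card) fun z => ?_
    rw [Real.norm_of_nonneg (Real.exp_pos _).le, one_mul]
    exact Real.exp_le_exp.2 (by exact_mod_cast count_le_card I z C)
  · rw [mgf_count, ← hq]
    have h1 : (1 + (Real.exp 1 - 1) * q) ^ I.card ≤ Real.exp (2 * I.card * q) := by
      have : 1 + (Real.exp 1 - 1) * q ≤ Real.exp (2 * q) := by
        have := Real.add_one_le_exp (2 * q)
        nlinarith [Real.exp_one_lt_three]
      refine (pow_le_pow_left₀ ?_ this _).trans_eq ?_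
      · nlinarith [Real.add_one_le_exp 1]
      · rw [← Real.exp_nat_mul]; congr 1; ring
    refine (mul_le_mul_of_nonneg_left h1 (Real.exp_pos _).le).trans_eq ?_
    rw [← Real.exp_add]; congr 1; ring

/-- Chernoff's bound at parameter `-1`, where `1 - exp (-1) ≥ 1 / 2` produces the factor `1 / 2`. -/
theorem prob_count_le (I : Finset (Fin s)) (C : Cell p) (t : ℝ) :
    (sampleLaw s ν Q).real {z | (count I z C : ℝ) ≤ I.card * ν.real C.toSet / 2 - t}
      ≤ Real.exp (-t) := by
  set q := ν.real C.toSet with hq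
  have hq0 : 0 ≤ q := measureReal_nonneg
  have hq1 : q ≤ 1 := measureReal_le_one
  refine (measure_le_le_exp_mul_mgf (t := -1) _ (by norm_num) ?_).trans ?_
  · refine integrable_of_bdd ((measurable_count_cell I C).const_mul (-1)).exp.aestronglyMeasurable
      (M := 1) fun z => ?_
    rw [Real.norm_of_nonneg (Real.exp_pos _).le]
    exact Real.exp_le_one_iff.2 (by simp)
  · rw [mgf_count, ← hq]
    have he : Real.exp (-1) ≤ 1 / 2 := by
      rw [Real.exp_neg, ← one_div]
      refine one_div_le_one_div_of_le (by norm_num) ?_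
      linarith [Real.add_one_le_exp 1]
    have he0 := Real.exp_pos (-1)
    have h1 : (1 + (Real.exp (-1) - 1) * q) ^ I.card ≤ Real.exp (-(I.card * q / 2)) := by
      have : 1 + (Real.exp (-1) - 1) * q ≤ Real.exp (-(q / 2)) := by
        have := Real.add_one_le_exp (-(q / 2))
        nlinarith
      refine (pow_le_pow_left₀ ?_ this _).trans_eq ?_
      · nlinarith
      · rw [← Real.exp_nat_mul]; congr 1; ring
    refine (mul_le_mul_of_nonneg_left h1 (Real.exp_pos _).le).trans_eq ?_
    rw [← Real.exp_add]; congr 1; ring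

/-- The samples for which the number of points in some grid cell is far from its mean. -/
def badSamples (I : Finset (Fin s)) (t : ℝ) : Set (Fin s → Obs p d) :=
  ⋃ kl : (Fin p → Fin (I.card + 2)) × (Fin p → Fin (I.card + 2)),
    {z | 2 * I.card * ν.real (gridCell I.card kl.1 kl.2).toSet + t ≤ count I z (gridCell I.card kl.1 kl.2)}
    ∪ {z | (count I z (gridCell I.card kl.1 kl.2) : ℝ)
        ≤ I.card * ν.real (gridCell I.card kl.1 kl.2).toSet / 2 - t}

theorem measurableSet_badSamples (I : Finset (Fin s)) (t : ℝ) :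
    MeasurableSet (badSamples (d := d) ν I t) := by
  refine MeasurableSet.iUnion fun kl => MeasurableSet.union ?_ ?_
  · exact measurableSet_le measurable_const (measurable_count_cell I _)
  · exact measurableSet_le (measurable_count_cell I _) measurable_const

/-- Union bound over the `(I.card + 2) ^ (2 * p)` pairs of corners, with two tails each. -/
theorem prob_badSamples_le (I : Finset (Fin s)) (t : ℝ) :
    (sampleLaw s ν Q).real (badSamples ν I t)
      ≤ 2 * ((I.card : ℝ) + 2) ^ (2 * p) * Real.exp (-t) := by
  unfold badSamples
  refine (measureReal_iUnion_fintype_le _).trans ?_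
  refine (Finset.sum_le_card_nsmul _ _ (2 * Real.exp (-t)) fun kl _ => ?_).trans_eq ?_
  · refine (measureReal_union_le _ _).trans ?_
    linarith [prob_count_ge ν Q I (gridCell I.card kl.1 kl.2) t,
      prob_count_le ν Q I (gridCell I.card kl.1 kl.2) t]
  · simp only [Finset.card_univ, Fintype.card_prod, Fintype.card_fun, Fintype.card_fin, nsmul_eq_mul]
    push_cast
    ring

/-- The number of points of every cell is comparable with its volume, up to `2 t`. -/
theorem count_bounds {I : Finset (Fin s)} {t c C : ℝ} {z : Fin s → Obs p d}
    (hz : z ∉ badSamples ν I t) (hI : 0 < I.card) (hc : 0 < c) (hcC : c ≤ C)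
    (hν : ∀ S : Cell p, c * S.vol ≤ ν.real S.toSet ∧ ν.real S.toSet ≤ C * S.vol)
    (ht : 4 * p * C ≤ t) (S : Cell p) :
    (count I z S : ℝ) ≤ 2 * C * I.card * S.vol + 2 * t ∧
      c / 2 * I.card * S.vol - 2 * t ≤ count I z S := by
  have hm : (0 : ℝ) < I.card := by exact_mod_cast hI
  simp only [badSamples, Set.mem_iUnion, Set.mem_union, Set.mem_ofPred_eq, not_exists, not_or,
    not_le] at hz
  have hC : 0 < C := hc.trans_le hcC
  have hp0 : (0 : ℝ) ≤ p := Nat.cast_nonneg p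
  -- The grid error in volume, multiplied by the number of points, is `2 * p`. It contributes at
  -- most `4 * p * C ≤ t` to the upper bound and less to the lower one, whence the total error `2 *
  -- t`.
  have hdiv : (I.card : ℝ) * (p * (2 * (1 / I.card))) = 2 * p := by field_simp
  constructor
  · obtain ⟨k, l, hsub, hvol⟩ := exists_outer_gridCell hI S
    have h1 : (count I z S : ℝ) ≤ count I z (gridCell I.card k l) := by
      exact_mod_cast count_mono I z hsub
    have h2 := (hz (k, l)).1
    have h3 := (hν (gridCell I.card k l)).2
    have h4 := (abs_le.1 hvol).2
    have h5 : (I.card : ℝ) * ν.real (gridCell I.card k l).toSet ≤ C * (I.card * S.vol + 2 * p) := by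
      rw [← hdiv, ← mul_add, mul_left_comm]
      refine mul_le_mul_of_nonneg_left (h3.trans ?_) hm.le
      exact mul_le_mul_of_nonneg_left (by linarith) hC.le
    simp only at h2
    nlinarith
  · obtain ⟨k, l, hsub, hvol⟩ := exists_inner_gridCell hI S
    have h1 : (count I z (gridCell I.card k l) : ℝ) ≤ count I z S := by
      exact_mod_cast count_mono I z hsub
    have h2 := (hz (k, l)).2
    have h3 := (hν (gridCell I.card k l)).1
    have h4 := (abs_le.1 hvol).1
    have h5 : c * (I.card * S.vol - 2 * p) ≤ (I.card : ℝ) * ν.real (gridCell I.card k l).toSet := by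
      rw [← hdiv, ← mul_sub, mul_left_comm]
      refine mul_le_mul_of_nonneg_left (le_trans ?_ h3) hm.le
      exact mul_le_mul_of_nonneg_left (by linarith) hc.le
    simp only at h2
    nlinarith [mul_le_mul_of_nonneg_right hcC hp0]

end Concentration

/-! ### Side lengths along the path to a leaf -/

section Lengths

variable {p : ℕ}

theorem Cell.len_left_of_ne (C : Cell p) {i j : Fin p} (c : ℝ) (h : i ≠ j) :
    (C.left j c).len i = C.len i := by
  simp [Cell.len, Cell.left, Function.update_of_ne h]

theorem Cell.len_right_of_ne (C : Cell p) {i j : Fin p} (c : ℝ) (h : i ≠ j) :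
    (C.right j c).len i = C.len i := by
  simp [Cell.len, Cell.right, Function.update_of_ne h]

theorem Cell.len_left_add_len_right (C : Cell p) (j : Fin p) (c : ℝ) :
    (C.left j c).len j + (C.right j c).len j = C.len j := by
  simp only [Cell.len, Cell.left, Cell.right, Function.update_self, clamp_min, clamp_max]
  generalize clamp (C.1 j) = a
  generalize clamp (C.2 j) = b
  generalize clamp (c : EReal) = e
  rcases le_total b e with h1 | h1 <;> rcases le_total a e with h2 | h2 <;>
    simp only [min_eq_left, min_eq_right, max_eq_left, max_eq_right, h1, h2]
  · rw [max_eq_left (a := (0 : ℝ)) (b := b - e) (by linarith), add_zero]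
  · rw [max_eq_left (a := (0 : ℝ)) (b := b - a) (by linarith), add_zero]
  · rw [max_eq_right (by linarith), max_eq_right (by linarith), max_eq_right (by linarith)]; ring
  · rw [max_eq_left (a := (0 : ℝ)) (b := e - a) (by linarith), zero_add]

theorem Cell.len_left_le (C : Cell p) (i j : Fin p) (c : ℝ) : (C.left j c).len i ≤ C.len i := by
  by_cases h : i = j
  · subst h
    linarith [C.len_left_add_len_right i c, (C.right i c).len_nonneg i]
  · exact (C.len_left_of_ne c h).le

theorem Cell.len_right_le (C : Cell p) (i j : Fin p) (c : ℝ) : (C.right j c).len i ≤ C.len i := by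
  by_cases h : i = j
  · subst h
    linarith [C.len_left_add_len_right i c, (C.left i c).len_nonneg i]
  · exact (C.len_right_of_ne c h).le

theorem measurable_len (j : Fin p) : Measurable fun C : Cell p => C.len j := by
  have hc : Measurable clamp := clamp_mono.measurable
  have h1 : Measurable fun C : Cell p => clamp (C.1 j) :=
    hc.comp ((measurable_pi_apply j).comp measurable_fst)
  have h2 : Measurable fun C : Cell p => clamp (C.2 j) :=
    hc.comp ((measurable_pi_apply j).comp measurable_snd)
  exact measurable_const.max (h2.sub h1)

/-- If the volume of a child cell is at least the fraction `γ` of its parent's, the length of the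
other child is at most the fraction `1 - γ`. -/
theorem len_le_of_vol {C D : Cell p} {j : Fin p} {γ : ℝ} (h0 : 0 < C.vol)
    (hD : ∀ i, i ≠ j → D.len i = C.len i) (h : γ * C.vol ≤ D.vol) : γ * C.len j ≤ D.len j := by
  unfold Cell.vol at h h0
  rw [← Finset.mul_prod_erase _ _ (Finset.mem_univ j)] at h h0
  rw [← Finset.mul_prod_erase _ (fun i => D.len i) (Finset.mem_univ j),
    Finset.prod_congr rfl (fun i hi => hD i (Finset.ne_of_mem_erase hi)), ← mul_assoc] at h
  have hpos : 0 < ∏ i ∈ Finset.univ.erase j, C.len i := by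
    refine lt_of_le_of_ne (Finset.prod_nonneg fun i _ => C.len_nonneg i) fun h' => ?_
    rw [← h', mul_zero] at h0
    exact lt_irrefl _ h0
  exact le_of_mul_le_mul_right h hpos

namespace SplitTree

open Classical in
/-- The number of splits along the feature `j` among the first `k` splits on the path to `x`. -/
noncomputable def numSplits (x : Cov p) (j : Fin p) : ℕ → SplitTree p → ℕ
  | 0, _ => 0
  | _ + 1, leaf => 0
  | k + 1, node i c l r => (if i = j then 1 else 0) + numSplits x j k (if x i < c then l else r)

open Classical in
/-- The path to `x` has at least `k` splits. -/
def DeepAt (x : Cov p) : ℕ → SplitTree p → Prop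
  | 0, _ => True
  | _ + 1, leaf => False
  | k + 1, node i c l r => DeepAt x k (if x i < c then l else r)

theorem len_leafFrom_le_self (τ : SplitTree p) (C : Cell p) (x : Cov p) (j : Fin p) :
    (τ.leafFrom C x).len j ≤ C.len j := by
  induction τ generalizing C with
  | leaf => exact le_rfl
  | node i c l r ihl ihr =>
    simp only [leafFrom]
    split_ifs
    · exact (ihl _).trans (C.len_left_le _ _ _)
    · exact (ihr _).trans (C.len_right_le _ _ _)

/-- A cell with at least `T ≥ 2κ` points cannot be a leaf, and it is large enough for the shrinkage
hypothesis. A split keeps at least the fraction `α` of the points, so `T ≤ α ^ k * N C` secures `k`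
shrinking splits in a row. Splits further down can only shorten the sides. -/
theorem len_leafFrom_le {α r T : ℝ} {κ : ℕ} {N : Cell p → ℕ} (hα : 0 < α) (hα1 : α ≤ 1)
    (hr : 0 ≤ r) (hT : (2 * κ : ℝ) ≤ T) (hT0 : 0 < T)
    (hshrink : ∀ (C : Cell p) (j : Fin p) (c : ℝ), T ≤ N C → α * N C ≤ N (C.left j c) →
      α * N C ≤ N (C.right j c) →
      (C.left j c).len j ≤ r * C.len j ∧ (C.right j c).len j ≤ r * C.len j)
    (x : Cov p) (j : Fin p) (k : ℕ) (τ : SplitTree p) (C : Cell p)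
    (hreg : τ.IsRegular α κ N C) (hk : T ≤ α ^ k * N C) :
    DeepAt x k τ ∧ (τ.leafFrom C x).len j ≤ r ^ (numSplits x j k τ) * C.len j := by
  induction k generalizing τ C with
  | zero =>
    refine ⟨trivial, ?_⟩
    simpa [numSplits] using len_leafFrom_le_self τ C x j
  | succ k ih =>
    have hTN : T ≤ N C := hk.trans
      (mul_le_of_le_one_left (Nat.cast_nonneg _) (pow_le_one₀ hα.le hα1))
    cases τ with
    | leaf =>
      exfalso
      have h2 : N C ≤ 2 * κ - 1 := hreg.2
      have h3 : (2 * κ : ℝ) ≤ N C := hT.trans hTN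
      have h4 : 2 * κ ≤ N C := by exact_mod_cast h3
      -- Positivity covers `κ = 0`, where the truncated `2 * κ - 1` is `0`.
      have h5 : (0 : ℝ) < N C := hT0.trans_le hTN
      have h6 : 0 < N C := by exact_mod_cast h5
      omega
    | node i c l r' =>
      obtain ⟨hL, hR, hregl, hregr⟩ := hreg
      have hs := hshrink C i c hTN hL hR
      have hstep : ∀ D : Cell p, α * N C ≤ N D → T ≤ α ^ k * N D := fun D hD => by
        refine hk.trans ?_
        rw [pow_succ, mul_assoc]
        exact mul_le_mul_of_nonneg_left hD (by positivity)
      by_cases hx : x i < c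
      · obtain ⟨h1, h2⟩ := ih l _ hregl (hstep _ hL)
        simp only [DeepAt, leafFrom, numSplits, hx, if_true]
        refine ⟨h1, h2.trans ?_⟩
        by_cases hij : i = j
        · subst hij
          rw [if_pos rfl, pow_add, pow_one, mul_comm r, mul_assoc]
          exact mul_le_mul_of_nonneg_left hs.1 (by positivity)
        · rw [if_neg hij, zero_add, C.len_left_of_ne c (Ne.symm hij)]
      · obtain ⟨h1, h2⟩ := ih r' _ hregr (hstep _ hR)
        simp only [DeepAt, leafFrom, numSplits, hx, if_false]
        refine ⟨h1, h2.trans ?_⟩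
        by_cases hij : i = j
        · subst hij
          rw [if_pos rfl, pow_add, pow_one, mul_comm r, mul_assoc]
          exact mul_le_mul_of_nonneg_left hs.2 (by positivity)
        · rw [if_neg hij, zero_add, C.len_right_of_ne c (Ne.symm hij)]

/-! ### The number of splits along a feature on the path to a point -/

open Classical in
/-- `r` for a split along the feature `j` that sends `x` to the side `b`, `1` for other such splits, `0` if
the split does not send `x` to the side `b`. -/
noncomputable def splitWeight (x : Cov p) (j : Fin p) (r : ℝ) (b : Bool) (s : (Fin p × ℝ) ⊕ Unit) : ℝ :=
  if (∃ i c, s = Sum.inl (i, c)) ∧ (goesLeft x s ↔ b = false) then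
    (if ∃ c, s = Sum.inl (j, c) then r else 1) else 0

theorem measurableSet_exists_split :
    MeasurableSet {s : (Fin p × ℝ) ⊕ Unit | ∃ i c, s = Sum.inl (i, c)} := by
  have : {s : (Fin p × ℝ) ⊕ Unit | ∃ i c, s = Sum.inl (i, c)}
      = ⋃ i, {s | ∃ c, s = Sum.inl (i, c)} := by ext s; simp
  rw [this]
  exact MeasurableSet.iUnion fun i => measurableSet_isSplit i

theorem measurable_splitWeight (x : Cov p) (j : Fin p) (r : ℝ) (b : Bool) :
    Measurable (splitWeight x j r b) := by
  refine Measurable.ite (measurableSet_exists_split.inter ?_)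
    (Measurable.ite (measurableSet_isSplit j) measurable_const measurable_const) measurable_const
  cases b
  · have : {s | goesLeft x s ↔ false = false} = {s | goesLeft x s} := by ext; simp
    have h : MeasurableSet {s | goesLeft x s ↔ false = false} := by
      rw [this]; exact measurableSet_goesLeft x
    exact h
  · have : {s | goesLeft x s ↔ true = false} = {s | goesLeft x s}ᶜ := by ext; simp
    have h : MeasurableSet {s | goesLeft x s ↔ true = false} := by
      rw [this]; exact (measurableSet_goesLeft x).compl
    exact h

theorem splitWeight_nonneg (x : Cov p) (j : Fin p) {r : ℝ} (hr : 0 ≤ r) (b : Bool)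
    (s : (Fin p × ℝ) ⊕ Unit) : 0 ≤ splitWeight x j r b s := by
  unfold splitWeight; split_ifs <;> first | exact hr | norm_num

theorem splitWeight_le_one (x : Cov p) (j : Fin p) {r : ℝ} (hr : r ≤ 1) (b : Bool)
    (s : (Fin p × ℝ) ⊕ Unit) : splitWeight x j r b s ≤ 1 := by
  unfold splitWeight; split_ifs <;> first | exact hr | norm_num

open Classical in
-- Exactly one child receives `x`, so passing to the two children keeps the total weight, except for
-- the loss of the fraction `1 - r` at a split along `j`. This is the one-step recursion for the
-- expected value of `r ^ numSplits`.
theorem splitWeight_add (x : Cov p) (j : Fin p) (r : ℝ) (s : (Fin p × ℝ) ⊕ Unit) :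
    splitWeight x j r false s + splitWeight x j r true s
      = (if ∃ i c, s = Sum.inl (i, c) then 1 else 0) - (1 - r) * if ∃ c, s = Sum.inl (j, c) then 1 else 0 := by
  by_cases h1 : ∃ i c, s = Sum.inl (i, c)
  · by_cases h2 : ∃ c, s = Sum.inl (j, c) <;> by_cases h3 : goesLeft x s <;>
      simp [splitWeight, h1, h2, h3]
  · have h2 : ¬ ∃ c, s = Sum.inl (j, c) := fun h => h1 ⟨j, h⟩
    simp [splitWeight, h1, h2]

/-- The weight `r ^ (number of splits along j)` on the event that the path to `x` starts with the
address `a`, as a function of the splits above `a`. -/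
noncomputable def histWeight (x : Cov p) (j : Fin p) (r : ℝ) (a : List Bool)
    (h : Fin a.length → (Fin p × ℝ) ⊕ Unit) : ℝ :=
  ∏ m : Fin a.length, splitWeight x j r (a.getD m false) (h m)

theorem histWeight_history (x : Cov p) (j : Fin p) (r : ℝ) (a : List Bool) (τ : SplitTree p) :
    histWeight x j r a (τ.history a)
      = ∏ m ∈ Finset.range a.length, splitWeight x j r (a.getD m false) (τ.splitAt (a.take m)) :=
  (Finset.prod_range fun m => splitWeight x j r (a.getD m false) (τ.splitAt (a.take m))).symm

/-- Appending a letter drives the induction on depth, where the random-split condition enters;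
`histWeight_cons` instead peels off the root, to match the recursion of the trees. -/
theorem histWeight_concat (x : Cov p) (j : Fin p) (r : ℝ) (a : List Bool) (b : Bool) (τ : SplitTree p) :
    histWeight x j r (a ++ [b]) (τ.history (a ++ [b]))
      = histWeight x j r a (τ.history a) * splitWeight x j r b (τ.splitAt a) := by
  rw [histWeight_history, histWeight_history, List.length_append, List.length_singleton,
    Finset.prod_range_succ]
  congr 1
  · refine Finset.prod_congr rfl fun m hm => ?_
    have hm' := Finset.mem_range.1 hm
    rw [List.getD_append _ _ _ _ hm', List.take_append_of_le_length hm'.le]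
  · simp

theorem histWeight_cons (x : Cov p) (j : Fin p) (r : ℝ) (a : List Bool) (b : Bool) (τ : SplitTree p) :
    histWeight x j r (b :: a) (τ.history (b :: a))
      = histWeight x j r a ((sub b τ).history a) * splitWeight x j r b (τ.splitAt []) := by
  rw [histWeight_history, histWeight_history, List.length_cons, Finset.prod_range_succ']
  congr 1
  refine Finset.prod_congr rfl fun m _ => ?_
  rw [splitAt_sub]; rfl

theorem histWeight_nonneg (x : Cov p) (j : Fin p) {r : ℝ} (hr : 0 ≤ r) (a : List Bool)
    (h : Fin a.length → (Fin p × ℝ) ⊕ Unit) : 0 ≤ histWeight x j r a h :=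
  Finset.prod_nonneg fun _ _ => splitWeight_nonneg x j hr _ _

theorem histWeight_le_one (x : Cov p) (j : Fin p) {r : ℝ} (hr : 0 ≤ r) (hr1 : r ≤ 1) (a : List Bool)
    (h : Fin a.length → (Fin p × ℝ) ⊕ Unit) : histWeight x j r a h ≤ 1 :=
  Finset.prod_le_one (fun _ _ => splitWeight_nonneg x j hr _ _) fun _ _ => splitWeight_le_one x j hr1 _ _

theorem measurable_histWeight (x : Cov p) (j : Fin p) (r : ℝ) (a : List Bool) :
    Measurable (histWeight x j r a) :=
  Finset.measurable_prod _ fun m _ => (measurable_splitWeight x j r _).comp (measurable_pi_apply m)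

theorem measurable_history (a : List Bool) : Measurable (history a : SplitTree p → _) :=
  measurable_pi_lambda _ fun m => measurable_splitAt (a.take m)

/-- The address is that of the path to `x`. Since the path is random whereas the random-split
condition concerns fixed addresses, the expectation along the path is bounded by a sum over all
addresses of length `k`. -/
theorem exists_address {x : Cov p} (j : Fin p) (r : ℝ) (k : ℕ) (τ : SplitTree p)
    (h : DeepAt x k τ) : ∃ a : List Bool, a.length = k ∧
      r ^ numSplits x j k τ = histWeight x j r a (τ.history a) := by
  classical
  induction k generalizing τ with
  | zero => exact ⟨[], rfl, by simp [numSplits, histWeight]⟩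
  | succ k ih =>
    cases τ with
    | leaf => exact h.elim
    | node i c l r' =>
      simp only [DeepAt] at h
      obtain ⟨a, ha, hw⟩ := ih _ h
      have hj : (∃ c', (Sum.inl (i, c) : (Fin p × ℝ) ⊕ Unit) = Sum.inl (j, c')) ↔ i = j := by
        simp
      refine ⟨(!decide (x i < c)) :: a, by simp [ha], ?_⟩
      rw [histWeight_cons]
      have hsub : sub (!decide (x i < c)) (node i c l r') = if x i < c then l else r' := by
        by_cases hx : x i < c <;> simp [sub, hx]
      have hsw : splitWeight x j r (!decide (x i < c)) ((node i c l r').splitAt [])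
          = r ^ (if i = j then 1 else 0) := by
        simp only [splitAt, splitWeight, goesLeft_inl, hj]
        rw [if_pos]
        · split_ifs <;> simp
        · refine ⟨⟨i, c, rfl⟩, by simp⟩
      rw [hsub, hsw, ← hw, numSplits, pow_add, mul_comm]

/-- The addresses of length `k`. -/
def addresses : ℕ → Finset (List Bool)
  | 0 => {[]}
  | k + 1 => (addresses k ×ˢ Finset.univ).image fun q => q.1 ++ [q.2]

theorem mem_addresses (a : List Bool) : a ∈ addresses a.length := by
  induction a using List.reverseRecOn with
  | nil => simp [addresses]
  | append_singleton a b ih =>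
    rw [List.length_append, List.length_singleton, addresses, Finset.mem_image]
    exact ⟨(a, b), by simp [ih], rfl⟩

theorem sum_addresses_succ (k : ℕ) (f : List Bool → ℝ) :
    ∑ a ∈ addresses (k + 1), f a = ∑ a ∈ addresses k, (f (a ++ [false]) + f (a ++ [true])) := by
  rw [addresses, Finset.sum_image, Finset.sum_product]
  · refine Finset.sum_congr rfl fun a _ => ?_
    rw [Fintype.sum_bool, add_comm]
  · rintro ⟨a, b⟩ _ ⟨a', b'⟩ _ h
    have := List.append_inj' h rfl
    simpa using this

section RandomTree

variable {Ξ : Type*} [MeasurableSpace Ξ] (law : Measure Ξ) [IsProbabilityMeasure law]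
  (tree : Ξ → SplitTree p) (htree : Measurable tree)

include htree in
-- The random-split condition, read for all sets `B`, is an inequality between the laws of the
-- history restricted to two events. It therefore passes to integrals of non-negative functions of
-- the history.
theorem integral_histWeight_split_le {q : ℝ} (hq : 0 ≤ q) (x : Cov p) (j : Fin p) {r : ℝ} (hr : 0 ≤ r)
    (hr1 : r ≤ 1) (a : List Bool)
    (hrs : ∀ B : Set (Fin a.length → (Fin p × ℝ) ⊕ Unit), MeasurableSet B →
      q * law.real {ξ | (tree ξ).history a ∈ B ∧ ∃ j' c, (tree ξ).splitAt a = Sum.inl (j', c)}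
      ≤ law.real {ξ | (tree ξ).history a ∈ B ∧ ∃ c, (tree ξ).splitAt a = Sum.inl (j, c)}) :
    q * ∫ ξ in {ξ | ∃ j' c, (tree ξ).splitAt a = Sum.inl (j', c)},
        histWeight x j r a ((tree ξ).history a) ∂law
      ≤ ∫ ξ in {ξ | ∃ c, (tree ξ).splitAt a = Sum.inl (j, c)},
        histWeight x j r a ((tree ξ).history a) ∂law := by
  have hh : Measurable fun ξ => (tree ξ).history a := (measurable_history a).comp htree
  have hw := measurable_histWeight x j r a
  set S := {ξ | ∃ j' c, (tree ξ).splitAt a = Sum.inl (j', c)} with hS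
  set S' := {ξ | ∃ c, (tree ξ).splitAt a = Sum.inl (j, c)} with hS'
  have hle : ENNReal.ofReal q • (law.restrict S).map (fun ξ => (tree ξ).history a)
      ≤ (law.restrict S').map (fun ξ => (tree ξ).history a) := by
    refine Measure.le_intro fun B hB _ => ?_
    rw [Measure.smul_apply, Measure.map_apply hh hB, Measure.map_apply hh hB,
      Measure.restrict_apply (hh hB), Measure.restrict_apply (hh hB), smul_eq_mul]
    have h := hrs B hB
    rw [← ENNReal.ofReal_toReal (measure_ne_top law ((fun ξ => (tree ξ).history a) ⁻¹' B ∩ S)),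
      ← ENNReal.ofReal_toReal (measure_ne_top law ((fun ξ => (tree ξ).history a) ⁻¹' B ∩ S')),
      ← ENNReal.ofReal_mul hq]
    exact ENNReal.ofReal_le_ofReal h
  have hb : ∀ h, ‖histWeight x j r a h‖ ≤ 1 := fun h => by
    rw [Real.norm_of_nonneg (histWeight_nonneg x j hr a h)]
    exact histWeight_le_one x j hr hr1 a h
  have := integral_mono_measure hle (.of_forall fun h => histWeight_nonneg x j hr a h)
    (integrable_of_bdd hw.aestronglyMeasurable hb)
  rw [integral_smul_measure, integral_map hh.aemeasurable hw.aestronglyMeasurable,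
    integral_map hh.aemeasurable hw.aestronglyMeasurable, ENNReal.toReal_ofReal hq] at this
  exact this

include htree in
-- At each address, the two extensions carry the weight on the event of a split minus `1 - r` times
-- the weight on the event of a split along `j`. The latter is at least `q` times the former, so
-- each level costs a factor `1 - (1 - r) * q`.
theorem sum_integral_histWeight_le {q : ℝ} (hq : 0 ≤ q) (hq1 : q ≤ 1) (x : Cov p) (j : Fin p) {r : ℝ}
    (hr : 0 ≤ r) (hr1 : r ≤ 1)
    (hrs : ∀ (a : List Bool) (B : Set (Fin a.length → (Fin p × ℝ) ⊕ Unit)), MeasurableSet B →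
      q * law.real {ξ | (tree ξ).history a ∈ B ∧ ∃ j' c, (tree ξ).splitAt a = Sum.inl (j', c)}
      ≤ law.real {ξ | (tree ξ).history a ∈ B ∧ ∃ c, (tree ξ).splitAt a = Sum.inl (j, c)}) (k : ℕ) :
    ∑ a ∈ addresses k, ∫ ξ, histWeight x j r a ((tree ξ).history a) ∂law
      ≤ (1 - (1 - r) * q) ^ k := by
  classical
  have hρ : 0 ≤ 1 - (1 - r) * q := by nlinarith
  induction k with
  | zero => simp [addresses, histWeight]
  | succ k ih =>
    rw [sum_addresses_succ, pow_succ, mul_comm]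
    refine le_trans ?_ (mul_le_mul_of_nonneg_left ih hρ)
    rw [Finset.mul_sum]
    refine Finset.sum_le_sum fun a _ => ?_
    have hmS : MeasurableSet {ξ | ∃ j' c, (tree ξ).splitAt a = Sum.inl (j', c)} :=
      ((measurable_splitAt a).comp htree) measurableSet_exists_split
    have hmS' : MeasurableSet {ξ | ∃ c, (tree ξ).splitAt a = Sum.inl (j, c)} :=
      ((measurable_splitAt a).comp htree) (measurableSet_isSplit j)
    have hW : ∀ a : List Bool, Integrable (fun ξ => histWeight x j r a ((tree ξ).history a)) law :=
      fun a => integrable_of_bdd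
        (((measurable_histWeight x j r a).comp ((measurable_history a).comp htree)).aestronglyMeasurable)
        (M := 1) fun ξ => by
          rw [Real.norm_of_nonneg (histWeight_nonneg x j hr a _)]
          exact histWeight_le_one x j hr hr1 a _
    have hkey := integral_histWeight_split_le law tree htree hq x j hr hr1 a (hrs a)
    rw [← integral_add (hW _) (hW _)]
    have hpt : ∀ ξ, histWeight x j r (a ++ [false]) ((tree ξ).history (a ++ [false]))
        + histWeight x j r (a ++ [true]) ((tree ξ).history (a ++ [true]))
        = {ξ | ∃ j' c, (tree ξ).splitAt a = Sum.inl (j', c)}.indicator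
            (fun ξ => histWeight x j r a ((tree ξ).history a)) ξ
          - (1 - r) * {ξ | ∃ c, (tree ξ).splitAt a = Sum.inl (j, c)}.indicator
            (fun ξ => histWeight x j r a ((tree ξ).history a)) ξ := by
      intro ξ
      rw [histWeight_concat, histWeight_concat, ← mul_add, splitWeight_add, Set.indicator_apply,
        Set.indicator_apply]
      simp only [Set.mem_ofPred_eq]
      by_cases h1 : ∃ j' c, (tree ξ).splitAt a = Sum.inl (j', c) <;>
        by_cases h2 : ∃ c, (tree ξ).splitAt a = Sum.inl (j, c) <;>
        simp only [h1, h2, if_true, if_false] <;> ring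
    simp_rw [hpt]
    rw [integral_sub ((hW a).indicator hmS) (((hW a).indicator hmS').const_mul _), integral_const_mul,
      integral_indicator hmS, integral_indicator hmS']
    have h1 : ∫ ξ in {ξ | ∃ j' c, (tree ξ).splitAt a = Sum.inl (j', c)},
        histWeight x j r a ((tree ξ).history a) ∂law
        ≤ ∫ ξ, histWeight x j r a ((tree ξ).history a) ∂law :=
      setIntegral_le_integral (hW a) (.of_forall fun ξ => histWeight_nonneg x j hr a _)
    have h2 := mul_le_mul_of_nonneg_left hkey (sub_nonneg.2 hr1)
    have h3 := mul_le_mul_of_nonneg_left h1 hρ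
    nlinarith

include htree in
/-- The mean length of a side of the leaf decreases geometrically in the depth of the leaf. -/
theorem integral_len_leafAt_le {q : ℝ} (hq : 0 ≤ q) (hq1 : q ≤ 1) (x : Cov p) (j : Fin p) {r : ℝ}
    (hr : 0 ≤ r) (hr1 : r ≤ 1)
    (hrs : ∀ (a : List Bool) (B : Set (Fin a.length → (Fin p × ℝ) ⊕ Unit)), MeasurableSet B →
      q * law.real {ξ | (tree ξ).history a ∈ B ∧ ∃ j' c, (tree ξ).splitAt a = Sum.inl (j', c)}
      ≤ law.real {ξ | (tree ξ).history a ∈ B ∧ ∃ c, (tree ξ).splitAt a = Sum.inl (j, c)}) (k : ℕ)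
    (hdeep : ∀ᵐ ξ ∂law, DeepAt x k (tree ξ) ∧
      ((tree ξ).leafAt x).len j ≤ r ^ numSplits x j k (tree ξ)) :
    ∫ ξ, ((tree ξ).leafAt x).len j ∂law ≤ (1 - (1 - r) * q) ^ k := by
  refine le_trans ?_ (sum_integral_histWeight_le law tree htree hq hq1 x j hr hr1 hrs k)
  have hW : ∀ a : List Bool, Integrable (fun ξ => histWeight x j r a ((tree ξ).history a)) law :=
    fun a => integrable_of_bdd
      (((measurable_histWeight x j r a).comp ((measurable_history a).comp htree)).aestronglyMeasurable)
      (M := 1) fun ξ => by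
        rw [Real.norm_of_nonneg (histWeight_nonneg x j hr a _)]
        exact histWeight_le_one x j hr hr1 a _
  rw [← integral_finsetSum _ fun a _ => hW a]
  refine integral_mono_ae ?_ (integrable_finsetSum _ fun a _ => hW a) ?_
  · refine integrable_of_bdd (((measurable_len j).comp
      ((measurable_leafAt x).comp htree)).aestronglyMeasurable) (M := 1) fun ξ => ?_
    rw [Real.norm_of_nonneg (Cell.len_nonneg _ _)]
    exact Cell.len_le_one _ _
  · filter_upwards [hdeep] with ξ hξ
    obtain ⟨a, ha, hw⟩ := exists_address j r k _ hξ.1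
    refine hξ.2.trans ?_
    rw [hw]
    refine Finset.single_le_sum (f := fun a => histWeight x j r a ((tree ξ).history a))
      (fun a _ => histWeight_nonneg x j hr a _) ?_
    rw [← ha]
    exact mem_addresses a

end RandomTree

end SplitTree

end Lengths

/-! ### Weights of the observations, averaged over the randomness of the tree. -/

namespace TreeProcedure

variable {p d s : ℕ} (A : TreeProcedure p d s) (x : Cov p)

open Classical in
/-- The weight of the observation `i` in the tree with the given half and auxiliary randomness. -/
noncomputable def weightAt (I : Finset (Fin s)) (i : Fin s) (ω : (Fin s → Obs p d) × A.Aux) : ℝ :=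
  if i ∈ I then weight I ω.1 (A.leaf x I ω) i else 0

/-- The weight of the observation `i` with the randomness of the tree integrated out. -/
noncomputable def meanWeight (i : Fin s) (z : Fin s → Obs p d) : ℝ :=
  ((halves s).card : ℝ)⁻¹ * ∑ I ∈ halves s, ∫ ξ, A.weightAt x I i (z, ξ) ∂A.law

theorem measurable_weightAt (I : Finset (Fin s)) (i : Fin s) : Measurable (A.weightAt x I i) := by
  unfold weightAt
  by_cases h : i ∈ I
  · simp only [h, if_true]; exact A.measurable_leaf_weight x I i
  · simp only [h, if_false]; exact measurable_const

theorem weightAt_nonneg (I : Finset (Fin s)) (i : Fin s) (ω) : 0 ≤ A.weightAt x I i ω := by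
  unfold weightAt; split_ifs
  · exact weight_nonneg _ _ _ _
  · exact le_rfl

theorem weightAt_le_one (I : Finset (Fin s)) (i : Fin s) (ω) : A.weightAt x I i ω ≤ 1 := by
  unfold weightAt; split_ifs
  · exact weight_le_one _ _ _ _
  · exact zero_le_one

theorem sum_weightAt (I : Finset (Fin s)) (ω) :
    ∑ i, A.weightAt x I i ω = ∑ i ∈ I, weight I ω.1 (A.leaf x I ω) i := by
  classical
  unfold weightAt
  rw [Finset.sum_ite_mem, Finset.univ_inter]

theorem sum_weightAt_le_one (I : Finset (Fin s)) (ω) : ∑ i, A.weightAt x I i ω ≤ 1 := by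
  rw [sum_weightAt]; exact sum_weight_le_one _ _ _

theorem integrable_weightAt (I : Finset (Fin s)) (i : Fin s) (z : Fin s → Obs p d) :
    Integrable (fun ξ => A.weightAt x I i (z, ξ)) A.law :=
  integrable_of_bdd
    ((A.measurable_weightAt x I i).comp (measurable_const.prodMk measurable_id)).aestronglyMeasurable
    (M := 1) fun ξ => by
      rw [Real.norm_of_nonneg (A.weightAt_nonneg x I i _)]
      exact A.weightAt_le_one x I i _

theorem halves_nonempty (s : ℕ) : (halves s).Nonempty := by
  unfold halves
  rw [Finset.powersetCard_nonempty]
  simp; omega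

theorem card_halves_pos (s : ℕ) : (0 : ℝ) < (halves s).card := by
  exact_mod_cast (halves_nonempty s).card_pos

theorem card_of_mem_halves {I : Finset (Fin s)} (hI : I ∈ halves s) : I.card = (s + 1) / 2 :=
  (Finset.mem_powersetCard.1 hI).2

theorem average_le {f : Finset (Fin s) → ℝ} {B : ℝ} (h : ∀ I ∈ halves s, f I ≤ B) :
    ((halves s).card : ℝ)⁻¹ * ∑ I ∈ halves s, f I ≤ B := by
  rw [inv_mul_le_iff₀ (card_halves_pos s)]
  exact (Finset.sum_le_card_nsmul _ _ _ h).trans_eq (nsmul_eq_mul _ _)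

theorem meanWeight_nonneg (i : Fin s) (z) : 0 ≤ A.meanWeight x i z :=
  mul_nonneg (by positivity) (Finset.sum_nonneg fun I _ =>
    integral_nonneg fun ξ => A.weightAt_nonneg x I i _)

theorem sum_meanWeight (z : Fin s → Obs p d) :
    ∑ i, A.meanWeight x i z
      = ((halves s).card : ℝ)⁻¹ * ∑ I ∈ halves s, ∫ ξ, ∑ i, A.weightAt x I i (z, ξ) ∂A.law := by
  unfold meanWeight
  rw [← Finset.mul_sum, Finset.sum_comm]
  congr 1
  refine Finset.sum_congr rfl fun I _ => ?_
  rw [integral_finsetSum _ fun i _ => A.integrable_weightAt x I i z]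

theorem sum_meanWeight_le_one (z : Fin s → Obs p d) : ∑ i, A.meanWeight x i z ≤ 1 := by
  rw [sum_meanWeight]
  refine average_le fun I _ => ?_
  refine (integral_mono (integrable_finsetSum _ fun i _ => A.integrable_weightAt x I i z)
    (integrable_const 1) fun ξ => A.sum_weightAt_le_one x I _).trans ?_
  simp

theorem meanWeight_le_one (i : Fin s) (z) : A.meanWeight x i z ≤ 1 :=
  (Finset.single_le_sum (f := fun i => A.meanWeight x i z)
    (fun i _ => A.meanWeight_nonneg x i z) (Finset.mem_univ i)).trans (A.sum_meanWeight_le_one x z)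

theorem norm_meanWeight_le (i : Fin s) (z) : ‖A.meanWeight x i z‖ ≤ 1 := by
  rw [Real.norm_of_nonneg (A.meanWeight_nonneg x i z)]; exact A.meanWeight_le_one x i z

theorem stronglyMeasurable_meanWeight (i : Fin s) : StronglyMeasurable (A.meanWeight x i) := by
  unfold meanWeight
  refine StronglyMeasurable.const_mul (Finset.stronglyMeasurable_fun_sum _ fun I _ => ?_) _
  exact (A.measurable_weightAt x I i).stronglyMeasurable.integral_prod_right'

section Law

variable (ν : Measure (Cov p)) [IsProbabilityMeasure ν]
  (Q : Kernel (Cov p) (Resp d)) [IsMarkovKernel Q]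

instance : IsProbabilityMeasure (A.jointLaw ν Q) := by unfold jointLaw; infer_instance

variable {ν Q}

/-- Regularity makes the leaf of `x` non-empty, since it holds at least `κ ≥ 1` points. -/
theorem sum_meanWeight_ae_eq_one {α : ℝ} {κ : ℕ} (hκ : 1 ≤ κ) (hs : κ ≤ (s + 1) / 2)
    (hreg : A.AlphaRegular ν Q α κ) : ∀ᵐ z ∂(sampleLaw s ν Q), ∑ i, A.meanWeight x i z = 1 := by
  have h : ∀ᵐ z ∂(sampleLaw s ν Q), ∀ I ∈ halves s, ∀ᵐ ξ ∂A.law,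
      (A.tree I ξ z).IsRegular α κ (count I z) (Cell.root p) := by
    rw [Filter.eventually_all_finset]
    exact fun I hI => Measure.ae_ae_of_ae_prod (hreg hs I hI)
  filter_upwards [h] with z hz
  rw [sum_meanWeight]
  have : ∀ I ∈ halves s, ∫ ξ, ∑ i, A.weightAt x I i (z, ξ) ∂A.law = 1 := fun I hI => by
    have h1 : ∀ᵐ ξ ∂A.law, ∑ i, A.weightAt x I i (z, ξ) = 1 := by
      filter_upwards [hz I hI] with ξ hξ
      rw [sum_weightAt]
      exact sum_weight I z _ (lt_of_lt_of_le hκ (hξ.leafFrom x).1)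
    rw [integral_congr_ae h1]; simp
  rw [Finset.sum_congr rfl this, Finset.sum_const, nsmul_eq_mul, mul_one,
    inv_mul_cancel₀ (card_halves_pos s).ne']

theorem count_map (σ : Equiv.Perm (Fin s)) (I : Finset (Fin s)) (z : Fin s → Obs p d) (L : Cell p) :
    count (I.map σ.toEmbedding) z L = count I (fun i => z (σ i)) L := by
  classical
  unfold count
  rw [Finset.filter_map, Finset.card_map]
  rfl

theorem weight_map (σ : Equiv.Perm (Fin s)) (I : Finset (Fin s)) (z : Fin s → Obs p d) (L : Cell p)
    (i : Fin s) : weight (I.map σ.toEmbedding) z L (σ i) = weight I (fun i => z (σ i)) L i := by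
  unfold weight
  rw [count_map]

theorem map_mem_halves (σ : Equiv.Perm (Fin s)) (I : Finset (Fin s)) :
    I.map σ.toEmbedding ∈ halves s ↔ I ∈ halves s := by
  simp [halves, Finset.mem_powersetCard]

/-- A relabelling permutes the halves among themselves, and for a given half the weight is a
function of the sample and the leaf. As the auxiliary randomness is integrated out, equality of the
laws of the leaf suffices. -/
theorem meanWeight_perm (hx : x ∈ cube p) (hsym : A.Symmetric ν Q) (σ : Equiv.Perm (Fin s)) :
    ∀ᵐ z ∂(sampleLaw s ν Q), ∀ i,
      A.meanWeight x (σ i) z = A.meanWeight x i (fun k => z (σ k)) := by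
  classical
  have h : ∀ᵐ z ∂(sampleLaw s ν Q), ∀ I ∈ halves s, ∀ u ∈ cube p,
    A.law.map (fun ξ => (A.tree (I.map σ.toEmbedding) ξ z).leafAt u)
      = A.law.map (fun ξ => (A.tree I ξ (fun i => z (σ i))).leafAt u) := by
    rw [Filter.eventually_all_finset]
    exact fun I hI => hsym I hI σ
  filter_upwards [h] with z hz i
  unfold meanWeight
  congr 1
  have hre : ∑ J ∈ halves s, ∫ ξ, A.weightAt x J (σ i) (z, ξ) ∂A.law
      = ∑ I ∈ halves s, ∫ ξ, A.weightAt x (I.map σ.toEmbedding) (σ i) (z, ξ) ∂A.law := by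
    refine (Finset.sum_equiv (Equiv.finsetCongr σ) (fun I => ?_) (fun I _ => ?_)).symm
    · simp [map_mem_halves]
    · simp
  rw [hre]
  refine Finset.sum_congr rfl fun I hI => ?_
  by_cases hi : i ∈ I
  · have hi' : σ i ∈ I.map σ.toEmbedding := by simpa using hi
    simp only [weightAt, hi, hi', if_true, weight_map]
    have hm : Measurable fun L : Cell p => weight I (fun k => z (σ k)) L i :=
      (measurable_weight I i).comp (measurable_prodMk_left (x := fun k => z (σ k)))
    have m1 : Measurable fun ξ => A.leaf x (I.map σ.toEmbedding) (z, ξ) :=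
      (A.measurable_leaf x _).comp (measurable_const.prodMk measurable_id)
    have m2 : Measurable fun ξ => A.leaf x I ((fun k => z (σ k)), ξ) :=
      (A.measurable_leaf x _).comp (measurable_const.prodMk measurable_id)
    rw [← integral_map (φ := fun ξ => A.leaf x (I.map σ.toEmbedding) (z, ξ))
        (f := fun L => weight I (fun k => z (σ k)) L i) m1.aemeasurable hm.aestronglyMeasurable,
      ← integral_map (φ := fun ξ => A.leaf x I ((fun k => z (σ k)), ξ))
        (f := fun L => weight I (fun k => z (σ k)) L i) m2.aemeasurable hm.aestronglyMeasurable]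
    have := hz I hI x hx
    unfold leaf
    rw [this]
  · simp [weightAt, hi]

/-- By honesty the weight of an observation does not depend on its response. -/
theorem meanWeight_update (hhon : A.Honest) (i : Fin s) (z : Fin s → Obs p d) (u : Cov p)
    (y y' : Resp d) :
    A.meanWeight x i (Function.update z i (u, y)) = A.meanWeight x i (Function.update z i (u, y')) := by
  classical
  unfold meanWeight
  congr 1
  refine Finset.sum_congr rfl fun I hI => ?_
  congr 1
  funext ξ
  -- If `i ∉ I` the tree may well use the response of `i`, but then its weight is zero.
  by_cases hi : i ∈ I
  · have hX : ∀ k, (Function.update z i (u, y) k).1 = (Function.update z i (u, y') k).1 := fun k => by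
      by_cases hk : k = i
      · subst hk; simp
      · simp [Function.update_of_ne hk]
    have ht : A.tree I ξ (Function.update z i (u, y)) = A.tree I ξ (Function.update z i (u, y')) := by
      refine hhon I hI _ _ hX (fun k hk => ?_) ξ
      have hki : k ≠ i := fun h => hk (h ▸ hi)
      simp [Function.update_of_ne hki]
    have hl : A.leaf x I (Function.update z i (u, y), ξ) = A.leaf x I (Function.update z i (u, y'), ξ) := by
      unfold leaf; rw [ht]
    simp only [weightAt, hi, if_true, hl, weight, count, hX]
  · simp [weightAt, hi]

/-- This lets the estimates on the leaf be made for one fixed half at a time. -/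
theorem integral_sum_meanWeight_le {g : Cov p → ℝ} (hg : Measurable g) {G : ℝ}
    (hg0 : ∀ u, 0 ≤ g u) (hgG : ∀ u, g u ≤ G) {B : ℝ}
    (h : ∀ I ∈ halves s,
      ∫ ω, ∑ i ∈ I, weight I ω.1 (A.leaf x I ω) i * g (ω.1 i).1 ∂(A.jointLaw ν Q) ≤ B) :
    ∫ z, ∑ i, A.meanWeight x i z * g (z i).1 ∂(sampleLaw s ν Q) ≤ B := by
  classical
  have hgm : ∀ i, Measurable fun z : Fin s → Obs p d => g (z i).1 := fun i =>
    hg.comp (measurable_pi_apply i).fst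
  have hint : ∀ I i, Integrable (fun ω : (Fin s → Obs p d) × A.Aux =>
      A.weightAt x I i ω * g (ω.1 i).1) (A.jointLaw ν Q) := fun I i =>
    integrable_of_bdd ((A.measurable_weightAt x I i).mul
      ((hgm i).comp measurable_fst)).aestronglyMeasurable (M := 1 * G) fun ω => by
        rw [norm_mul, Real.norm_of_nonneg (A.weightAt_nonneg x I i _), Real.norm_of_nonneg (hg0 _)]
        exact mul_le_mul (A.weightAt_le_one x I i _) (hgG _) (hg0 _) zero_le_one
  have heq : ∀ z : Fin s → Obs p d, ∑ i, A.meanWeight x i z * g (z i).1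
      = ((halves s).card : ℝ)⁻¹ * ∑ I ∈ halves s,
        ∫ ξ, ∑ i, A.weightAt x I i (z, ξ) * g (z i).1 ∂A.law := fun z => by
    unfold meanWeight
    simp_rw [mul_assoc, ← Finset.mul_sum, Finset.sum_mul]
    rw [Finset.sum_comm]
    congr 1
    refine Finset.sum_congr rfl fun I _ => ?_
    rw [integral_finsetSum _ fun i _ => (A.integrable_weightAt x I i z).mul_const _]
    simp_rw [integral_mul_const]
  simp_rw [heq]
  rw [integral_const_mul, integral_finsetSum]
  · refine average_le fun I hI => ?_
    refine le_trans (Eq.le ?_) (h I hI)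
    have := integral_prod (μ := sampleLaw s ν Q) (ν := A.law)
      (fun ω : (Fin s → Obs p d) × A.Aux => ∑ i, A.weightAt x I i ω * g (ω.1 i).1)
      (integrable_finsetSum _ fun i _ => hint I i)
    rw [← this]
    refine integral_congr_ae (.of_forall fun ω => ?_)
    simp only [weightAt, ite_mul, zero_mul]
    rw [Finset.sum_ite_mem, Finset.univ_inter]
  · intro I _
    exact (integrable_finsetSum _ fun i _ => hint I i).integral_prod_left

/-- By symmetry each observation has the same share of a weighted sum. -/
theorem integral_meanWeight_mul (hx : x ∈ cube p) (hsym : A.Symmetric ν Q) {g : Cov p → ℝ}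
    (hg : Measurable g) {G : ℝ} (hgG : ∀ u, ‖g u‖ ≤ G) (i : Fin s) :
    ∫ z, ∑ k, A.meanWeight x k z * g (z k).1 ∂(sampleLaw s ν Q)
      = s * ∫ z, A.meanWeight x i z * g (z i).1 ∂(sampleLaw s ν Q) := by
  have hgm : ∀ i, Measurable fun z : Fin s → Obs p d => g (z i).1 := fun i =>
    hg.comp (measurable_pi_apply i).fst
  have hmeas : ∀ k, Measurable fun z : Fin s → Obs p d => A.meanWeight x k z * g (z k).1 := fun k =>
    (A.stronglyMeasurable_meanWeight x k).measurable.mul (hgm k)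
  have hint : ∀ k, Integrable (fun z : Fin s → Obs p d => A.meanWeight x k z * g (z k).1)
      (sampleLaw s ν Q) := fun k =>
    integrable_of_bdd (hmeas k).aestronglyMeasurable (M := 1 * G) fun z => by
        rw [norm_mul]
        exact mul_le_mul (A.norm_meanWeight_le x k z) (hgG _) (norm_nonneg _) zero_le_one
  rw [integral_finsetSum _ fun k _ => hint k]
  have heq : ∀ k, ∫ z, A.meanWeight x k z * g (z k).1 ∂(sampleLaw s ν Q)
      = ∫ z, A.meanWeight x i z * g (z i).1 ∂(sampleLaw s ν Q) := fun k => by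
    have hp : MeasurePreserving (fun z : Fin s → Obs p d => fun l => z (Equiv.swap i k l))
      (sampleLaw s ν Q) (sampleLaw s ν Q) := measurePreserving_perm (ν ⊗ₘ Q) (Equiv.swap i k)
    conv_rhs => rw [← hp.map_eq]
    rw [integral_map hp.measurable.aemeasurable (hmeas i).aestronglyMeasurable]
    refine integral_congr_ae ?_
    filter_upwards [A.meanWeight_perm x hx hsym (Equiv.swap i k)] with z hz
    have := hz i
    rw [Equiv.swap_apply_left] at this
    simp only [Equiv.swap_apply_left, this]
  simp_rw [heq]
  simp

end Law

section Output

variable (H : Type*) [NormedAddCommGroup H] [InnerProductSpace ℝ H] [CompleteSpace H]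
  [RKHS ℝ H (Resp d) ℝ]

theorem T_eq_sum (z : Fin s → Obs p d) :
    A.T H x z = ∑ i, A.meanWeight x i z • feature H (z i).2 := by
  classical
  unfold T meanWeight
  simp_rw [mul_smul, ← Finset.smul_sum, Finset.sum_smul]
  congr 1
  rw [Finset.sum_comm]
  refine Finset.sum_congr rfl fun I _ => ?_
  simp_rw [← integral_smul_const]
  rw [← integral_finsetSum _ fun i _ => (A.integrable_weightAt x I i z).smul_const _]
  refine integral_congr_ae (.of_forall fun ξ => ?_)
  simp only [predict, weightAt, ite_smul, zero_smul]
  rw [Finset.sum_ite_mem, Finset.univ_inter]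

end Output

end TreeProcedure

/-! ### Distances and box volumes relative to the test point. -/

section Distances

variable {p : ℕ}

/-- The `ℓ¹` distance of two points of `[0,1]^p`. -/
noncomputable def cubeDist (x u : Cov p) : ℝ := min (∑ j, |u j - x j|) p

/-- The volume of the box spanned by two points. -/
noncomputable def boxVol (x u : Cov p) : ℝ := ∏ j, |u j - x j|

theorem measurable_coord (j : Fin p) : Measurable fun u : Cov p => u j := by fun_prop

theorem measurable_cubeDist (x : Cov p) : Measurable (cubeDist x) := by
  unfold cubeDist
  refine Measurable.min (Finset.measurable_sum _ fun j _ => ?_) measurable_const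
  exact ((measurable_coord j).sub_const _).abs

theorem measurable_boxVol (x : Cov p) : Measurable (boxVol x) := by
  unfold boxVol
  refine Finset.measurable_prod _ fun j _ => ?_
  exact ((measurable_coord j).sub_const _).abs

theorem cubeDist_nonneg (x u : Cov p) : 0 ≤ cubeDist x u :=
  le_min (Finset.sum_nonneg fun _ _ => abs_nonneg _) (Nat.cast_nonneg _)

theorem cubeDist_le (x u : Cov p) : cubeDist x u ≤ p := min_le_right _ _

/-- On the cube the truncation at `p` is inactive; it only makes `cubeDist` bounded everywhere. -/
theorem norm_sub_le_cubeDist {x u : Cov p} (hx : x ∈ cube p) (hu : u ∈ cube p) :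
    ‖u - x‖ ≤ cubeDist x u := by
  have hj : ∀ j, |u j - x j| ≤ 1 := fun j => by
    rw [abs_le]; constructor <;> linarith [(hx j).1, (hx j).2, (hu j).1, (hu j).2]
  have h1 : ‖u - x‖ ≤ ∑ j, |u j - x j| := by
    rw [EuclideanSpace.norm_eq]
    refine Real.sqrt_le_iff.2 ⟨Finset.sum_nonneg fun _ _ => abs_nonneg _, ?_⟩
    refine le_trans (Eq.le ?_) (Finset.sum_sq_le_sq_sum_of_nonneg fun j _ => abs_nonneg (u j - x j))
    simp
  refine le_min h1 (h1.trans ?_)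
  refine (Finset.sum_le_card_nsmul _ _ 1 fun j _ => hj j).trans_eq (by simp)

theorem cubeDist_le_sum_len {C : Cell p} {x u : Cov p} (hx : x ∈ C.toSet) (hu : u ∈ C.toSet) :
    cubeDist x u ≤ ∑ j, C.len j :=
  (min_le_left _ _).trans (Finset.sum_le_sum fun j _ => Cell.abs_sub_le_len hu hx j)

/-- Membership in a random leaf of small volume is thereby replaced by a condition on `u` that does
not involve the data. -/
theorem boxVol_le_vol {C : Cell p} {x u : Cov p} (hx : x ∈ C.toSet) (hu : u ∈ C.toSet) :
    boxVol x u ≤ C.vol :=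
  Finset.prod_le_prod (fun _ _ => abs_nonneg _) fun j _ => Cell.abs_sub_le_len hu hx j

/-- A singularity of order less than one is integrable on the unit interval. -/
theorem integrable_abs_rpow (y : ℝ) (hy : y ∈ Set.Icc (0 : ℝ) 1) {r : ℝ} (hr : -1 < r) :
    Integrable ((Set.Icc (0 : ℝ) 1).indicator fun v => |v - y| ^ r) := by
  rw [integrable_indicator_iff measurableSet_Icc, integrableOn_Icc_iff_integrableOn_Ioc,
    ← intervalIntegrable_iff_integrableOn_Ioc_of_le zero_le_one]
  have h1 : IntervalIntegrable (fun v => |v - y| ^ r) volume 0 y := by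
    have h := (intervalIntegral.intervalIntegrable_rpow' (a := y) (b := 0) hr).comp_sub_left y
    rw [sub_self, sub_zero] at h
    refine h.congr (fun v hv => ?_)
    rw [Set.uIoc_of_le hy.1] at hv
    rw [abs_sub_comm, abs_of_nonneg (by linarith [hv.2])]
  have h2 : IntervalIntegrable (fun v => |v - y| ^ r) volume y 1 := by
    have h := (intervalIntegral.intervalIntegrable_rpow' (a := 0) (b := 1 - y) hr).comp_sub_right y
    rw [zero_add, sub_add_cancel] at h
    refine h.congr (fun v hv => ?_)
    rw [Set.uIoc_of_le hy.2] at hv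
    rw [abs_of_nonneg (by linarith [hv.1])]
  exact h1.trans h2

theorem volume_boxVol_eq_zero (x : Cov p) : volume {u : Cov p | boxVol x u = 0} = 0 := by
  have hvp := PiLp.volume_preserving_ofLp (Fin p)
  have hsub : {u : Cov p | boxVol x u = 0} ⊆ ⋃ j, (WithLp.ofLp ⁻¹' {f : Fin p → ℝ | f j = x j}) := by
    intro u hu
    obtain ⟨j, -, hj⟩ := Finset.prod_eq_zero_iff.1 (show ∏ j, |u j - x j| = 0 from hu)
    exact Set.mem_iUnion.2 ⟨j, sub_eq_zero.1 (abs_eq_zero.1 hj)⟩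
  refine measure_mono_null hsub (measure_iUnion_null fun j => ?_)
  have hm : MeasurableSet {f : Fin p → ℝ | f j = x j} :=
    measurableSet_eq_fun (measurable_pi_apply j) measurable_const
  rw [hvp.measure_preimage hm.nullMeasurableSet]
  exact Measure.pi_hyperplane (fun _ : Fin p => (volume : Measure ℝ)) j (x j : ℝ)

/-- Few points span a box of small volume with a given point. -/
theorem exists_volume_boxVol_le (x : Cov p) (hx : x ∈ cube p) {a : ℝ} (ha : 0 < a)
    (ha1 : a < 1) : ∃ K : ℝ, 0 ≤ K ∧ ∀ t : ℝ, 0 < t →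
      (volume.restrict (cube p)).real {u : Cov p | boxVol x u ≤ t} ≤ K * t ^ a := by
  have hvp := PiLp.volume_preserving_ofLp (Fin p)
  -- Markov's inequality is applied to `boxVol x u ^ (-a)` on the cube. It is a product over the
  -- coordinates, and each factor is integrable because `a < 1`.
  set φ : Fin p → ℝ → ℝ := fun j => (Set.Icc (0 : ℝ) 1).indicator fun v => |v - x j| ^ (-a) with hφ
  have hφi : ∀ j, Integrable (φ j) := fun j => integrable_abs_rpow (x j) (hx j) (by linarith)
  have hφ0 : ∀ j v, 0 ≤ φ j v := fun j v =>
    Set.indicator_nonneg (fun v _ => Real.rpow_nonneg (abs_nonneg _) _) v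
  have hΦi : Integrable (fun u : Fin p → ℝ => ∏ j, φ j (u j)) := Integrable.fintype_prod hφi
  have hΨi : Integrable (fun u : Cov p => ∏ j, φ j (u j)) :=
    hvp.integrable_comp_of_integrable hΦi
  refine ⟨∫ u : Cov p, ∏ j, φ j (u j), integral_nonneg fun u =>
    Finset.prod_nonneg fun j _ => hφ0 j _, fun t ht => ?_⟩
  have hmk := mul_meas_ge_le_integral_of_nonneg (μ := (volume : Measure (Cov p)))
    (f := fun u : Cov p => ∏ j, φ j (u j)) (.of_forall fun u =>
    Finset.prod_nonneg fun j _ => hφ0 j _) hΨi (t ^ (-a))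
  have hfin : (volume : Measure (Cov p)) {u | t ^ (-a) ≤ ∏ j, φ j (u j)} ≠ ⊤ := by
    have := hΨi.measure_norm_ge_lt_top (ε := t ^ (-a)) (Real.rpow_pos_of_pos ht _)
    refine ne_top_of_le_ne_top this.ne (measure_mono fun u hu => ?_)
    exact le_trans hu (Real.le_norm_self _)
  have hms : MeasurableSet {u : Cov p | boxVol x u ≤ t} :=
    measurableSet_le (measurable_boxVol x) measurable_const
  have hle : (volume.restrict (cube p)).real {u : Cov p | boxVol x u ≤ t}
      ≤ volume.real {u : Cov p | t ^ (-a) ≤ ∏ j, φ j (u j)} := by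
    rw [Measure.real, Measure.real, Measure.restrict_apply hms]
    refine ENNReal.toReal_mono hfin ?_
    -- Points with `boxVol x u = 0` are set apart: there the negative power takes the default value
    -- `0`, so they escape Markov's inequality, but they form a null set.
    have hsub : {u : Cov p | boxVol x u ≤ t} ∩ cube p ⊆
        {u : Cov p | boxVol x u = 0} ∪ {u : Cov p | t ^ (-a) ≤ ∏ j, φ j (u j)} := by
      rintro u ⟨hu, huc⟩
      by_cases h0 : boxVol x u = 0
      · exact Or.inl h0
      · right
        have hpos : 0 < boxVol x u := lt_of_le_of_ne
          (Finset.prod_nonneg fun j _ => abs_nonneg _) (Ne.symm h0)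
        have : ∏ j, φ j (u j) = boxVol x u ^ (-a) := by
          unfold boxVol
          rw [← Real.finsetProd_rpow _ _ fun j _ => abs_nonneg _]
          refine Finset.prod_congr rfl fun j _ => ?_
          exact Set.indicator_of_mem (huc j) _
        show t ^ (-a) ≤ _
        rw [this]
        exact Real.rpow_le_rpow_of_nonpos hpos hu (by linarith)
    refine (measure_mono hsub).trans ((measure_union_le _ _).trans ?_)
    rw [volume_boxVol_eq_zero x, zero_add]
  refine hle.trans ?_
  rw [Real.rpow_neg ht.le, inv_mul_le_iff₀ (Real.rpow_pos_of_pos ht _), ← Real.rpow_neg ht.le] at hmk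
  exact hmk.trans_eq (mul_comm _ _)

end Distances

/-! ### The leaf of a forest tree -/

namespace TreeProcedure

variable {p d s : ℕ} (A : TreeProcedure p d s) {x : Cov p}
  {ν : Measure (Cov p)} [IsProbabilityMeasure ν] {Q : Kernel (Cov p) (Resp d)} [IsMarkovKernel Q]
  {α π t q c C : ℝ} {κ : ℕ}

theorem mem_leaf (hx : x ∈ cube p) (I : Finset (Fin s)) (ω : (Fin s → Obs p d) × A.Aux) :
    x ∈ (A.leaf x I ω).toSet :=
  SplitTree.mem_leafFrom _ _ (by rw [root_toSet]; exact hx)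

theorem ae_mem_cube (hν : ν ≤ ENNReal.ofReal C • volume.restrict (cube p)) :
    ∀ᵐ z ∂(sampleLaw (d := d) s ν Q), ∀ i, (z i).1 ∈ cube p := by
  have h1 : ∀ᵐ u ∂ν, u ∈ cube p := by
    refine (Measure.absolutelyContinuous_of_le hν).ae_le ?_
    exact Measure.ae_smul_measure (ae_restrict_mem (measurableSet_cube p)) _
  have h2 : ∀ᵐ w ∂(ν ⊗ₘ Q), w.1 ∈ cube p := by
    have h := Measure.fst_compProd ν Q
    rw [← h] at h1
    exact ae_of_ae_map measurable_fst.aemeasurable h1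
  rw [ae_all_iff]
  intro i
  exact (measurePreserving_eval (fun _ : Fin s => ν ⊗ₘ Q) i).quasiMeasurePreserving.ae h2

/-- With at least `8 * t / α` points in the parent, the additive error `2 * t` in `count_bounds` is
at most a quarter of the count in either child. Counts are then proportional to volumes up to
constants, so each child keeps the fraction `α * c / (16 * C)` of the volume, and its sibling loses
as much of the side that is cut. The constant `16` is not sharp. -/
theorem shrink {I : Finset (Fin s)} {z : Fin s → Obs p d} (hα : 0 < α) (hα1 : α ≤ 1)
    (hz : z ∉ badSamples ν I t) (hI : 0 < I.card) (hc : 0 < c) (hcC : c ≤ C)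
    (hν : ∀ S : Cell p, c * S.vol ≤ ν.real S.toSet ∧ ν.real S.toSet ≤ C * S.vol)
    (ht : 4 * p * C ≤ t) (ht0 : 0 < t) (S : Cell p) (j : Fin p) (e : ℝ)
    (hT : 8 * t / α ≤ count I z S) (hl : α * count I z S ≤ count I z (S.left j e))
    (hr : α * count I z S ≤ count I z (S.right j e)) :
    (S.left j e).len j ≤ (1 - α * c / (16 * C)) * S.len j ∧
      (S.right j e).len j ≤ (1 - α * c / (16 * C)) * S.len j := by
  have hm : (0 : ℝ) < I.card := by exact_mod_cast hI
  have hC : 0 < C := hc.trans_le hcC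
  have hb := count_bounds ν hz hI hc hcC hν ht
  set N : ℝ := (count I z S : ℝ) with hN
  have hTN : 8 * t ≤ α * N := by rw [div_le_iff₀ hα] at hT; linarith
  have hN0 : 0 < N := by
    by_contra h
    nlinarith
  have hαN : α * N ≤ N := mul_le_of_le_one_left hN0.le hα1
  have hvol : 0 < S.vol := by
    by_contra h
    have h0 : S.vol = 0 := le_antisymm (not_lt.1 h) S.vol_nonneg
    have := (hb S).1
    rw [h0, mul_zero, zero_add] at this
    linarith
  have key : ∀ D : Cell p, α * N ≤ count I z D → α * c / (16 * C) * S.vol ≤ D.vol := by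
    intro D hD
    have h1 := (hb D).1
    have h2 := (hb S).2
    rw [div_mul_eq_mul_div, div_le_iff₀ (by positivity)]
    have h3 : c / 2 * I.card * S.vol ≤ 5 / 4 * N := by linarith
    have h4 : 3 / 4 * (α * N) ≤ 2 * C * I.card * D.vol := by linarith
    have h5 : α * (c / 2 * I.card * S.vol) ≤ α * (5 / 4 * N) := mul_le_mul_of_nonneg_left h3 hα.le
    have h6 : I.card * (α * c * S.vol) ≤ I.card * (D.vol * (16 * C)) := by
      have h7 : 0 ≤ C * I.card * D.vol := mul_nonneg (by positivity) D.vol_nonneg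
      nlinarith
    exact le_of_mul_le_mul_left h6 hm
  have hadd := S.len_left_add_len_right j e
  have h1 := len_le_of_vol hvol (fun i hi => S.len_left_of_ne e hi) (key _ hl)
  have h2 := len_le_of_vol hvol (fun i hi => S.len_right_of_ne e hi) (key _ hr)
  constructor <;> linarith

theorem count_root {I : Finset (Fin s)} {z : Fin s → Obs p d} (hz : ∀ i, (z i).1 ∈ cube p) :
    count I z (Cell.root p) = I.card := by
  classical
  unfold count
  rw [root_toSet, Finset.filter_true_of_mem fun i _ => hz i]

/-- The mean length of a side of the leaf, for a typical sample. -/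
theorem integral_len_leaf_le {I : Finset (Fin s)} {z : Fin s → Obs p d} (hα : 0 < α) (hα1 : α ≤ 1)
    (hz : z ∉ badSamples ν I t) (hI : 0 < I.card) (hc : 0 < c) (hcC : c ≤ C)
    (hν : ∀ S : Cell p, c * S.vol ≤ ν.real S.toSet ∧ ν.real S.toSet ≤ C * S.vol)
    (ht : 4 * p * C ≤ t) (ht0 : 0 < t) (hκt : 2 * κ ≤ 8 * t / α)
    (hq : 0 ≤ q) (hq1 : q ≤ 1) (hqπ : q ≤ π / p)
    (hzc : ∀ i, (z i).1 ∈ cube p)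
    (hreg : ∀ᵐ ξ ∂A.law, (A.tree I ξ z).IsRegular α κ (count I z) (Cell.root p)) (j : Fin p)
    (hrs : ∀ (a : List Bool) (j : Fin p)
      (B : Set (Fin a.length → (Fin p × ℝ) ⊕ Unit)), MeasurableSet B →
      π / p * A.law.real {ξ | (A.tree I ξ z).history a ∈ B ∧
          ∃ j' c, (A.tree I ξ z).splitAt a = Sum.inl (j', c)}
        ≤ A.law.real {ξ | (A.tree I ξ z).history a ∈ B ∧
          ∃ c, (A.tree I ξ z).splitAt a = Sum.inl (j, c)})
    (k : ℕ) (hk : 8 * t / α ≤ α ^ k * I.card) :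
    ∫ ξ, (A.leaf x I (z, ξ)).len j ∂A.law ≤ (1 - α * c / (16 * C) * q) ^ k := by
  have hC : 0 < C := hc.trans_le hcC
  have hγ : α * c / (16 * C) ≤ 1 := by
    rw [div_le_one (by positivity)]
    nlinarith
  have hγ0 : 0 ≤ α * c / (16 * C) := by positivity
  have hmeas : Measurable fun ξ => A.tree I ξ z :=
    (A.measurable_tree I).comp measurable_prodMk_right
  have h := SplitTree.integral_len_leafAt_le A.law (fun ξ => A.tree I ξ z) hmeas hq hq1 x j
    (r := 1 - α * c / (16 * C)) (by linarith) (by linarith)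
    (fun a B hB => (mul_le_mul_of_nonneg_right hqπ measureReal_nonneg).trans (hrs a j B hB)) k ?_
  · rw [sub_sub_cancel] at h
    exact h
  · filter_upwards [hreg] with ξ hξ
    have h2 := SplitTree.len_leafFrom_le hα hα1 (r := 1 - α * c / (16 * C)) (by linarith)
      hκt (by positivity)
      (fun S j e => shrink hα hα1 hz hI hc hcC hν ht ht0 S j e) x j k (A.tree I ξ z) (Cell.root p) hξ
      (by rw [count_root hzc]; exact hk)
    refine ⟨h2.1, h2.2.trans ?_⟩
    exact mul_le_of_le_one_right (pow_nonneg (by linarith) _) (Cell.len_le_one _ _)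

variable (x ν Q)

/-- The mean `ℓ¹` distance to `x` of the observations in its leaf. -/
noncomputable def meanDist : ℝ :=
  ∫ z, ∑ i, A.meanWeight x i z * cubeDist x (z i).1 ∂(sampleLaw s ν Q)

variable {x ν Q}

/-- Within the leaf the distance to `x` is at most the sum of the `p` sides. For good samples the
mean sides decay geometrically in the depth; for bad ones they are at most `1`, which costs the
probability of `badSamples`. -/
theorem meanDist_le (hx : x ∈ cube p) (hα : 0 < α) (hα1 : α ≤ 1) (hs : 0 < s) (hc : 0 < c) (hcC : c ≤ C)
    (hν : ∀ S : Cell p, c * S.vol ≤ ν.real S.toSet ∧ ν.real S.toSet ≤ C * S.vol)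
    (hνC : ν ≤ ENNReal.ofReal C • volume.restrict (cube p))
    (ht : 4 * p * C ≤ t) (ht0 : 0 < t) (hκt : 2 * κ ≤ 8 * t / α)
    (hq : 0 ≤ q) (hq1 : q ≤ 1) (hqπ : q ≤ π / p) (hκ : κ ≤ (s + 1) / 2)
    (hreg : A.AlphaRegular ν Q α κ) (hrs : A.RandomSplit ν Q π)
    (k : ℕ) (hk : 8 * t / α ≤ α ^ k * ((s + 1) / 2 : ℕ)) :
    A.meanDist x ν Q ≤ p * (2 * ((((s + 1) / 2 : ℕ) : ℝ) + 2) ^ (2 * p) * Real.exp (-t)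
      + (1 - α * c / (16 * C) * q) ^ k) := by
  have hC : 0 < C := hc.trans_le hcC
  have hγ : α * c / (16 * C) ≤ 1 := by
    rw [div_le_one (by positivity)]
    nlinarith
  have hγ0 : 0 ≤ α * c / (16 * C) := by positivity
  have hρ0 : 0 ≤ (1 - α * c / (16 * C) * q) ^ k := pow_nonneg (by nlinarith) _
  refine A.integral_sum_meanWeight_le x (measurable_cubeDist x) (cubeDist_nonneg x) (cubeDist_le x)
    fun I hI => ?_
  have hcard := card_of_mem_halves hI
  have hI0 : 0 < I.card := by omega
  have hlen : ∀ j, Integrable (fun ω => (A.leaf x I ω).len j) (A.jointLaw ν Q) := fun j =>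
    integrable_of_bdd ((measurable_len j).comp (A.measurable_leaf x I)).aestronglyMeasurable
      (M := 1) fun ω => by
        rw [Real.norm_of_nonneg (Cell.len_nonneg _ _)]; exact Cell.len_le_one _ _
  have hpt : ∀ ω : (Fin s → Obs p d) × A.Aux,
      ∑ i ∈ I, weight I ω.1 (A.leaf x I ω) i * cubeDist x (ω.1 i).1 ≤ ∑ j, (A.leaf x I ω).len j := by
    intro ω
    have h1 : ∀ i ∈ I, weight I ω.1 (A.leaf x I ω) i * cubeDist x (ω.1 i).1
        ≤ weight I ω.1 (A.leaf x I ω) i * ∑ j, (A.leaf x I ω).len j := fun i _ => by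
      by_cases h : (ω.1 i).1 ∈ (A.leaf x I ω).toSet
      · exact mul_le_mul_of_nonneg_left (cubeDist_le_sum_len (A.mem_leaf hx I ω) h)
          (weight_nonneg _ _ _ _)
      · simp [weight, h]
    refine (Finset.sum_le_sum h1).trans ?_
    rw [← Finset.sum_mul]
    exact mul_le_of_le_one_left (Finset.sum_nonneg fun j _ => Cell.len_nonneg _ _)
      (sum_weight_le_one _ _ _)
  have hmono : ∫ ω, ∑ i ∈ I, weight I ω.1 (A.leaf x I ω) i * cubeDist x (ω.1 i).1 ∂(A.jointLaw ν Q)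
      ≤ ∫ ω, ∑ j, (A.leaf x I ω).len j ∂(A.jointLaw ν Q) :=
    integral_mono_of_nonneg (.of_forall fun ω => Finset.sum_nonneg fun i _ =>
      mul_nonneg (weight_nonneg _ _ _ _) (cubeDist_nonneg _ _))
      (integrable_finsetSum _ fun j _ => hlen j) (.of_forall hpt)
  refine hmono.trans ?_
  rw [integral_finsetSum _ fun j _ => hlen j]
  refine (Finset.sum_le_card_nsmul _ _ (2 * ((((s + 1) / 2 : ℕ) : ℝ) + 2) ^ (2 * p) * Real.exp (-t)
      + (1 - α * c / (16 * C) * q) ^ k) fun j _ => ?_).trans_eq (by simp [mul_add])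
  have hbad := measurableSet_badSamples (d := d) ν I t
  have hz : ∀ᵐ z ∂(sampleLaw s ν Q), ∫ ξ, (A.leaf x I (z, ξ)).len j ∂A.law
      ≤ (badSamples ν I t).indicator (fun _ => (1 : ℝ)) z + (1 - α * c / (16 * C) * q) ^ k := by
    filter_upwards [hrs I hI, Measure.ae_ae_of_ae_prod (hreg hκ I hI), ae_mem_cube (d := d) (Q := Q) hνC]
      with z hz1 hz2 hz3
    by_cases hzb : z ∈ badSamples ν I t
    · rw [Set.indicator_of_mem hzb]
      have : ∫ ξ, (A.leaf x I (z, ξ)).len j ∂A.law ≤ 1 := by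
        refine (integral_mono_of_nonneg (.of_forall fun ξ => Cell.len_nonneg _ _)
          (integrable_const 1) (.of_forall fun ξ => Cell.len_le_one _ _)).trans ?_
        simp
      linarith
    · rw [Set.indicator_of_notMem hzb, zero_add]
      exact A.integral_len_leaf_le hα hα1 hzb hI0 hc hcC hν ht ht0 hκt hq hq1 hqπ hz3 hz2 j hz1 k
        (by rw [hcard]; exact hk)
  have hfub : ∫ ω, (A.leaf x I ω).len j ∂(A.jointLaw ν Q)
      = ∫ z, ∫ ξ, (A.leaf x I (z, ξ)).len j ∂A.law ∂(sampleLaw s ν Q) :=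
    integral_prod _ (hlen j)
  rw [hfub]
  refine (integral_mono_ae (hlen j).integral_prod_left
    (((integrable_const (1 : ℝ)).indicator hbad).add (integrable_const _)) hz).trans ?_
  have hii : ∫ z, ((badSamples ν I t).indicator (fun _ => (1 : ℝ)) z
      + (1 - α * c / (16 * C) * q) ^ k) ∂(sampleLaw s ν Q)
      = (sampleLaw s ν Q).real (badSamples ν I t) + (1 - α * c / (16 * C) * q) ^ k := by
    rw [integral_add ((integrable_const (1 : ℝ)).indicator hbad) (integrable_const _),
      integral_indicator_const _ hbad]
    simp
  refine hii.le.trans ?_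
  have := prob_badSamples_le ν Q I t
  rw [hcard] at this
  linarith

/-- The observations in the leaf of `x` span boxes of small volume with `x`. -/
theorem integral_boxVol_le (hx : x ∈ cube p) (hc : 0 < c) (hcC : c ≤ C)
    (hν : ∀ S : Cell p, c * S.vol ≤ ν.real S.toSet ∧ ν.real S.toSet ≤ C * S.vol)
    (ht : 4 * p * C ≤ t) (hs : 0 < s) (hκ : κ ≤ (s + 1) / 2) (hreg : A.AlphaRegular ν Q α κ) :
    ∫ z, ∑ i, A.meanWeight x i z * {u | 4 * (κ + t) / (c * ((s + 1) / 2 : ℕ)) < boxVol x u}.indicator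
        (fun _ => (1 : ℝ)) (z i).1 ∂(sampleLaw s ν Q)
      ≤ 2 * ((((s + 1) / 2 : ℕ) : ℝ) + 2) ^ (2 * p) * Real.exp (-t) := by
  set S := {u | 4 * (κ + t) / (c * ((s + 1) / 2 : ℕ)) < boxVol x u} with hS
  have hmS : MeasurableSet S := measurableSet_lt measurable_const (measurable_boxVol x)
  have hg0 : ∀ u, 0 ≤ S.indicator (fun _ => (1 : ℝ)) u := fun u =>
    Set.indicator_nonneg (fun _ _ => zero_le_one) u
  have hg1 : ∀ u, S.indicator (fun _ => (1 : ℝ)) u ≤ 1 := fun u =>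
    Set.indicator_le_self' (fun _ _ => zero_le_one) u
  refine A.integral_sum_meanWeight_le x (measurable_const.indicator hmS) hg0 hg1 fun I hI => ?_
  have hcard := card_of_mem_halves hI
  have hI0 : 0 < I.card := by omega
  have hm : (0 : ℝ) < I.card := by exact_mod_cast hI0
  have hbad := measurableSet_badSamples (d := d) ν I t
  have hle1 : ∀ ω : (Fin s → Obs p d) × A.Aux,
      ∑ i ∈ I, weight I ω.1 (A.leaf x I ω) i * S.indicator (fun _ => (1 : ℝ)) (ω.1 i).1 ≤ 1 := fun ω =>
    (Finset.sum_le_sum fun i _ => mul_le_of_le_one_right (weight_nonneg _ _ _ _) (hg1 _)).trans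
      (sum_weight_le_one _ _ _)
  have hpt : ∀ᵐ ω ∂(A.jointLaw ν Q),
      ∑ i ∈ I, weight I ω.1 (A.leaf x I ω) i * S.indicator (fun _ => (1 : ℝ)) (ω.1 i).1
        ≤ (Prod.fst ⁻¹' badSamples ν I t).indicator (fun _ => (1 : ℝ)) ω := by
    filter_upwards [hreg hκ I hI] with ω hω
    by_cases hb : ω ∈ Prod.fst ⁻¹' badSamples ν I t
    · rw [Set.indicator_of_mem hb]; exact hle1 ω
    · rw [Set.indicator_of_notMem hb]
      refine Finset.sum_nonpos fun i _ => ?_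
      by_cases h : (ω.1 i).1 ∈ (A.leaf x I ω).toSet
      · have h1 := (count_bounds ν (show ω.1 ∉ badSamples ν I t from hb) hI0 hc hcC hν ht
          (A.leaf x I ω)).2
        have h2 := (hω.leafFrom x).2
        have h3 : (count I ω.1 (A.leaf x I ω) : ℝ) ≤ 2 * κ := by
          have : count I ω.1 (A.leaf x I ω) ≤ 2 * κ := h2.trans (Nat.sub_le _ _)
          exact_mod_cast this
        have h4 := boxVol_le_vol (A.mem_leaf hx I ω) h
        have h5 : (ω.1 i).1 ∉ S := by
          rw [hS, Set.mem_ofPred_eq, not_lt]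
          refine h4.trans ?_
          rw [← hcard, le_div_iff₀ (by positivity)]
          linarith
        simp [h5]
      · simp [weight, h]
  refine (integral_mono_of_nonneg (.of_forall fun ω => Finset.sum_nonneg fun i _ =>
      mul_nonneg (weight_nonneg _ _ _ _) (hg0 _))
    ((integrable_const (1 : ℝ)).indicator (measurable_fst hbad)) hpt).trans ?_
  rw [integral_indicator_const _ (measurable_fst hbad), smul_eq_mul, mul_one, Measure.real]
  have hfst : (A.jointLaw ν Q) (Prod.fst ⁻¹' badSamples ν I t) = sampleLaw s ν Q (badSamples ν I t) :=
    measurePreserving_fst.measure_preimage hbad.nullMeasurableSet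
  rw [hfst]
  have := prob_badSamples_le ν Q I t
  rw [hcard] at this
  exact this

end TreeProcedure

/-! ### The expected weight of an observation given this observation. -/

namespace TreeProcedure

variable {p d s : ℕ} (A : TreeProcedure p d s) (x : Cov p)
  (ν : Measure (Cov p)) [IsProbabilityMeasure ν] (Q : Kernel (Cov p) (Resp d)) [IsMarkovKernel Q]

/-- The conditional mean of the weight of an observation given this observation. -/
noncomputable def share (i : Fin s) (w : Obs p d) : ℝ := marg (ν ⊗ₘ Q) (A.meanWeight x i) i w

theorem stronglyMeasurable_share (i : Fin s) : StronglyMeasurable (A.share x ν Q i) := by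
  unfold share marg
  exact ((A.stronglyMeasurable_meanWeight x i).comp_measurable
    (measurable_update_pair i)).integral_prod_left'

theorem share_nonneg (i : Fin s) (w : Obs p d) : 0 ≤ A.share x ν Q i w :=
  integral_nonneg fun _ => A.meanWeight_nonneg x i _

theorem share_le_one (i : Fin s) (w : Obs p d) : A.share x ν Q i w ≤ 1 :=
  (Real.le_norm_self _).trans (marg_norm_le (A.norm_meanWeight_le x i) i w)

theorem norm_share_le (i : Fin s) (w : Obs p d) : ‖A.share x ν Q i w‖ ≤ 1 :=
  marg_norm_le (A.norm_meanWeight_le x i) i w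

theorem share_eq (hhon : A.Honest) (i : Fin s) (u : Cov p) (y y' : Resp d) :
    A.share x ν Q i (u, y) = A.share x ν Q i (u, y') := by
  unfold share marg
  simp_rw [A.meanWeight_update x hhon i _ u y y']

variable {x ν Q}

theorem integral_share_mul {g : Cov p → ℝ} (hg : Measurable g) {G : ℝ} (hgG : ∀ u, ‖g u‖ ≤ G)
    (i : Fin s) : ∫ w, A.share x ν Q i w * g w.1 ∂(ν ⊗ₘ Q)
      = ∫ z, A.meanWeight x i z * g (z i).1 ∂(sampleLaw s ν Q) := by
  have hint : Integrable (fun z : Fin s → Obs p d => A.meanWeight x i z * g (z i).1)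
      (sampleLaw s ν Q) :=
    integrable_of_bdd ((A.stronglyMeasurable_meanWeight x i).measurable.mul
      (hg.comp (measurable_pi_apply i).fst)).aestronglyMeasurable (M := 1 * G) fun z => by
        rw [norm_mul]
        exact mul_le_mul (A.norm_meanWeight_le x i z) (hgG _) (norm_nonneg _) zero_le_one
  unfold sampleLaw at hint ⊢
  rw [integral_update hint i]
  simp only [Function.update_self, integral_mul_const]
  rfl

/-- Each observation has the share `1 / s` of a weighted sum. -/
theorem mul_integral_share_mul (hx : x ∈ cube p) (hsym : A.Symmetric ν Q) {g : Cov p → ℝ}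
    (hg : Measurable g) {G : ℝ} (hgG : ∀ u, ‖g u‖ ≤ G) (i : Fin s) :
    s * ∫ w, A.share x ν Q i w * g w.1 ∂(ν ⊗ₘ Q)
      = ∫ z, ∑ k, A.meanWeight x k z * g (z k).1 ∂(sampleLaw s ν Q) := by
  rw [A.integral_share_mul hg hgG, A.integral_meanWeight_mul x hx hsym hg hgG i]

theorem integral_share_mul_cubeDist (hx : x ∈ cube p) (hsym : A.Symmetric ν Q) (i : Fin s) :
    s * ∫ w, A.share x ν Q i w * cubeDist x w.1 ∂(ν ⊗ₘ Q) = A.meanDist x ν Q :=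
  A.mul_integral_share_mul hx hsym (measurable_cubeDist x) (G := p) (fun u => by
    rw [Real.norm_of_nonneg (cubeDist_nonneg x u)]; exact cubeDist_le x u) i

variable (x ν Q)

/-- The second moment of the conditional mean of a weight. -/
noncomputable def shareSq (i : Fin s) : ℝ := ∫ w, A.share x ν Q i w ^ 2 ∂(ν ⊗ₘ Q)

variable {x ν Q}

theorem integrable_share (i : Fin s) : Integrable (A.share x ν Q i) (ν ⊗ₘ Q) :=
  integrable_of_bdd (A.stronglyMeasurable_share x ν Q i).aestronglyMeasurable
    (A.norm_share_le x ν Q i)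

theorem integrable_share_sq (i : Fin s) : Integrable (fun w => A.share x ν Q i w ^ 2) (ν ⊗ₘ Q) :=
  integrable_of_bdd ((A.stronglyMeasurable_share x ν Q i).pow 2).aestronglyMeasurable (M := 1)
    fun w => by
      rw [norm_pow]
      exact pow_le_one₀ (norm_nonneg _) (A.norm_share_le x ν Q i w)

/-- If most of the weight is on observations with small `boxVol`, the second moment of the share of an
observation is large. -/
theorem one_le_mul_shareSq (hx : x ∈ cube p) (hsym : A.Symmetric ν Q) (hs : 0 < s)
    (hone : ∀ᵐ z ∂(sampleLaw s ν Q), ∑ i, A.meanWeight x i z = 1) {a M : ℝ} (hM : 0 < M)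
    (hbox : ∫ z, ∑ i, A.meanWeight x i z * {u | a < boxVol x u}.indicator
        (fun _ => (1 : ℝ)) (z i).1 ∂(sampleLaw s ν Q) ≤ 1 / 2)
    (hν : ν.real {u | boxVol x u ≤ a} ≤ M) (i : Fin s) :
    1 ≤ 4 * s ^ 2 * M * A.shareSq x ν Q i := by
  set S := {u | a < boxVol x u} with hS
  have hmS : MeasurableSet S := measurableSet_lt measurable_const (measurable_boxVol x)
  have hs' : (0 : ℝ) < s := by exact_mod_cast hs
  have hind : ∀ (R : Set (Cov p)) (u : Cov p), ‖R.indicator (fun _ => (1 : ℝ)) u‖ ≤ 1 := fun R u => by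
    refine (norm_indicator_le_norm_self _ _).trans ?_
    simp
  have h1 : (s : ℝ) * ∫ w, A.share x ν Q i w ∂(ν ⊗ₘ Q) = 1 := by
    have := A.mul_integral_share_mul (x := x) (ν := ν) (Q := Q) hx hsym (g := fun _ => (1 : ℝ))
      measurable_const (G := 1) (fun _ => by simp) i
    simp only [mul_one] at this
    rw [this, integral_congr_ae hone]
    simp
  have h2 : (s : ℝ) * ∫ w, A.share x ν Q i w * S.indicator (fun _ => (1 : ℝ)) w.1 ∂(ν ⊗ₘ Q) ≤ 1 / 2 := by
    rw [A.mul_integral_share_mul hx hsym (measurable_const.indicator hmS) (hind S)]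
    exact hbox
  have hmSc : Measurable fun w : Obs p d => Sᶜ.indicator (fun _ => (1 : ℝ)) w.1 :=
    (measurable_const.indicator hmS.compl).comp measurable_fst
  have hmS' : Measurable fun w : Obs p d => S.indicator (fun _ => (1 : ℝ)) w.1 :=
    (measurable_const.indicator hmS).comp measurable_fst
  have hi1 : Integrable (fun w : Obs p d => A.share x ν Q i w * S.indicator (fun _ => (1 : ℝ)) w.1)
      (ν ⊗ₘ Q) := (A.integrable_share i).mul_bdd hmS'.aestronglyMeasurable (.of_forall fun w => hind S _)
  have hi2 : Integrable (fun w : Obs p d => Sᶜ.indicator (fun _ => (1 : ℝ)) w.1) (ν ⊗ₘ Q) :=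
    integrable_of_bdd hmSc.aestronglyMeasurable fun w => hind Sᶜ _
  have hν' : ∫ w : Obs p d, Sᶜ.indicator (fun _ => (1 : ℝ)) w.1 ∂(ν ⊗ₘ Q) ≤ M := by
    refine le_trans (Eq.le ?_) hν
    have e : (fun w : Obs p d => Sᶜ.indicator (fun _ => (1 : ℝ)) w.1)
        = (Prod.fst ⁻¹' Sᶜ).indicator fun _ => (1 : ℝ) := rfl
    rw [e, integral_indicator_const _ (measurable_fst hmS.compl), smul_eq_mul, mul_one]
    have h := Measure.fst_compProd ν Q
    conv_rhs => rw [← h]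
    have hcompl : {u | boxVol x u ≤ a} = Sᶜ := by ext u; simp [hS]
    rw [hcompl, Measure.real, Measure.real, Measure.fst_apply hmS.compl]
  -- Cauchy–Schwarz in pointwise form: off `S`, `b ≤ θ b² + 1 / (4θ)` with `θ = s * M`. Since `Sᶜ`
  -- has mass at most `M`, integrating and multiplying by `s` gives `1 ≤ 1/2 + s² M E[b²] + 1/4`.
  have hpt : ∀ w : Obs p d, A.share x ν Q i w ≤ A.share x ν Q i w * S.indicator (fun _ => (1 : ℝ)) w.1
      + (s * M * A.share x ν Q i w ^ 2
        + (4 * s * M)⁻¹ * Sᶜ.indicator (fun _ => (1 : ℝ)) w.1) := by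
    intro w
    have hb := A.share_nonneg x ν Q i w
    by_cases hw : w.1 ∈ S
    · rw [Set.indicator_of_mem hw, Set.indicator_of_notMem (by simpa using hw)]
      have : 0 ≤ s * M * A.share x ν Q i w ^ 2 := by positivity
      linarith
    · rw [Set.indicator_of_notMem hw, Set.indicator_of_mem (by simpa using hw), mul_zero, zero_add,
        mul_one]
      have hθ : 0 < s * M := mul_pos hs' hM
      have e : s * M * A.share x ν Q i w ^ 2 + (4 * s * M)⁻¹ - A.share x ν Q i w
          = s * M * (A.share x ν Q i w - (2 * s * M)⁻¹) ^ 2 := by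
        field_simp; ring
      have : 0 ≤ s * M * (A.share x ν Q i w - (2 * s * M)⁻¹) ^ 2 := by positivity
      linarith
  have h3 := integral_mono (A.integrable_share i)
    (hi1.add (((A.integrable_share_sq i).const_mul (s * M)).add (hi2.const_mul (4 * s * M)⁻¹))) hpt
  have h4 : ∫ w : Obs p d, (A.share x ν Q i w * S.indicator (fun _ => (1 : ℝ)) w.1
      + (s * M * A.share x ν Q i w ^ 2
        + (4 * s * M)⁻¹ * Sᶜ.indicator (fun _ => (1 : ℝ)) w.1)) ∂(ν ⊗ₘ Q)
      = ∫ w, A.share x ν Q i w * S.indicator (fun _ => (1 : ℝ)) w.1 ∂(ν ⊗ₘ Q)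
        + (s * M * A.shareSq x ν Q i
        + (4 * s * M)⁻¹ * ∫ w : Obs p d, Sᶜ.indicator (fun _ => (1 : ℝ)) w.1 ∂(ν ⊗ₘ Q)) := by
    have hi3 : Integrable (fun w : Obs p d => s * M * A.share x ν Q i w ^ 2
        + (4 * s * M)⁻¹ * Sᶜ.indicator (fun _ => (1 : ℝ)) w.1) (ν ⊗ₘ Q) :=
      ((A.integrable_share_sq i).const_mul (s * M)).add (hi2.const_mul (4 * s * M)⁻¹)
    rw [integral_add hi1 hi3,
      integral_add ((A.integrable_share_sq i).const_mul (s * M)) (hi2.const_mul (4 * s * M)⁻¹),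
      integral_const_mul, integral_const_mul]
    rfl
  have h5 := mul_le_mul_of_nonneg_left (h3.trans_eq h4) hs'.le
  rw [h1] at h5
  have h6 : s * ((4 * s * M)⁻¹ * ∫ w : Obs p d, Sᶜ.indicator (fun _ => (1 : ℝ)) w.1 ∂(ν ⊗ₘ Q))
      ≤ 1 / 4 := by
    have : (s : ℝ) * ((4 * s * M)⁻¹ * M) = 1 / 4 := by field_simp
    rw [← this]
    exact mul_le_mul_of_nonneg_left (mul_le_mul_of_nonneg_left hν' (by positivity)) hs'.le
  nlinarith

end TreeProcedure

/-! ### Asymptotics -/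

/-- With the tolerance `t = m ^ η`, the exponential tail beats the polynomial number of grid cells
and any further power of `m`. -/
theorem tendsto_rpow_mul_bad {η : ℝ} (hη : 0 < η) (e : ℝ) (p : ℕ) :
    Tendsto (fun m : ℕ => (m : ℝ) ^ e * (2 * ((m : ℝ) + 2) ^ (2 * p) * Real.exp (-(m : ℝ) ^ η)))
      atTop (𝓝 0) := by
  have h1 := (tendsto_rpow_mul_exp_neg_mul_atTop_nhds_zero ((e + 2 * p) / η) 1 one_pos).comp
    ((tendsto_rpow_atTop hη).comp tendsto_natCast_atTop_atTop)
  have h2 := h1.const_mul (2 * 3 ^ (2 * p) : ℝ)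
  rw [mul_zero] at h2
  refine squeeze_zero' (.of_forall fun m => by positivity) ?_ h2
  filter_upwards [eventually_ge_atTop 1] with m hm
  have hm' : (1 : ℝ) ≤ m := by exact_mod_cast hm
  have hm0 : (0 : ℝ) < m := by linarith
  simp only [Function.comp]
  rw [← Real.rpow_mul hm0.le, mul_div_cancel₀ _ hη.ne', Real.rpow_add hm0, neg_one_mul]
  have h3 : ((m : ℝ) + 2) ^ (2 * p) ≤ 3 ^ (2 * p) * (m : ℝ) ^ (2 * p : ℝ) := by
    have e1 : (m : ℝ) ^ (2 * p : ℝ) = (m : ℝ) ^ (2 * p) := by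
      rw [← Real.rpow_natCast]; push_cast; rfl
    rw [e1, ← mul_pow]
    exact pow_le_pow_left₀ (by positivity) (by linarith) _
  have h4 : 0 ≤ (m : ℝ) ^ e := Real.rpow_nonneg hm0.le _
  have h5 := (Real.exp_pos (-(m : ℝ) ^ η)).le
  have h6 := mul_le_mul_of_nonneg_left h3 (mul_nonneg h4 h5)
  nlinarith

/-- The depth is half of what regularity could guarantee: about `√m` points are still present there,
well above the concentration error, while `ρ ^ depth` is already a negative power of `m`. The factor
`ρ⁻¹` pays for the floor. -/
theorem depth_bounds {α ρ : ℝ} (hα : 0 < α) (hα1 : α < 1) (hρ : 0 < ρ) (hρ1 : ρ ≤ 1) {m : ℕ}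
    (hm : 1 ≤ m) :
    (m : ℝ) ^ (-(1 / 2) : ℝ) ≤ α ^ ⌊Real.log m / (2 * Real.log α⁻¹)⌋₊ ∧
    ρ ^ ⌊Real.log m / (2 * Real.log α⁻¹)⌋₊
      ≤ ρ⁻¹ * (m : ℝ) ^ (-(Real.log ρ⁻¹ / (2 * Real.log α⁻¹))) := by
  have hm' : (1 : ℝ) ≤ m := by exact_mod_cast hm
  have hm0 : (0 : ℝ) < m := by linarith
  have hlα : 0 < Real.log α⁻¹ := Real.log_pos ((one_lt_inv₀ hα).2 hα1)
  have hlm : 0 ≤ Real.log m := Real.log_nonneg hm'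
  set y := Real.log m / (2 * Real.log α⁻¹) with hy
  have hy0 : 0 ≤ y := by positivity
  have hmul : y * Real.log α⁻¹ = Real.log m / 2 := by
    have aux : ∀ a L : ℝ, 0 < L → a / (2 * L) * L = a / 2 := fun a L hL => by field_simp
    exact aux _ _ hlα
  have hlρ : 0 ≤ Real.log ρ⁻¹ := Real.log_nonneg ((one_le_inv₀ hρ).2 hρ1)
  constructor
  · rw [← Real.exp_log hα, ← Real.exp_nat_mul, Real.rpow_def_of_pos hm0]
    refine Real.exp_le_exp.2 ?_
    have h1 := Nat.floor_le hy0
    have h2 := mul_le_mul_of_nonneg_right h1 hlα.le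
    rw [hmul, Real.log_inv] at h2
    linarith
  · have h1 := (Nat.lt_floor_add_one y).le
    have h2 := mul_le_mul_of_nonneg_right h1 hlρ
    have e : ρ⁻¹ = Real.exp (Real.log ρ⁻¹) := (Real.exp_log (inv_pos.2 hρ)).symm
    have e' : ρ ^ ⌊y⌋₊ = Real.exp (-(⌊y⌋₊ * Real.log ρ⁻¹)) := by
      rw [Real.log_inv, mul_neg, neg_neg, Real.exp_nat_mul, Real.exp_log hρ]
    rw [e', Real.rpow_def_of_pos hm0]
    generalize Real.log ρ⁻¹ = L at *
    rw [e, ← Real.exp_add]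
    refine Real.exp_le_exp.2 ?_
    have h3 : Real.log m * -(L / (2 * Real.log α⁻¹)) = -(y * L) := by
      rw [hy]; ring
    rw [h3]
    linarith

theorem TreeProcedure.meanDist_nonneg {p d s : ℕ} (A : TreeProcedure p d s) (x : Cov p)
    (ν : Measure (Cov p)) (Q : Kernel (Cov p) (Resp d)) : 0 ≤ A.meanDist x ν Q :=
  integral_nonneg fun _ => Finset.sum_nonneg fun i _ =>
    mul_nonneg (A.meanWeight_nonneg x i _) (cubeDist_nonneg _ _)

/-- The mean distance of the observations in the leaf is of smaller order than the second moment of the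
total share of the observations. -/
theorem tendsto_meanDist_div {p d : ℕ} (hp : 0 < p)
    {ν : Measure (Cov p)} [IsProbabilityMeasure ν] {Q : Kernel (Cov p) (Resp d)} [IsMarkovKernel Q]
    {x : Cov p} (hx : x ∈ cube p) {α π : ℝ} {κ : ℕ} (hα : 0 < α) (hα1 : α < 1) (hπ : 0 < π) (hκ : 1 ≤ κ)
    {s : ℕ → ℕ} (hs : ∀ n, 0 < s n) (hs' : Tendsto s atTop atTop) (A : ∀ n, TreeProcedure p d (s n))
    (hrs : ∀ n, (A n).RandomSplit ν Q π) (hsym : ∀ n, (A n).Symmetric ν Q)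
    (hreg : ∀ n, (A n).AlphaRegular ν Q α κ) (hν : HasBoundedDensity ν) :
    (∀ᶠ n in atTop, 0 < (A n).shareSq x ν Q ⟨0, hs n⟩) ∧
    Tendsto (fun n => (A n).meanDist x ν Q / (s n * (A n).shareSq x ν Q ⟨0, hs n⟩)) atTop (𝓝 0) := by
  obtain ⟨c, C, hc, hcC, hcell, hνC⟩ := measure_cell_bounds hν
  have hC : 0 < C := hc.trans_le hcC
  have hp' : (0 : ℝ) < p := by exact_mod_cast hp
  set γ := α * c / (16 * C) with hγdef
  have hγ0 : 0 < γ := by positivity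
  have hγ : γ ≤ 1 / 16 := by
    rw [hγdef, div_le_div_iff₀ (by positivity) (by norm_num)]
    nlinarith
  -- The truncation at `1` keeps `ρ` in `(0, 1)` with no upper bound on `π`.
  set q := min (π / p) 1 with hqdef
  have hq0 : 0 < q := lt_min (by positivity) one_pos
  have hq1 : q ≤ 1 := min_le_right _ _
  have hqπ : q ≤ π / p := min_le_left _ _
  set ρ := 1 - γ * q with hρdef
  have hγq : 0 < γ * q := by positivity
  have hρ1 : ρ < 1 := by linarith
  have hρ0 : 0 < ρ := by nlinarith
  set c₀ := Real.log ρ⁻¹ / (2 * Real.log α⁻¹) with hc₀def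
  have hc₀ : 0 < c₀ := by
    have h1 := Real.log_pos ((one_lt_inv₀ hρ0).2 hρ1)
    have h2 := Real.log_pos ((one_lt_inv₀ hα).2 hα1)
    positivity
  -- The bound `1 / 4` keeps the tolerance `m ^ η` below the `√m` points left at the chosen depth;
  -- the bound `c₀ / 4` makes the loss `m ^ (2 * η)` in the lower bound on `shareSq` smaller than
  -- the gain `m ^ (-c₀)` in `meanDist`.
  set η := min (1 / 4) (c₀ / 4) with hηdef
  have hη0 : 0 < η := lt_min (by norm_num) (by positivity)
  have hη4 : η ≤ 1 / 4 := min_le_left _ _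
  have hηc : η ≤ c₀ / 4 := min_le_right _ _
  obtain ⟨K, hK, hbox⟩ := exists_volume_boxVol_le x hx (a := 1 - η) (by linarith) (by linarith)
  set bad : ℕ → ℝ := fun m => 2 * ((m : ℝ) + 2) ^ (2 * p) * Real.exp (-(m : ℝ) ^ η) with hbad
  set K₂ := 8 * C * (K + 1) * (8 / c) ^ (1 - η) with hK₂
  have hK₂0 : 0 ≤ K₂ := by positivity
  have hbound0 : Tendsto (fun m : ℕ => K₂ * (p * ((m : ℝ) ^ (2 * η) * bad m
      + ρ⁻¹ * (m : ℝ) ^ (2 * η - c₀)))) atTop (𝓝 0) := by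
    have h1 := tendsto_rpow_mul_bad hη0 (2 * η) p
    have h2 : Tendsto (fun m : ℕ => (m : ℝ) ^ (2 * η - c₀)) atTop (𝓝 0) := by
      have := (tendsto_rpow_neg_atTop (y := c₀ - 2 * η) (by linarith)).comp
        tendsto_natCast_atTop_atTop
      refine this.congr fun m => ?_
      simp only [Function.comp, neg_sub]
    have h3 := ((h1.add (h2.const_mul ρ⁻¹)).const_mul (p : ℝ)).const_mul K₂
    simpa using h3
  have hpow : Tendsto (fun m : ℕ => (m : ℝ) ^ η) atTop atTop :=
    (tendsto_rpow_atTop hη0).comp tendsto_natCast_atTop_atTop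
  have hpow2 : Tendsto (fun m : ℕ => (m : ℝ) ^ (1 / 2 - η)) atTop atTop :=
    (tendsto_rpow_atTop (by linarith)).comp tendsto_natCast_atTop_atTop
  have hbadt : Tendsto bad atTop (𝓝 0) := by
    have := tendsto_rpow_mul_bad hη0 0 p
    simpa using this
  have hm : Tendsto (fun n => (s n + 1) / 2) atTop atTop := by
    refine tendsto_atTop.2 fun b => ?_
    filter_upwards [hs'.eventually_ge_atTop (2 * b)] with n hn
    omega
  have hev : ∀ᶠ n in atTop, 0 < (A n).shareSq x ν Q ⟨0, hs n⟩ ∧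
      (A n).meanDist x ν Q / (s n * (A n).shareSq x ν Q ⟨0, hs n⟩)
        ≤ K₂ * (p * ((((s n + 1) / 2 : ℕ) : ℝ) ^ (2 * η) * bad ((s n + 1) / 2)
          + ρ⁻¹ * (((s n + 1) / 2 : ℕ) : ℝ) ^ (2 * η - c₀))) := by
    filter_upwards [hm.eventually (eventually_ge_atTop 1), hm.eventually (eventually_ge_atTop κ),
      hm.eventually (hpow.eventually_ge_atTop (4 * p * C)),
      hm.eventually (hpow.eventually_ge_atTop (κ : ℝ)),
      hm.eventually (hpow2.eventually_ge_atTop (8 / α)),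
      hm.eventually (hbadt.eventually_le_const (show (0 : ℝ) < 1 / 2 by norm_num))]
      with n h1 hκm h4p hκt h8 hb
    have hs0 : (0 : ℝ) < s n := by exact_mod_cast hs n
    have hsm : (s n : ℝ) ≤ 2 * (((s n + 1) / 2 : ℕ) : ℝ) := by
      have : s n ≤ 2 * ((s n + 1) / 2) := by omega
      exact_mod_cast this
    have hE0 : 0 ≤ (A n).shareSq x ν Q ⟨0, hs n⟩ := integral_nonneg fun w => sq_nonneg _
    have hmd := fun k hk => (A n).meanDist_le (t := ((((s n + 1) / 2 : ℕ) : ℝ)) ^ η) (q := q)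
      hx hα hα1.le (hs n) hc hcC hcell hνC h4p (Real.rpow_pos_of_pos (by exact_mod_cast h1) _)
      (by
        rw [le_div_iff₀ hα]
        have : (2 * κ * α : ℝ) ≤ 2 * κ := mul_le_of_le_one_right (by positivity) hα1.le
        have : (0 : ℝ) ≤ κ := Nat.cast_nonneg _
        linarith) hq0.le hq1 hqπ hκm (hreg n) (hrs n) k hk
    have hib := (A n).integral_boxVol_le (t := ((((s n + 1) / 2 : ℕ) : ℝ)) ^ η)
      hx hc hcC hcell h4p (hs n) hκm (hreg n)
    have hlow := fun M hM h => (A n).one_le_mul_shareSq hx (hsym n) (hs n)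
      ((A n).sum_meanWeight_ae_eq_one x hκ hκm (hreg n)) (M := M) hM (hib.trans hb) h ⟨0, hs n⟩
    generalize (A n).shareSq x ν Q ⟨0, hs n⟩ = E at *
    have hD0 := (A n).meanDist_nonneg x ν Q
    generalize (A n).meanDist x ν Q = D at *
    generalize (s n + 1) / 2 = m at *
    have hm1 : (1 : ℝ) ≤ m := by exact_mod_cast h1
    have hm0 : (0 : ℝ) < m := by linarith
    obtain ⟨hd1, hd2⟩ := depth_bounds hα hα1 hρ0 hρ1.le h1
    -- The count condition at this depth reads `8 / α * m ^ η ≤ m ^ (1 / 2)`, which holds for large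
    -- `m`.
    have hD := hmd ⌊Real.log m / (2 * Real.log α⁻¹)⌋₊ (by
      have e1 : (m : ℝ) ^ (1 / 2 - η) * (m : ℝ) ^ η = (m : ℝ) ^ (1 / 2 : ℝ) := by
        rw [← Real.rpow_add hm0]; congr 1; ring
      have e2 : (m : ℝ) ^ (-(1 / 2) : ℝ) * m = (m : ℝ) ^ (1 / 2 : ℝ) := by
        rw [← Real.rpow_add_one hm0.ne']; norm_num
      have e3 : 8 * (m : ℝ) ^ η / α = 8 / α * (m : ℝ) ^ η := by ring
      rw [e3]
      refine (mul_le_mul_of_nonneg_right h8 (by positivity)).trans ?_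
      rw [e1, ← e2]
      exact mul_le_mul_of_nonneg_right hd1 hm0.le)
    set a := 4 * ((κ : ℝ) + (m : ℝ) ^ η) / (c * m) with ha
    have ha0 : 0 < a := by positivity
    -- `K + 1` instead of `K` makes this bound strictly positive, as `hlow` demands.
    have hνa : ν.real {u | boxVol x u ≤ a} ≤ C * ((K + 1) * a ^ (1 - η)) := by
      have h2 : ν {u | boxVol x u ≤ a} ≤ ENNReal.ofReal C * volume.restrict (cube p) {u | boxVol x u ≤ a} :=
        hνC _
      have hfin : volume.restrict (cube p) {u | boxVol x u ≤ a} ≠ ⊤ := by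
        refine ne_top_of_le_ne_top ?_ (measure_mono (Set.subset_univ _))
        rw [Measure.restrict_apply_univ, ← root_toSet, volume_toSet]
        exact ENNReal.ofReal_ne_top
      have h3 := ENNReal.toReal_mono (ENNReal.mul_ne_top ENNReal.ofReal_ne_top hfin) h2
      rw [ENNReal.toReal_mul, ENNReal.toReal_ofReal hC.le] at h3
      refine h3.trans (mul_le_mul_of_nonneg_left ((hbox a ha0).trans ?_) hC.le)
      exact mul_le_mul_of_nonneg_right (by linarith) (by positivity)
    have hE := hlow (C * ((K + 1) * a ^ (1 - η))) (by positivity) hνa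
    have hE1 : 0 < E := by
      refine lt_of_le_of_ne hE0 fun h => ?_
      rw [← h, mul_zero] at hE
      linarith
    refine ⟨hE1, ?_⟩
    -- As `a` is of order `m ^ (η - 1)`, its power `a ^ (1 - η)` is of order `m ^ (-(1 - η)²)`, at
    -- most `m ^ (2 * η - 1)`. The factor `s n ≤ 2 * m` turns this into `m ^ (2 * η)`.
    have hsa : 4 * s n * (C * ((K + 1) * a ^ (1 - η))) ≤ K₂ * (m : ℝ) ^ (2 * η) := by
      have h5 : a ≤ 8 / c * (m : ℝ) ^ (η - 1) := by
        rw [ha, Real.rpow_sub_one hm0.ne', div_mul_div_comm]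
        exact div_le_div_of_nonneg_right (by linarith) (by positivity)
      have h6 : a ^ (1 - η) ≤ (8 / c) ^ (1 - η) * (m : ℝ) ^ (2 * η - 1) := by
        refine (Real.rpow_le_rpow ha0.le h5 (by linarith)).trans ?_
        rw [Real.mul_rpow (by positivity) (by positivity), ← Real.rpow_mul hm0.le]
        refine mul_le_mul_of_nonneg_left ?_ (by positivity)
        exact Real.rpow_le_rpow_of_exponent_le hm1 (by nlinarith)
      have h7 : (m : ℝ) ^ (2 * η) = m * (m : ℝ) ^ (2 * η - 1) := by
        have := Real.rpow_add_one hm0.ne' (2 * η - 1)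
        rw [sub_add_cancel] at this
        rw [this, mul_comm]
      calc 4 * s n * (C * ((K + 1) * a ^ (1 - η)))
          ≤ 4 * (2 * m) * (C * ((K + 1) * ((8 / c) ^ (1 - η) * (m : ℝ) ^ (2 * η - 1)))) := by
            gcongr
        _ = K₂ * (m : ℝ) ^ (2 * η) := by rw [h7, hK₂]; ring
    have hdiv : D / (s n * E) ≤ 4 * s n * (C * ((K + 1) * a ^ (1 - η))) * D := by
      rw [div_le_iff₀ (by positivity)]
      have := mul_le_mul_of_nonneg_left hE hD0
      rw [mul_one] at this
      refine this.trans_eq ?_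
      ring
    refine hdiv.trans ((mul_le_mul_of_nonneg_right hsa hD0).trans ?_)
    rw [mul_assoc]
    refine mul_le_mul_of_nonneg_left ?_ hK₂0
    have h8 : D ≤ p * (bad m + ρ⁻¹ * (m : ℝ) ^ (-c₀)) := by
      refine hD.trans (mul_le_mul_of_nonneg_left ?_ hp'.le)
      simp only [hbad]
      linarith
    refine (mul_le_mul_of_nonneg_left h8 (by positivity)).trans_eq ?_
    have h9 : (m : ℝ) ^ (2 * η - c₀) = (m : ℝ) ^ (2 * η) * (m : ℝ) ^ (-c₀) := by
      rw [← Real.rpow_add hm0]; rfl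
    rw [h9]; ring
  refine ⟨hev.mono fun n h => h.1, ?_⟩
  refine squeeze_zero' (hev.mono fun n h => ?_) (hev.mono fun n h => h.2) (hbound0.comp hm)
  exact div_nonneg ((A n).meanDist_nonneg x ν Q) (mul_nonneg (Nat.cast_nonneg _) h.1.le)

/-! ### The feature map of a bounded continuous kernel -/

section Feature

variable {d : ℕ} {H : Type*} [NormedAddCommGroup H] [InnerProductSpace ℝ H] [CompleteSpace H]
  [RKHS ℝ H (Resp d) ℝ]

theorem inner_feature (f : H) (y : Resp d) : ⟪f, feature H y⟫ = f y := by
  unfold feature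
  rw [RKHS.inner_kerFun]
  simp

theorem kernelFn_eq (y y' : Resp d) : kernelFn H y y' = ⟪feature H y, feature H y'⟫ := by
  rw [real_inner_comm, inner_feature]
  unfold kernelFn feature
  rw [RKHS.kerFun_apply]

theorem exists_norm_feature_le (hK : KernelBounded H) : ∃ B : ℝ, 0 ≤ B ∧ ∀ y, ‖feature H y‖ ≤ B := by
  obtain ⟨M, hM⟩ := hK
  refine ⟨√M, Real.sqrt_nonneg _, fun y => Real.le_sqrt_of_sq_le ?_⟩
  rw [← real_inner_self_eq_norm_sq, ← kernelFn_eq]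
  exact hM ⟨(y, y), rfl⟩

/-- The squared distance of two features is `k(w,w) - 2 k(w,y) + k(y,y)`, which vanishes as `w → y`.
Continuity on the separable space `Resp d` also yields strong measurability without separability of
`H`. -/
theorem continuous_feature (hK : KernelContinuous H) : Continuous (feature H : Resp d → H) := by
  rw [continuous_iff_continuousAt]
  intro y
  rw [ContinuousAt, tendsto_iff_norm_sub_tendsto_zero]
  have hk : ∀ {g g' : Resp d → Resp d}, Continuous g → Continuous g' →
      Continuous fun w => kernelFn H (g w) (g' w) := fun hg hg' => by
    have h0 : Continuous fun q : Resp d × Resp d => kernelFn H q.1 q.2 := hK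
    have h1 := h0.comp (hg.prodMk hg')
    exact h1
  have hsq : ∀ w, ‖feature H w - feature H y‖ ^ 2
      = kernelFn H w w - 2 * kernelFn H w y + kernelFn H y y := fun w => by
    rw [norm_sub_sq_real, kernelFn_eq, kernelFn_eq, kernelFn_eq, real_inner_self_eq_norm_sq,
      real_inner_self_eq_norm_sq]
  have hc : Continuous fun w => kernelFn H w w - 2 * kernelFn H w y + kernelFn H y y :=
    ((hk continuous_id continuous_id).sub ((hk continuous_id continuous_const).const_mul 2)).add
      continuous_const
  have h2 : Tendsto (fun w => √(‖feature H w - feature H y‖ ^ 2)) (𝓝 y) (𝓝 0) := by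
    have h3 := (Real.continuous_sqrt.comp hc).tendsto y
    have h4 : kernelFn H y y - 2 * kernelFn H y y + kernelFn H y y = 0 := by ring
    rw [Function.comp_apply, h4, Real.sqrt_zero] at h3
    refine h3.congr fun w => ?_
    rw [hsq]
    rfl
  refine h2.congr fun w => ?_
  rw [Real.sqrt_sq (norm_nonneg _)]

theorem stronglyMeasurable_feature (hK : KernelContinuous H) :
    StronglyMeasurable (feature H : Resp d → H) :=
  (continuous_feature hK).stronglyMeasurable

variable {p : ℕ} {Q : Kernel (Cov p) (Resp d)} [IsMarkovKernel Q]

theorem stronglyMeasurable_condMean (hK : KernelContinuous H) :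
    StronglyMeasurable (condMean H Q) := by
  unfold condMean
  exact StronglyMeasurable.integral_kernel_prod_right (κ := Q) (f := fun _ y => feature H y)
    ((stronglyMeasurable_feature hK).comp_measurable measurable_snd)

theorem norm_condMean_le {B : ℝ} (hB : ∀ y, ‖feature H y‖ ≤ B) (u : Cov p) : ‖condMean H Q u‖ ≤ B := by
  refine (norm_integral_le_of_norm_le_const (C := B) (.of_forall fun y => hB y)).trans ?_
  simp

/-- The residual has conditional mean zero. -/
theorem integral_smul_resid (hK : KernelContinuous H) {B : ℝ} (hB : ∀ y, ‖feature H y‖ ≤ B)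
    {ν : Measure (Cov p)} [IsProbabilityMeasure ν] {b : Obs p d → ℝ} (hb : StronglyMeasurable b)
    {G : ℝ} (hbG : ∀ w, ‖b w‖ ≤ G) (hbY : ∀ u y y', b (u, y) = b (u, y')) :
    ∫ w, b w • (feature H w.2 - condMean H Q w.1) ∂(ν ⊗ₘ Q) = 0 := by
  have hF : StronglyMeasurable fun w : Obs p d => b w • (feature H w.2 - condMean H Q w.1) :=
    hb.smul (((stronglyMeasurable_feature hK).comp_measurable measurable_snd).sub
      ((stronglyMeasurable_condMean hK).comp_measurable measurable_fst))
  have hint : Integrable (fun w : Obs p d => b w • (feature H w.2 - condMean H Q w.1)) (ν ⊗ₘ Q) :=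
    integrable_of_bdd hF.aestronglyMeasurable (M := G * (B + B)) fun w => by
      rw [norm_smul]
      exact mul_le_mul (hbG w) ((norm_sub_le _ _).trans (add_le_add (hB _) (norm_condMean_le hB _)))
        (norm_nonneg _) ((norm_nonneg _).trans (hbG w))
  rw [Measure.integral_compProd hint]
  have : ∀ u, ∫ y, b (u, y) • (feature H y - condMean H Q u) ∂(Q u) = 0 := fun u => by
    have hfi : Integrable (feature H) (Q u) :=
      integrable_of_bdd (stronglyMeasurable_feature hK).aestronglyMeasurable hB
    have e : ∀ y, b (u, y) • (feature H y - condMean H Q u)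
        = b (u, 0) • (feature H y - condMean H Q u) := fun y => by rw [hbY u y 0]
    simp_rw [e]
    rw [integral_smul, integral_sub hfi (integrable_const _)]
    simp [condMean]
  simp [this]

end Feature

/-! ### Invariance properties of the variance -/

section Variance

variable {Ω V : Type*} [MeasurableSpace Ω] [NormedAddCommGroup V] [InnerProductSpace ℝ V]

theorem hilbertVar_congr {P : Measure Ω} {ξ η : Ω → V} (h : ξ =ᵐ[P] η) :
    hilbertVar P ξ = hilbertVar P η := by
  unfold hilbertVar
  rw [integral_congr_ae h]
  refine integral_congr_ae ?_
  filter_upwards [h] with ω hω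
  rw [hω]

theorem hilbertVar_eval {ι : Type*} [Fintype ι] [DecidableEq ι] [CompleteSpace V] {lam : Measure Ω}
    [IsProbabilityMeasure lam] (i : ι) {g : Ω → V} (hg : StronglyMeasurable g) :
    hilbertVar (Measure.pi fun _ : ι => lam) (fun z => g (z i)) = hilbertVar lam g := by
  unfold hilbertVar
  rw [integral_eval hg.aestronglyMeasurable]
  exact integral_eval (g := fun w => ‖g w - ∫ w', g w' ∂lam‖ ^ 2)
    ((hg.sub stronglyMeasurable_const).norm.pow 2).aestronglyMeasurable

theorem variance_eq_hilbertVar {P : Measure Ω} {ξ : Ω → ℝ} (hξ : AEMeasurable ξ P) :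
    Var[ξ; P] = hilbertVar P ξ := by
  rw [variance_eq_integral hξ]
  unfold hilbertVar
  simp only [Real.norm_eq_abs, sq_abs]

end Variance

theorem integral_update' {ι Ω V : Type*} [Fintype ι] [DecidableEq ι] [MeasurableSpace Ω]
    {lam : Measure Ω} [IsProbabilityMeasure lam] [NormedAddCommGroup V] [InnerProductSpace ℝ V]
    [CompleteSpace V] {F : (ι → Ω) → V} (hF : Integrable F (Measure.pi fun _ => lam)) (i : ι) :
    ∫ z, F z ∂(Measure.pi fun _ => lam)
      = ∫ z, ∫ w, F (Function.update z i w) ∂lam ∂(Measure.pi fun _ => lam) := by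
  rw [integral_update hF i]
  exact integral_integral_swap (integrable_update hF i).swap

/-! ### The projection of a tree onto one observation -/

namespace TreeProcedure

variable {p d s : ℕ} (A : TreeProcedure p d s) {x : Cov p}
  {ν : Measure (Cov p)} [IsProbabilityMeasure ν] {Q : Kernel (Cov p) (Resp d)} [IsMarkovKernel Q]
  (H : Type*) [NormedAddCommGroup H] [InnerProductSpace ℝ H] [CompleteSpace H]
  [RKHS ℝ H (Resp d) ℝ]

variable (x Q) in
/-- The error due to the distances of the observations in the leaf to `x`. -/
noncomputable def biasPart (z : Fin s → Obs p d) : H :=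
  ∑ i, A.meanWeight x i z • condMean H Q (z i).1 - condMean H Q x

variable (x ν Q) in
/-- The part of the projection of a tree that is due to the response of the observation. -/
noncomputable def noisePart (i : Fin s) (w : Obs p d) : H :=
  A.share x ν Q i w • (feature H w.2 - condMean H Q w.1)

variable {H}

theorem norm_sum_meanWeight_smul_le {B : ℝ} (z : Fin s → Obs p d) {v : Fin s → H}
    (hv : ∀ i, ‖v i‖ ≤ B) (hB : 0 ≤ B) : ‖∑ i, A.meanWeight x i z • v i‖ ≤ B := by
  refine (norm_sum_le _ _).trans ?_
  have : ∀ i ∈ Finset.univ, ‖A.meanWeight x i z • v i‖ ≤ A.meanWeight x i z * B := fun i _ => by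
    rw [norm_smul, Real.norm_of_nonneg (A.meanWeight_nonneg x i z)]
    exact mul_le_mul_of_nonneg_left (hv i) (A.meanWeight_nonneg x i z)
  refine (Finset.sum_le_sum this).trans ?_
  rw [← Finset.sum_mul]
  exact mul_le_of_le_one_left hB (A.sum_meanWeight_le_one x z)

variable (hK : KernelContinuous H) {B : ℝ} (hB0 : 0 ≤ B) (hB : ∀ y, ‖feature H y‖ ≤ B)

include hK in
theorem stronglyMeasurable_biasPart : StronglyMeasurable (A.biasPart x Q H) := by
  unfold biasPart
  refine (Finset.stronglyMeasurable_fun_sum _ fun i _ => ?_).sub stronglyMeasurable_const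
  exact (A.stronglyMeasurable_meanWeight x i).smul
    ((stronglyMeasurable_condMean hK).comp_measurable (measurable_pi_apply i).fst)

include hB0 hB in
theorem norm_biasPart_le (z : Fin s → Obs p d) : ‖A.biasPart x Q H z‖ ≤ 2 * B := by
  refine (norm_sub_le _ _).trans ?_
  have h1 := A.norm_sum_meanWeight_smul_le (x := x) z
    (v := fun i => condMean H Q (z i).1) (fun i => norm_condMean_le hB _) hB0
  linarith [norm_condMean_le (Q := Q) hB x]

include hK in
theorem stronglyMeasurable_noisePart (i : Fin s) : StronglyMeasurable (A.noisePart x ν Q H i) :=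
  (A.stronglyMeasurable_share x ν Q i).smul
    (((stronglyMeasurable_feature hK).comp_measurable measurable_snd).sub
      ((stronglyMeasurable_condMean hK).comp_measurable measurable_fst))

include hB0 hB in
theorem norm_noisePart_le (i : Fin s) (w : Obs p d) : ‖A.noisePart x ν Q H i w‖ ≤ 2 * B := by
  unfold noisePart
  rw [norm_smul]
  refine (mul_le_mul (A.norm_share_le x ν Q i w) ((norm_sub_le _ _).trans
    (add_le_add (hB _) (norm_condMean_le hB _))) (norm_nonneg _) zero_le_one).trans ?_
  linarith

include hK hB in
theorem integral_noisePart (hhon : A.Honest) (i : Fin s) :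
    ∫ w, A.noisePart x ν Q H i w ∂(ν ⊗ₘ Q) = 0 :=
  integral_smul_resid hK hB (A.stronglyMeasurable_share x ν Q i) (A.norm_share_le x ν Q i)
    (A.share_eq x ν Q hhon i)

include hK in
theorem stronglyMeasurable_T : StronglyMeasurable (A.T H x) := by
  have : A.T H x = fun z => ∑ i, A.meanWeight x i z • feature H (z i).2 :=
    funext fun z => A.T_eq_sum x H z
  rw [this]
  exact Finset.stronglyMeasurable_fun_sum _ fun i _ => (A.stronglyMeasurable_meanWeight x i).smul
    ((stronglyMeasurable_feature hK).comp_measurable (measurable_pi_apply i).snd)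

include hB0 hB in
theorem norm_T_le (z : Fin s → Obs p d) : ‖A.T H x z‖ ≤ B := by
  rw [T_eq_sum]
  exact A.norm_sum_meanWeight_smul_le z (fun i => hB _) hB0

include hK hB0 hB in
/-- The projection of a tree onto one observation. -/
theorem marg_T (hhon : A.Honest) (i : Fin s) (w : Obs p d) :
    marg (ν ⊗ₘ Q) (A.T H x) i w
      = A.noisePart x ν Q H i w + marg (ν ⊗ₘ Q) (A.biasPart x Q H) i w + condMean H Q x := by
  have hup : Measurable fun z : Fin s → Obs p d => Function.update z i w :=
    (measurable_update_pair i).comp (measurable_id.prodMk measurable_const)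
  have hresm : ∀ k, StronglyMeasurable fun z : Fin s → Obs p d =>
      A.meanWeight x k z • (feature H (z k).2 - condMean H Q (z k).1) := fun k =>
    (A.stronglyMeasurable_meanWeight x k).smul
      (((stronglyMeasurable_feature hK).comp_measurable (measurable_pi_apply k).snd).sub
        ((stronglyMeasurable_condMean hK).comp_measurable (measurable_pi_apply k).fst))
  have hresB : ∀ k (z : Fin s → Obs p d),
      ‖A.meanWeight x k z • (feature H (z k).2 - condMean H Q (z k).1)‖ ≤ 1 * (B + B) := fun k z => by
    rw [norm_smul]
    exact mul_le_mul (A.norm_meanWeight_le x k z) ((norm_sub_le _ _).trans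
      (add_le_add (hB _) (norm_condMean_le hB _))) (norm_nonneg _) zero_le_one
  have hdec : ∀ z : Fin s → Obs p d, A.T H x z
      = (∑ k, A.meanWeight x k z • (feature H (z k).2 - condMean H Q (z k).1) + A.biasPart x Q H z)
        + condMean H Q x := fun z => by
    rw [T_eq_sum]
    unfold biasPart
    simp_rw [smul_sub, Finset.sum_sub_distrib]
    abel
  have hi1 : ∀ k, Integrable (fun z : Fin s → Obs p d => A.meanWeight x k (Function.update z i w) •
      (feature H (Function.update z i w k).2 - condMean H Q (Function.update z i w k).1))
      (Measure.pi fun _ => ν ⊗ₘ Q) := fun k =>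
    integrable_of_bdd ((hresm k).comp_measurable hup).aestronglyMeasurable fun z => hresB k _
  have hi2 : Integrable (fun z : Fin s → Obs p d => A.biasPart x Q H (Function.update z i w))
      (Measure.pi fun _ => ν ⊗ₘ Q) :=
    integrable_of_bdd ((A.stronglyMeasurable_biasPart hK).comp_measurable hup).aestronglyMeasurable
      fun z => A.norm_biasPart_le hB0 hB _
  -- Resample coordinate `k` as the innermost variable: given everything else, honesty frees the
  -- weight of the response, and the residual averages to zero.
  have hzero : ∀ k, k ≠ i → ∫ z : Fin s → Obs p d, A.meanWeight x k (Function.update z i w) •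
      (feature H (Function.update z i w k).2 - condMean H Q (Function.update z i w k).1)
      ∂(Measure.pi fun _ => ν ⊗ₘ Q) = 0 := fun k hk => by
    rw [integral_update' (hi1 k) k]
    have : ∀ z : Fin s → Obs p d, ∫ w', A.meanWeight x k (Function.update (Function.update z k w') i w) •
      (feature H (Function.update (Function.update z k w') i w k).2
        - condMean H Q (Function.update (Function.update z k w') i w k).1) ∂(ν ⊗ₘ Q) = 0 := fun z => by
      simp only [Function.update_of_ne hk, Function.update_self]
      simp_rw [Function.update_comm hk]
      refine integral_smul_resid hK hB (b := fun w' => A.meanWeight x k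
        (Function.update (Function.update z i w) k w')) ?_ (fun w' => A.norm_meanWeight_le x k _)
        (fun u y y' => A.meanWeight_update x hhon k _ u y y')
      exact (A.stronglyMeasurable_meanWeight x k).comp_measurable
        ((measurable_update_pair k).comp (measurable_const.prodMk measurable_id))
    simp [this]
  unfold marg
  simp_rw [hdec]
  have hi3 : Integrable (fun z : Fin s → Obs p d => ∑ k, A.meanWeight x k (Function.update z i w) •
      (feature H (Function.update z i w k).2 - condMean H Q (Function.update z i w k).1)
      + A.biasPart x Q H (Function.update z i w)) (Measure.pi fun _ => ν ⊗ₘ Q) :=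
    (integrable_finsetSum _ fun k _ => hi1 k).add hi2
  rw [integral_add hi3 (integrable_const _),
    integral_add (integrable_finsetSum _ fun k _ => hi1 k) hi2,
    integral_finsetSum _ fun k _ => hi1 k,
    Finset.sum_eq_single i (fun k _ hk => hzero k hk) (by simp)]
  congr 1
  · congr 1
    simp only [Function.update_self]
    rw [integral_smul_const]
    rfl
  · simp

/-- The bias is symmetric in the observations. -/
theorem biasPart_perm (hx : x ∈ cube p) (hsym : A.Symmetric ν Q) (σ : Equiv.Perm (Fin s)) :
    ∀ᵐ z ∂(sampleLaw s ν Q), A.biasPart x Q H (fun k => z (σ k)) = A.biasPart x Q H z := by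
  filter_upwards [A.meanWeight_perm x hx hsym σ] with z hz
  unfold biasPart
  congr 1
  rw [← Equiv.sum_comp σ fun i => A.meanWeight x i z • condMean H Q (z i).1]
  exact Finset.sum_congr rfl fun i _ => by rw [hz i]

include hK hB0 hB in
/-- The projection of the bias is small. -/
theorem mul_hilbertVar_biasPart_le (hx : x ∈ cube p) (hsym : A.Symmetric ν Q)
    (hone : ∀ᵐ z ∂(sampleLaw s ν Q), ∑ i, A.meanWeight x i z = 1)
    (hcube : ∀ᵐ z ∂(sampleLaw s ν Q), ∀ i, (z i).1 ∈ cube p) {L : ℝ}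
    (hL : ∀ u ∈ cube p, ‖condMean H Q u - condMean H Q x‖ ≤ L * cubeDist x u) (i : Fin s) :
    s * hilbertVar (ν ⊗ₘ Q) (marg (ν ⊗ₘ Q) (A.biasPart x Q H) i) ≤ 2 * B * L * A.meanDist x ν Q := by
  have hF := A.stronglyMeasurable_biasPart (x := x) (Q := Q) hK
  have hFB := A.norm_biasPart_le (x := x) (Q := Q) hB0 hB
  -- By symmetry the `s` terms on the left of Bessel's inequality coincide; this produces the factor
  -- `s` in the claim.
  have h1 := sum_hilbertVar_marg_le (lam := ν ⊗ₘ Q) hF hFB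
  have h2 : ∀ k, hilbertVar (ν ⊗ₘ Q) (marg (ν ⊗ₘ Q) (A.biasPart x Q H) k)
      = hilbertVar (ν ⊗ₘ Q) (marg (ν ⊗ₘ Q) (A.biasPart x Q H) i) := fun k =>
    hilbertVar_congr (marg_ae_eq_of_symm k i (fun σ => A.biasPart_perm hx hsym σ) hF)
  simp_rw [h2] at h1
  rw [Finset.sum_const, Finset.card_univ, Fintype.card_fin, nsmul_eq_mul] at h1
  refine h1.trans ?_
  have hsumm : StronglyMeasurable fun z : Fin s → Obs p d =>
      ∑ i, A.meanWeight x i z * cubeDist x (z i).1 :=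
    Finset.stronglyMeasurable_fun_sum _ fun i _ => (A.stronglyMeasurable_meanWeight x i).mul
      ((measurable_cubeDist x).comp (measurable_pi_apply i).fst).stronglyMeasurable
  have hsumi : Integrable (fun z : Fin s → Obs p d => ∑ i, A.meanWeight x i z * cubeDist x (z i).1)
      (sampleLaw s ν Q) := by
    refine integrable_of_bdd hsumm.aestronglyMeasurable (M := p) fun z => ?_
    rw [Real.norm_of_nonneg (Finset.sum_nonneg fun i _ =>
      mul_nonneg (A.meanWeight_nonneg x i z) (cubeDist_nonneg _ _))]
    refine (Finset.sum_le_sum fun i _ => mul_le_mul_of_nonneg_left (cubeDist_le x _)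
      (A.meanWeight_nonneg x i z)).trans ?_
    rw [← Finset.sum_mul]
    exact mul_le_of_le_one_left (Nat.cast_nonneg _) (A.sum_meanWeight_le_one x z)
  unfold meanDist
  rw [← integral_const_mul]
  refine integral_mono_of_nonneg (.of_forall fun z => sq_nonneg _) (hsumi.const_mul _) ?_
  filter_upwards [hone, hcube] with z hz1 hzc
  have e : A.biasPart x Q H z = ∑ i, A.meanWeight x i z • (condMean H Q (z i).1 - condMean H Q x) := by
    unfold biasPart
    simp_rw [smul_sub, Finset.sum_sub_distrib, ← Finset.sum_smul, hz1, one_smul]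
  have h3 : ‖A.biasPart x Q H z‖ ≤ L * ∑ i, A.meanWeight x i z * cubeDist x (z i).1 := by
    rw [e, Finset.mul_sum]
    refine (norm_sum_le _ _).trans (Finset.sum_le_sum fun i _ => ?_)
    rw [norm_smul, Real.norm_of_nonneg (A.meanWeight_nonneg x i z), mul_left_comm]
    exact mul_le_mul_of_nonneg_left (hL _ (hzc i)) (A.meanWeight_nonneg x i z)
  -- One factor of the square is bounded by `2 * B` and the other by the weighted distance, so the
  -- bound is linear in `meanDist`.
  rw [sq, mul_assoc]
  exact mul_le_mul (hFB z) h3 (norm_nonneg _) (by positivity)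

/-- The conditional variance of the image of the feature under a linear map. -/
noncomputable def _root_.DRF.linVar {V : Type*} [NormedAddCommGroup V] [InnerProductSpace ℝ V]
    (Q : Kernel (Cov p) (Resp d)) (l : H →L[ℝ] V) (u : Cov p) : ℝ :=
  ∫ y, ‖l (feature H y - condMean H Q u)‖ ^ 2 ∂(Q u)

section Linear

variable {V : Type*} [NormedAddCommGroup V] [InnerProductSpace ℝ V] [CompleteSpace V] (l : H →L[ℝ] V)

include hB in
theorem _root_.DRF.norm_map_resid_le (y : Resp d) (u : Cov p) :
    ‖l (feature H y - condMean H Q u)‖ ≤ ‖l‖ * (2 * B) := by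
  refine (l.le_opNorm _).trans (mul_le_mul_of_nonneg_left ?_ (norm_nonneg _))
  linarith [norm_sub_le (feature H y) (condMean H Q u), hB y, norm_condMean_le (Q := Q) hB u]

include hK in
theorem _root_.DRF.stronglyMeasurable_map_resid :
    StronglyMeasurable fun w : Obs p d => l (feature H w.2 - condMean H Q w.1) :=
  l.continuous.comp_stronglyMeasurable
    (((stronglyMeasurable_feature hK).comp_measurable measurable_snd).sub
      ((stronglyMeasurable_condMean hK).comp_measurable measurable_fst))

include hK hB hB0 in
/-- The second moment of the noise is approximately proportional to the conditional variance at `x`. -/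
theorem abs_integral_noisePart_sq_sub_le (hx : x ∈ cube p) (hhon : A.Honest) (hsym : A.Symmetric ν Q)
    (hs : 0 < s) (hνc : ∀ᵐ w ∂(ν ⊗ₘ Q), w.1 ∈ cube p) {L : ℝ}
    (hL : ∀ u ∈ cube p, |linVar Q l u - linVar Q l x| ≤ L * cubeDist x u) (i : Fin s) :
    |∫ w, ‖l (A.noisePart x ν Q H i w)‖ ^ 2 ∂(ν ⊗ₘ Q) - linVar Q l x * A.shareSq x ν Q i|
      ≤ L * (A.meanDist x ν Q / s) := by
  have hs' : (0 : ℝ) < s := by exact_mod_cast hs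
  set b := A.share x ν Q i with hb
  have hbm := A.stronglyMeasurable_share x ν Q i
  have hG0 : 0 ≤ ‖l‖ * (2 * B) := by positivity
  have hsqm : StronglyMeasurable fun w : Obs p d => ‖l (feature H w.2 - condMean H Q w.1)‖ ^ 2 :=
    (stronglyMeasurable_map_resid hK l).norm.pow 2
  have hsqB : ∀ (y : Resp d) (u : Cov p), ‖‖l (feature H y - condMean H Q u)‖ ^ 2‖ ≤ (‖l‖ * (2 * B)) ^ 2 :=
    fun y u => by
      rw [norm_pow, norm_norm]
      exact pow_le_pow_left₀ (norm_nonneg _) (norm_map_resid_le hB l y u) 2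
  have hlvm : StronglyMeasurable (linVar Q l) := by
    unfold linVar
    exact StronglyMeasurable.integral_kernel_prod_right (κ := Q)
      (f := fun u y => ‖l (feature H y - condMean H Q u)‖ ^ 2) hsqm
  have hlvB : ∀ u, ‖linVar Q l u‖ ≤ (‖l‖ * (2 * B)) ^ 2 := fun u => by
    refine (norm_integral_le_of_norm_le_const (.of_forall fun y => hsqB y u)).trans ?_
    simp
  have hb2B : ∀ w, ‖b w ^ 2‖ ≤ 1 := fun w => by
    rw [norm_pow]; exact pow_le_one₀ (norm_nonneg _) (A.norm_share_le x ν Q i w)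
  have hint : Integrable (fun w : Obs p d => b w ^ 2 * ‖l (feature H w.2 - condMean H Q w.1)‖ ^ 2)
      (ν ⊗ₘ Q) := integrable_of_bdd ((hbm.pow 2).mul hsqm).aestronglyMeasurable
        (M := 1 * (‖l‖ * (2 * B)) ^ 2) fun w => by
      rw [norm_mul]
      exact mul_le_mul (hb2B w) (hsqB _ _) (norm_nonneg _) zero_le_one
  have hint2 : Integrable (fun w : Obs p d => b w ^ 2 * linVar Q l w.1) (ν ⊗ₘ Q) :=
    integrable_of_bdd ((hbm.pow 2).mul (hlvm.comp_measurable measurable_fst)).aestronglyMeasurable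
        (M := 1 * (‖l‖ * (2 * B)) ^ 2) fun w => by
      rw [norm_mul]
      exact mul_le_mul (hb2B w) (hlvB _) (norm_nonneg _) zero_le_one
  have e1 : ∫ w, ‖l (A.noisePart x ν Q H i w)‖ ^ 2 ∂(ν ⊗ₘ Q)
      = ∫ w, b w ^ 2 * linVar Q l w.1 ∂(ν ⊗ₘ Q) := by
    have h : ∀ w, ‖l (A.noisePart x ν Q H i w)‖ ^ 2
        = b w ^ 2 * ‖l (feature H w.2 - condMean H Q w.1)‖ ^ 2 := fun w => by
      unfold noisePart
      rw [map_smul, norm_smul, mul_pow, Real.norm_eq_abs, sq_abs]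
    simp_rw [h]
    rw [Measure.integral_compProd hint, Measure.integral_compProd hint2]
    refine integral_congr_ae (.of_forall fun u => ?_)
    have hbY : ∀ y, b (u, y) = b (u, 0) := fun y => A.share_eq x ν Q hhon i u y 0
    simp only [hbY]
    rw [integral_const_mul, integral_const_mul]
    congr 1
    simp [linVar]
  have e2 : linVar Q l x * A.shareSq x ν Q i = ∫ w, b w ^ 2 * linVar Q l x ∂(ν ⊗ₘ Q) := by
    rw [integral_mul_const, mul_comm]; rfl
  have e3 : A.meanDist x ν Q / s = ∫ w, b w * cubeDist x w.1 ∂(ν ⊗ₘ Q) := by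
    rw [← A.integral_share_mul_cubeDist hx hsym i, mul_comm, mul_div_assoc, div_self hs'.ne', mul_one]
  have hci : Integrable (fun w : Obs p d => b w * cubeDist x w.1) (ν ⊗ₘ Q) :=
    integrable_of_bdd (hbm.mul ((measurable_cubeDist x).comp
      measurable_fst).stronglyMeasurable).aestronglyMeasurable (M := 1 * p) fun w => by
        rw [norm_mul, Real.norm_of_nonneg (cubeDist_nonneg x _)]
        exact mul_le_mul (A.norm_share_le x ν Q i w) (cubeDist_le x _) (cubeDist_nonneg _ _) zero_le_one
  rw [e1, e2, ← integral_sub hint2 ((A.integrable_share_sq i).mul_const _), e3, ← integral_const_mul,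
    ← Real.norm_eq_abs]
  refine norm_integral_le_of_norm_le (hci.const_mul L) ?_
  filter_upwards [hνc] with w hw
  rw [← mul_sub, norm_mul, Real.norm_eq_abs (linVar Q l w.1 - _), norm_pow,
    Real.norm_of_nonneg (A.share_nonneg x ν Q i w)]
  have h0 := A.share_nonneg x ν Q i w
  have h1 := A.share_le_one x ν Q i w
  -- Passing from `b²` to `b` loses little enough, and the first moment against the distance is
  -- exactly `meanDist / s`.
  have h2 : b w ^ 2 ≤ b w := by rw [sq]; exact mul_le_of_le_one_left h0 h1
  refine (mul_le_mul h2 (hL _ hw) (abs_nonneg _) h0).trans_eq ?_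
  ring

end Linear

end TreeProcedure

/-! ### Perturbation of second moments and a convergence criterion. -/

theorem abs_integral_norm_add_sq_sub_le {Ω V : Type*} [MeasurableSpace Ω] [NormedAddCommGroup V]
    [InnerProductSpace ℝ V] [CompleteSpace V] {P : Measure Ω} [IsFiniteMeasure P] {a b : Ω → V}
    (ha : StronglyMeasurable a) (hb : StronglyMeasurable b) {Ma Mb : ℝ} (haM : ∀ ω, ‖a ω‖ ≤ Ma)
    (hbM : ∀ ω, ‖b ω‖ ≤ Mb) {ε : ℝ} (hε : 0 < ε) :
    |∫ ω, ‖a ω + b ω‖ ^ 2 ∂P - ∫ ω, ‖a ω‖ ^ 2 ∂P|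
      ≤ ε * ∫ ω, ‖a ω‖ ^ 2 ∂P + (1 + ε⁻¹) * ∫ ω, ‖b ω‖ ^ 2 ∂P := by
  have hsq : ∀ {g : Ω → V} {M : ℝ}, StronglyMeasurable g → (∀ ω, ‖g ω‖ ≤ M) →
      Integrable (fun ω => ‖g ω‖ ^ 2) P := fun hg hM =>
    integrable_of_bdd (hg.norm.pow 2).aestronglyMeasurable fun ω => by
      rw [norm_pow, norm_norm]
      exact pow_le_pow_left₀ (norm_nonneg _) (hM ω) 2
  have hia := hsq ha haM
  have hib := hsq hb hbM
  have hiab := hsq (ha.add hb) (M := Ma + Mb) fun ω =>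
    (norm_add_le _ _).trans (add_le_add (haM ω) (hbM ω))
  have hsub := integral_sub hiab hia
  have hadd := integral_add (hia.const_mul ε) (hib.const_mul (1 + ε⁻¹))
  rw [integral_const_mul, integral_const_mul] at hadd
  simp only [Pi.add_apply] at hsub
  rw [← hsub, ← hadd, ← Real.norm_eq_abs]
  refine norm_integral_le_of_norm_le ((hia.const_mul ε).add (hib.const_mul (1 + ε⁻¹)))
    (.of_forall fun ω => ?_)
  rw [norm_add_sq_real, Real.norm_eq_abs]
  have h1 : |⟪a ω, b ω⟫| ≤ ‖a ω‖ * ‖b ω‖ := abs_real_inner_le_norm _ _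
  -- Young's inequality with a free `ε`: the cross term costs an arbitrarily small fraction of the
  -- main term, so the correlation of noise and bias need not be controlled.
  have h2 : 2 * (‖a ω‖ * ‖b ω‖) ≤ ε * ‖a ω‖ ^ 2 + ε⁻¹ * ‖b ω‖ ^ 2 := by
    have e : ε * ‖a ω‖ ^ 2 + ε⁻¹ * ‖b ω‖ ^ 2 - 2 * (‖a ω‖ * ‖b ω‖)
        = ε * (‖a ω‖ - ε⁻¹ * ‖b ω‖) ^ 2 := by field_simp; ring
    have : 0 ≤ ε * (‖a ω‖ - ε⁻¹ * ‖b ω‖) ^ 2 := by positivity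
    linarith
  have h3 := abs_le.1 h1
  rw [abs_le]
  constructor <;> nlinarith [sq_nonneg ‖b ω‖]

/-- A sequence converges if its distance to the limit is, up to any fraction, a null sequence. -/
theorem tendsto_of_forall_abs_sub_le {u δ : ℕ → ℝ} {v K₀ : ℝ} (hδ : Tendsto δ atTop (𝓝 0))
    (h : ∀ ε > 0, ∃ K, ∀ᶠ n in atTop, |u n - v| ≤ ε * K₀ + K * δ n) : Tendsto u atTop (𝓝 v) := by
  rw [Metric.tendsto_nhds]
  intro e he
  have hK : 0 < 2 * (|K₀| + 1) := by positivity
  obtain ⟨K, hKn⟩ := h (e / (2 * (|K₀| + 1))) (by positivity)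
  have h2 : Tendsto (fun n => K * δ n) atTop (𝓝 0) := by simpa using hδ.const_mul K
  filter_upwards [hKn, h2.eventually_lt_const (show (0 : ℝ) < e / 2 by positivity)] with n h3 h4
  rw [Real.dist_eq]
  have h5 : e / (2 * (|K₀| + 1)) * K₀ ≤ e / 2 := by
    rw [div_mul_eq_mul_div, div_le_div_iff₀ hK (by norm_num)]
    nlinarith [le_abs_self K₀]
  linarith

/-! ### Lipschitz dependence of conditional variances on the covariates. -/

section Lipschitz

variable {p d : ℕ} {Q : Kernel (Cov p) (Resp d)} [IsMarkovKernel Q] {x : Cov p}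
  {H : Type*} [NormedAddCommGroup H] [InnerProductSpace ℝ H] [CompleteSpace H]
  [RKHS ℝ H (Resp d) ℝ] {V : Type*} [NormedAddCommGroup V] [InnerProductSpace ℝ V] [CompleteSpace V]

theorem dist_le_cubeDist_of_lipschitzOn {E : Type*} [SeminormedAddCommGroup E] {g : Cov p → E} {K : ℝ≥0}
    (hg : LipschitzOnWith K g (cube p)) (hx : x ∈ cube p) {u : Cov p} (hu : u ∈ cube p) :
    ‖g u - g x‖ ≤ K * cubeDist x u := by
  rw [← dist_eq_norm]
  refine (hg.dist_le_mul u hu x hx).trans (mul_le_mul_of_nonneg_left ?_ K.coe_nonneg)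
  rw [dist_eq_norm]
  exact norm_sub_le_cubeDist hx hu

theorem linVar_eq_hilbertVar (hK : KernelContinuous H) {B : ℝ} (hB : ∀ y, ‖feature H y‖ ≤ B)
    (l : H →L[ℝ] V) (u : Cov p) : linVar Q l u = hilbertVar (Q u) fun y => l (feature H y) := by
  have hi : Integrable (feature H) (Q u) :=
    integrable_of_bdd (stronglyMeasurable_feature hK).aestronglyMeasurable hB
  unfold linVar hilbertVar
  rw [l.integral_comp_comm hi]
  simp only [map_sub]
  rfl

/-- The variance is the second moment minus the squared norm of the mean. The former is Lipschitz by
hypothesis, the latter because the mean is bounded and Lipschitz. -/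
theorem linVar_lipschitz (hK : KernelContinuous H) {B : ℝ} (hB0 : 0 ≤ B) (hB : ∀ y, ‖feature H y‖ ≤ B)
    (l : H →L[ℝ] V) (hx : x ∈ cube p) {L : ℝ}
    (hL : ∀ u ∈ cube p, ‖condMean H Q u - condMean H Q x‖ ≤ L * cubeDist x u) {K : ℝ≥0}
    (hl : LipschitzOnWith K (fun u => ∫ y, ‖l (feature H y)‖ ^ 2 ∂(Q u)) (cube p)) {u : Cov p}
    (hu : u ∈ cube p) :
    |linVar Q l u - linVar Q l x| ≤ (K + 2 * (‖l‖ * B) * (‖l‖ * L)) * cubeDist x u := by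
  have hm : StronglyMeasurable fun y => l (feature H y) :=
    l.continuous.comp_stronglyMeasurable (stronglyMeasurable_feature hK)
  have hlB : ∀ {g : H}, ‖g‖ ≤ B → ‖l g‖ ≤ ‖l‖ * B := fun hg =>
    (l.le_opNorm _).trans (mul_le_mul_of_nonneg_left hg (norm_nonneg _))
  have hmean : ∀ v, ∫ y, l (feature H y) ∂(Q v) = l (condMean H Q v) := fun v =>
    l.integral_comp_comm (integrable_of_bdd (stronglyMeasurable_feature hK).aestronglyMeasurable hB)
  have hv : ∀ v, linVar Q l v = ∫ y, ‖l (feature H y)‖ ^ 2 ∂(Q v) - ‖l (condMean H Q v)‖ ^ 2 := fun v => by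
    rw [linVar_eq_hilbertVar hK hB, hilbertVar_eq_sub hm.aestronglyMeasurable fun y => hlB (hB y),
      hmean]
  have h1 := dist_le_cubeDist_of_lipschitzOn hl hx hu
  rw [Real.norm_eq_abs] at h1
  have h2 : |‖l (condMean H Q u)‖ ^ 2 - ‖l (condMean H Q x)‖ ^ 2|
      ≤ 2 * (‖l‖ * B) * (‖l‖ * L) * cubeDist x u := by
    rw [sq_sub_sq, abs_mul, mul_assoc]
    refine mul_le_mul ?_ ?_ (abs_nonneg _) (by positivity)
    · rw [abs_of_nonneg (by positivity), two_mul]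
      exact add_le_add (hlB (norm_condMean_le hB u)) (hlB (norm_condMean_le hB x))
    · refine (abs_norm_sub_norm_le _ _).trans ?_
      rw [← map_sub]
      refine (l.le_opNorm _).trans ?_
      rw [mul_assoc]
      exact mul_le_mul_of_nonneg_left (hL u hu) (norm_nonneg _)
  rw [hv, hv, sub_sub_sub_comm, add_mul]
  exact (abs_sub _ _).trans (add_le_add h1 h2)

end Lipschitz

/-! ### Variance of linear images of the projected tree. -/

namespace TreeProcedure

variable {p d s : ℕ} (A : TreeProcedure p d s) {x : Cov p}
  {ν : Measure (Cov p)} [IsProbabilityMeasure ν] {Q : Kernel (Cov p) (Resp d)} [IsMarkovKernel Q]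
  {H : Type*} [NormedAddCommGroup H] [InnerProductSpace ℝ H] [CompleteSpace H]
  [RKHS ℝ H (Resp d) ℝ] {V : Type*} [NormedAddCommGroup V] [InnerProductSpace ℝ V] [CompleteSpace V]
  (l : H →L[ℝ] V)

/-- The centered projection of a tree onto one observation. -/
theorem hilbertVar_map_proj (hK : KernelContinuous H) {B : ℝ} (hB0 : 0 ≤ B)
    (hB : ∀ y, ‖feature H y‖ ≤ B) (hhon : A.Honest) (i : Fin s) :
    hilbertVar (sampleLaw s ν Q) (fun z => l (A.proj H ν Q x i z))
      = ∫ w, ‖l (A.noisePart x ν Q H i w) + l (marg (ν ⊗ₘ Q) (A.biasPart x Q H) i w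
          - ∫ w', marg (ν ⊗ₘ Q) (A.biasPart x Q H) i w' ∂(ν ⊗ₘ Q))‖ ^ 2 ∂(ν ⊗ₘ Q) := by
  have hTm := A.stronglyMeasurable_T (x := x) hK
  have hTi : Integrable (A.T H x) (Measure.pi fun _ => ν ⊗ₘ Q) :=
    integrable_of_bdd hTm.aestronglyMeasurable (A.norm_T_le hB0 hB)
  have hFi : Integrable (A.biasPart x Q H) (Measure.pi fun _ => ν ⊗ₘ Q) :=
    integrable_of_bdd (A.stronglyMeasurable_biasPart hK).aestronglyMeasurable
      (A.norm_biasPart_le hB0 hB)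
  have hmT : StronglyMeasurable (marg (ν ⊗ₘ Q) (A.T H x) i) := by
    unfold marg
    exact (hTm.comp_measurable (measurable_update_pair i)).integral_prod_left'
  set e := ∫ z, A.T H x z ∂(sampleLaw s ν Q) with he
  set g : Obs p d → V := fun w => l (marg (ν ⊗ₘ Q) (A.T H x) i w - e) with hg
  have hgm : StronglyMeasurable g :=
    l.continuous.comp_stronglyMeasurable (hmT.sub stronglyMeasurable_const)
  have h1 : (fun z => l (A.proj H ν Q x i z)) =ᵐ[sampleLaw s ν Q] fun z => g (z i) := by
    filter_upwards [condExp_eval_ae_eq hTi i] with z hz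
    unfold proj sampleLaw
    rw [hz]
    rfl
  rw [hilbertVar_congr h1]
  have h2 : hilbertVar (sampleLaw s ν Q) (fun z => g (z i)) = hilbertVar (ν ⊗ₘ Q) g :=
    hilbertVar_eval i hgm
  rw [h2]
  have hTme := integrable_marg hTi i
  have hFme := integrable_marg hFi i
  have h3 : ∫ w, g w ∂(ν ⊗ₘ Q) = 0 := by
    simp only [hg]
    have hsubI : Integrable (fun w => marg (ν ⊗ₘ Q) (A.T H x) i w - e) (ν ⊗ₘ Q) :=
      hTme.sub (integrable_const _)
    rw [l.integral_comp_comm hsubI, integral_sub hTme (integrable_const _), integral_marg hTi]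
    simp [he, sampleLaw]
  unfold hilbertVar
  rw [h3]
  refine integral_congr_ae (.of_forall fun w => ?_)
  -- The noise has mean zero, so subtracting the mean of the tree removes `condMean H Q x` and
  -- centres only the bias.
  have h4 : e = ∫ w', marg (ν ⊗ₘ Q) (A.biasPart x Q H) i w' ∂(ν ⊗ₘ Q) + condMean H Q x := by
    have hni : Integrable (A.noisePart x ν Q H i) (ν ⊗ₘ Q) :=
      integrable_of_bdd (A.stronglyMeasurable_noisePart hK i).aestronglyMeasurable
        (A.norm_noisePart_le hB0 hB i)
    have h5 : e = ∫ w, marg (ν ⊗ₘ Q) (A.T H x) i w ∂(ν ⊗ₘ Q) := (integral_marg hTi i).symm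
    have hadd : Integrable (fun w => A.noisePart x ν Q H i w
      + marg (ν ⊗ₘ Q) (A.biasPart x Q H) i w) (ν ⊗ₘ Q) := hni.add hFme
    rw [h5]
    simp_rw [A.marg_T hK hB0 hB hhon i]
    rw [integral_add hadd (integrable_const _), integral_add hni hFme,
      A.integral_noisePart hK hB hhon i, zero_add]
    simp
  simp only [hg, sub_zero]
  rw [A.marg_T hK hB0 hB hhon i w, h4, ← map_add]
  congr 3
  abel

/-- The variance of the projection of a tree in terms of the second moment of the shares. -/
theorem abs_hilbertVar_map_proj_sub_le (hK : KernelContinuous H) {B : ℝ} (hB0 : 0 ≤ B)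
    (hB : ∀ y, ‖feature H y‖ ≤ B) (hx : x ∈ cube p) (hhon : A.Honest) (hsym : A.Symmetric ν Q)
    (hs : 0 < s) (hone : ∀ᵐ z ∂(sampleLaw s ν Q), ∑ i, A.meanWeight x i z = 1)
    (hcube : ∀ᵐ z ∂(sampleLaw s ν Q), ∀ i, (z i).1 ∈ cube p) {L : ℝ}
    (hL : ∀ u ∈ cube p, ‖condMean H Q u - condMean H Q x‖ ≤ L * cubeDist x u) {L' : ℝ}
    (hL' : ∀ u ∈ cube p, |linVar Q l u - linVar Q l x| ≤ L' * cubeDist x u) (i : Fin s) {ε : ℝ}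
    (hε : 0 < ε) :
    |hilbertVar (sampleLaw s ν Q) (fun z => l (A.proj H ν Q x i z)) - linVar Q l x * A.shareSq x ν Q i|
      ≤ ε * (‖l‖ * (2 * B)) ^ 2 * A.shareSq x ν Q i
        + (L' + (1 + ε⁻¹) * (‖l‖ ^ 2 * (2 * B * L))) * (A.meanDist x ν Q / s) := by
  have hs' : (0 : ℝ) < s := by exact_mod_cast hs
  set F := A.biasPart x Q H with hF
  set R : Obs p d → H := fun w => marg (ν ⊗ₘ Q) F i w - ∫ w', marg (ν ⊗ₘ Q) F i w' ∂(ν ⊗ₘ Q) with hR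
  have hmF : StronglyMeasurable (marg (ν ⊗ₘ Q) F i) := by
    unfold marg
    exact ((A.stronglyMeasurable_biasPart hK).comp_measurable
      (measurable_update_pair i)).integral_prod_left'
  have hRm : StronglyMeasurable R := hmF.sub stronglyMeasurable_const
  have hmFB : ∀ w, ‖marg (ν ⊗ₘ Q) F i w‖ ≤ 2 * B := marg_norm_le (A.norm_biasPart_le hB0 hB) i
  have hRB : ∀ w, ‖R w‖ ≤ 2 * B + 2 * B := fun w => by
    refine (norm_sub_le _ _).trans (add_le_add (hmFB w) ?_)
    refine (norm_integral_le_of_norm_le_const (.of_forall hmFB)).trans ?_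
    simp
  have hlB : ∀ {g : H} {M : ℝ}, ‖g‖ ≤ M → ‖l g‖ ≤ ‖l‖ * M := fun hg =>
    (l.le_opNorm _).trans (mul_le_mul_of_nonneg_left hg (norm_nonneg _))
  have h1 := abs_integral_norm_add_sq_sub_le (P := ν ⊗ₘ Q)
    (l.continuous.comp_stronglyMeasurable (A.stronglyMeasurable_noisePart (x := x) (ν := ν) (Q := Q) hK i))
    (l.continuous.comp_stronglyMeasurable hRm)
    (fun w => hlB (A.norm_noisePart_le hB0 hB i w)) (fun w => hlB (hRB w)) hε
  have h2 := A.hilbertVar_map_proj (x := x) (ν := ν) (Q := Q) l hK hB0 hB hhon i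
  have hcube' : ∀ᵐ w ∂(ν ⊗ₘ Q), w.1 ∈ cube p := by
    have hmp := measurePreserving_eval (fun _ : Fin s => ν ⊗ₘ Q) i
    have h : ∀ᵐ z ∂(sampleLaw s ν Q), (Function.eval i z).1 ∈ cube p := hcube.mono fun z hz => hz i
    rw [← hmp.map_eq]
    exact (ae_map_iff hmp.measurable.aemeasurable (measurable_fst (measurableSet_cube p))).2 h
  have h3 := A.abs_integral_noisePart_sq_sub_le hK hB0 hB l hx hhon hsym hs hcube' hL' i
  have h4 := A.mul_hilbertVar_biasPart_le hK hB0 hB hx hsym hone hcube hL i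
  -- This expresses the `ε`-fraction of the noise lost in `h1` as a multiple of `shareSq`.
  have h5 : ∫ w, ‖l (A.noisePart x ν Q H i w)‖ ^ 2 ∂(ν ⊗ₘ Q)
      ≤ (‖l‖ * (2 * B)) ^ 2 * A.shareSq x ν Q i := by
    unfold shareSq
    rw [← integral_const_mul]
    refine integral_mono_of_nonneg (.of_forall fun w => sq_nonneg _)
      ((A.integrable_share_sq i).const_mul _) (.of_forall fun w => ?_)
    simp only [noisePart]
    rw [map_smul, norm_smul, mul_pow, Real.norm_eq_abs, sq_abs, mul_comm]
    exact mul_le_mul_of_nonneg_right (pow_le_pow_left₀ (norm_nonneg _)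
      (norm_map_resid_le hB l _ _) 2) (sq_nonneg _)
  have h6 : ∫ w, ‖l (R w)‖ ^ 2 ∂(ν ⊗ₘ Q) ≤ ‖l‖ ^ 2 * (2 * B * L) * (A.meanDist x ν Q / s) := by
    have h7 : ∫ w, ‖l (R w)‖ ^ 2 ∂(ν ⊗ₘ Q) ≤ ‖l‖ ^ 2 * hilbertVar (ν ⊗ₘ Q) (marg (ν ⊗ₘ Q) F i) := by
      unfold hilbertVar
      rw [← integral_const_mul]
      have hRi : Integrable (fun w => ‖R w‖ ^ 2) (ν ⊗ₘ Q) :=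
        integrable_of_bdd (hRm.norm.pow 2).aestronglyMeasurable (M := (2 * B + 2 * B) ^ 2) fun w => by
          rw [norm_pow, norm_norm]
          exact pow_le_pow_left₀ (norm_nonneg _) (hRB w) 2
      refine integral_mono_of_nonneg (.of_forall fun w => sq_nonneg _) (hRi.const_mul _)
        (.of_forall fun w => ?_)
      simp only
      rw [← mul_pow]
      exact pow_le_pow_left₀ (norm_nonneg _) (l.le_opNorm _) 2
    refine h7.trans ?_
    rw [mul_assoc]
    refine mul_le_mul_of_nonneg_left ?_ (sq_nonneg _)
    rw [mul_div_assoc', le_div_iff₀ hs', mul_comm]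
    exact h4
  rw [h2]
  have h8 := mul_le_mul_of_nonneg_left h5 hε.le
  have h9 := mul_le_mul_of_nonneg_left h6 (show 0 ≤ 1 + ε⁻¹ by positivity)
  refine (abs_sub_le _ _ _).trans ((add_le_add h1 h3).trans ?_)
  linarith

end TreeProcedure

/-! ### Convergence of the variance ratio. -/

theorem SubsampleRate.tendsto {p : ℕ} {α π β : ℝ} {s : ℕ → ℕ} (hα : 0 < α) (hα1 : α < 1) (hπ : 0 < π)
    (h : SubsampleRate p α π β s) : 0 < p ∧ Tendsto s atTop atTop := by
  obtain ⟨h1, h2, h3⟩ := h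
  have hl1 : 0 ≤ Real.log ((1 - α)⁻¹) :=
    Real.log_nonneg ((one_le_inv₀ (by linarith)).2 (by linarith))
  have hl2 : 0 ≤ Real.log (α⁻¹) := Real.log_nonneg ((one_le_inv₀ hα).2 hα1.le)
  constructor
  · by_contra hp
    have hp0 : p = 0 := by omega
    subst hp0
    simp at h2
    linarith
  · have hβ : 0 < β := lt_of_le_of_lt (inv_nonneg.2 (by positivity)) h2
    have ht : Tendsto (fun n : ℕ => (n : ℝ) ^ β - 1) atTop atTop :=
      tendsto_atTop_add_const_right _ (-1)
        ((tendsto_rpow_atTop hβ).comp tendsto_natCast_atTop_atTop)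
    rw [← tendsto_natCast_atTop_iff (R := ℝ)]
    refine tendsto_atTop_mono' _ ?_ ht
    filter_upwards [eventually_ge_atTop 1] with n hn
    linarith [(abs_lt.1 (h3 n hn)).1]

/-- The variance of a linear image of the projection of a tree, relative to the second moment of the
shares. -/
theorem tendsto_hilbertVar_map_proj_div {p d : ℕ} {H : Type*} [NormedAddCommGroup H]
    [InnerProductSpace ℝ H] [CompleteSpace H] [RKHS ℝ H (Resp d) ℝ]
    {V : Type*} [NormedAddCommGroup V] [InnerProductSpace ℝ V] [CompleteSpace V] (l : H →L[ℝ] V)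
    {ν : Measure (Cov p)} [IsProbabilityMeasure ν] {Q : Kernel (Cov p) (Resp d)} [IsMarkovKernel Q]
    {x : Cov p} (hx : x ∈ cube p) {α π : ℝ} {κ : ℕ} (hα : 0 < α) (hα1 : α < 1) (hπ : 0 < π) (hκ : 1 ≤ κ)
    (hp : 0 < p) {s : ℕ → ℕ} (hs : ∀ n, 0 < s n) (hs' : Tendsto s atTop atTop)
    (A : ∀ n, TreeProcedure p d (s n)) (hhon : ∀ n, (A n).Honest)
    (hrs : ∀ n, (A n).RandomSplit ν Q π) (hsym : ∀ n, (A n).Symmetric ν Q)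
    (hreg : ∀ n, (A n).AlphaRegular ν Q α κ) (hν : HasBoundedDensity ν)
    (hK : KernelContinuous H) {B : ℝ} (hB0 : 0 ≤ B) (hB : ∀ y, ‖feature H y‖ ≤ B)
    (hmean : ∃ K : ℝ≥0, LipschitzOnWith K (condMean H Q) (cube p))
    (hl : ∃ K : ℝ≥0, LipschitzOnWith K (fun u => ∫ y, ‖l (feature H y)‖ ^ 2 ∂(Q u)) (cube p)) :
    Tendsto (fun n => hilbertVar (sampleLaw (s n) ν Q) (fun z => l ((A n).proj H ν Q x ⟨0, hs n⟩ z))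
      / (A n).shareSq x ν Q ⟨0, hs n⟩) atTop (𝓝 (linVar Q l x)) := by
  obtain ⟨K₁, hK₁⟩ := hmean
  obtain ⟨K₂, hK₂⟩ := hl
  obtain ⟨hpos, hδ⟩ := tendsto_meanDist_div hp hx hα hα1 hπ hκ hs hs' A hrs hsym hreg hν
  obtain ⟨-, C, -, -, -, hνC⟩ := measure_cell_bounds hν
  have hL : ∀ u ∈ cube p, ‖condMean H Q u - condMean H Q x‖ ≤ K₁ * cubeDist x u := fun u hu =>
    dist_le_cubeDist_of_lipschitzOn hK₁ hx hu
  -- After division by `shareSq` the noise error is `ε` times a constant, and all remaining errors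
  -- are a constant, depending on `ε`, times the null sequence `hδ`.
  refine tendsto_of_forall_abs_sub_le (K₀ := (‖l‖ * (2 * B)) ^ 2) hδ fun ε hε =>
    ⟨K₂ + 2 * (‖l‖ * B) * (‖l‖ * K₁) + (1 + ε⁻¹) * (‖l‖ ^ 2 * (2 * B * K₁)), ?_⟩
  filter_upwards [hpos, hs'.eventually_ge_atTop (2 * κ)] with n hE hn
  have hs0 : (0 : ℝ) < s n := by exact_mod_cast hs n
  have h := (A n).abs_hilbertVar_map_proj_sub_le l hK hB0 hB hx (hhon n) (hsym n) (hs n)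
    ((A n).sum_meanWeight_ae_eq_one x hκ (by omega) (hreg n)) (TreeProcedure.ae_mem_cube hνC)
    hL (fun u hu => linVar_lipschitz hK hB0 hB l hx hL hK₂ hu) ⟨0, hs n⟩ hε
  generalize (A n).shareSq x ν Q ⟨0, hs n⟩ = E at *
  have e : ∀ a : ℝ, a / E - linVar Q l x = (a - linVar Q l x * E) / E := fun a => by field_simp
  rw [e, abs_div, abs_of_pos hE, div_le_iff₀ hE]
  refine h.trans_eq ?_
  field_simp

end DRF

theorem mainTheorem8 {p d : ℕ}
    {H : Type*} [NormedAddCommGroup H] [InnerProductSpace ℝ H] [CompleteSpace H]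
    [RKHS ℝ H (DRF.Resp d) ℝ]
    -- the law of the covariates, the conditional law of the response, the test point
    (ν : MeasureTheory.Measure (DRF.Cov p)) [MeasureTheory.IsProbabilityMeasure ν]
    (Q : ProbabilityTheory.Kernel (DRF.Cov p) (DRF.Resp d)) [ProbabilityTheory.IsMarkovKernel Q]
    (x : DRF.Cov p) (hx : x ∈ DRF.cube p)
    -- the forest: subsample sizes and tree-growing procedures
    (α π β : ℝ) (κ : ℕ) (hα : 0 < α) (hα' : α ≤ 0.2) (hπ : 0 < π) (hκ : 1 ≤ κ)
    (s : ℕ → ℕ) (hs : ∀ n, 0 < s n)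
    (A : ∀ n, DRF.TreeProcedure p d (s n))
    (hF1 : ∀ n, (A n).Honest)
    (hF2 : ∀ n, (A n).RandomSplit ν Q π)
    (hF3 : ∀ n, (A n).Symmetric ν Q)
    (hF4 : ∀ n, (A n).AlphaRegular ν Q α κ)
    (hF5 : DRF.SubsampleRate p α π β s)
    (hF1' : DRF.HonestyStar H ν Q x s A)
    (hD : DRF.DataConditions H ν Q x)
    (hK1 : DRF.KernelBounded H) (hK2 : DRF.KernelContinuous H) :
    ∀ f : H, f ≠ 0 →
      Filter.Tendsto
        (fun n =>
          Var[fun z => inner ℝ ((A n).proj H ν Q x ⟨0, hs n⟩ z) f; DRF.sampleLaw (s n) ν Q] /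
            DRF.hilbertVar (DRF.sampleLaw (s n) ν Q) ((A n).proj H ν Q x ⟨0, hs n⟩))
        Filter.atTop
        (nhds (Var[fun y => f y; Q x] / DRF.condVar H Q x)) ∧
      0 < Var[fun y => f y; Q x] / DRF.condVar H Q x := by
  intro f hf
  have hα1 : α < 1 := by norm_num at hα'; linarith
  refine ⟨?_, div_pos (hD.eval_var_pos f hf) hD.var_pos⟩
  obtain ⟨B, hB0, hB⟩ := DRF.exists_norm_feature_le hK1
  obtain ⟨hp, hs'⟩ := hF5.tendsto hα hα1 hπ
  -- By the reproducing property, pairing with `f` turns the feature into evaluation of `f`; this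
  -- makes the Lipschitz condition on `E[|f(Y)|² | X = u]` the one required for `l = innerSL ℝ f`.
  have hfeat : ∀ y, innerSL ℝ f (DRF.feature H y) = f y := fun y => DRF.inner_feature f y
  have hnum := DRF.tendsto_hilbertVar_map_proj_div (innerSL ℝ f) hx hα hα1 hπ hκ hp hs hs' A hF1 hF2 hF3
    hF4 hD.density hK2 hB0 hB hD.mean_lipschitz
    (by simpa only [hfeat, Real.norm_eq_abs, sq_abs] using hD.eval_second_moment_lipschitz f hf)
  have hden := DRF.tendsto_hilbertVar_map_proj_div (ContinuousLinearMap.id ℝ H) hx hα hα1 hπ hκ hp hs hs'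
    A hF1 hF2 hF3 hF4 hD.density hK2 hB0 hB hD.mean_lipschitz hD.second_moment_lipschitz
  have hpos := (DRF.tendsto_meanDist_div hp hx hα hα1 hπ hκ hs hs' A hF2 hF3 hF4 hD.density).1
  have hfm : Measurable fun y => f y := by
    simp only [← hfeat]
    exact ((innerSL ℝ f).continuous.comp_stronglyMeasurable
      (DRF.stronglyMeasurable_feature hK2)).measurable
  rw [DRF.linVar_eq_hilbertVar hK2 hB] at hnum hden
  simp only [hfeat] at hnum
  rw [← DRF.variance_eq_hilbertVar hfm.aemeasurable] at hnum
  -- Both variances are normalised by the same `shareSq`, which is eventually positive and cancels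
  -- in the quotient.
  refine (hnum.div hden hD.var_pos.ne').congr' ?_
  filter_upwards [hpos] with n hE
  have hprojm : StronglyMeasurable ((A n).proj H ν Q x ⟨0, hs n⟩) :=
    (stronglyMeasurable_condExp.mono (measurable_pi_apply _).comap_le).sub stronglyMeasurable_const
  rw [DRF.variance_eq_hilbertVar (hprojm.inner stronglyMeasurable_const).measurable.aemeasurable]
  simp only [Pi.div_apply, innerSL_apply_apply, ContinuousLinearMap.id_apply, real_inner_comm f]
  exact div_div_div_cancel_right₀ hE.ne' _ _
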